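/- **Setting.** Let $\kappa_1<\dots<\kappa_n$ be real numbers such that, for each $2\le d\le k$, the sums of $d$ distinct $\kappa_j$ are pairwise distinct. Let $S_\pi^{tnn}$ be an irreducible positroid cell of $(Gr_{kn})_{\ge 0}$: it consists of the points represented by full-rank $k\times n$ matrices $A$ with $\Delta_J(A)>0$ for $J\in\mathcal M$ and $\Delta_J(A)=0$ for the other $k$-subsets $J$ of $[n]$; irreducible means that the reduced row echelon form of each point has no zero column and, in every row, a nonzero entry besides the pivot. The cell is indexed by the derangement $\pi\in S_n$ with $\pi(j)=i$ whenever $I_{i+1}=(I_i\setminus\{i\})\cup\{j\}$ (indices mod $n$), where $I_r$ is the lexicographically minimal element of $\mathcal M$ for the order $r<r+1<\dots<n<1<\dots<r-1$. **Contour plot and soliton graph.** For a point $A$ of the cell and $t\in\mathbb R$ let $$f_A(x,y)=\max_{J\in\mathcal M}\Big\{\ln\big(\Delta_J(A)K_J\big)+\sum_{j\in J}(\kappa_jx+\kappa_j^2y+\kappa_j^3t)\Big\},\qquad K_J=\prod_{l<m,\ l,m\in J}(\kappa_m-\kappa_l).$$ The contour plot is the locus in $\mathbb R^2$ where $f_A$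 is not locally linear. Each region of its complement is labelled by the $J$ whose term is dominant there (the dominant exponential $E_J$). A line-soliton of type $[i,j]$ is a segment, ray or line of the contour plot separating regions labelled $S\cup\{i\}$ and $S\cup\{j\}$ with $|S|=k-1$. The remaining points of the contour plot are the points where line-solitons meet, together with phase-shift segments (between regions whose labels differ in more than one element). The connected components of this remaining set are called interactions, and each is regarded as one point; that is, phase-shifts are ignored. Assume that the contour plot is generic: each interaction is either * a trivalent vertex: a single point, in the closure of exactly three regions, with no phase-shift segment at it; or * an $X$-crossing: it touches the closures of exactly four regions, consecutive ones (in the cyclic order around it) are separated by line-solitons ending at it, and opposite ones of these four line-solitons have the same type, so that two line-solitons cross there. Colour a trivalent vertex black (white) if a unique edge extends downwards (upwards) from it. The resulting graph, in the plane viewed as an open disk, with the unbounded line-solitons ending at boundary vertices, with edges labelled by the types of the line-solitons and regions labelled by the dominant exponentials, is the soliton graph $C$. **Generalized plabic graph.** $Pl(C)$ is obtained from $C$ by forgetting the labels of edges and regions and labelling by $\pi(i)$ the boundary vertex of the unbounded line-soliton of type $\{i,\pi(i)\}$ which extends to $y=+\infty$ if $\pi(i)>i$ and to $y=-\infty$ if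 $\pi(i)<i$. In $Pl(C)$ the trip $T_i$ starts at the boundary vertex labelled $i$, turns right at black vertices, turns left at white vertices, and goes straight through $X$-crossings. **Theorem.** For every such $A$ and $t$ with generic contour plot: 1. The boundary labelling of $Pl(C)$ is well defined and bijective: for each $m\in[n]$ exactly one unbounded end of a line-soliton gets the label $m$, and every unbounded end gets exactly one label. 2. The trip permutation of $Pl(C)$ is $\pi$: for each $i$ the trip $T_i$ ends at the boundary vertex labelled $\pi(i)$, and at no other. 3. If, for each $i$, every edge on $T_i$ is labelled with $i$, then the set of labels obtained by each edge is exactly $\{a,b\}$, where $[a,b]$ is the type of the line-soliton in $C$. 4. If, for each $i$, an $i$ is placed in every region to the left of $T_i$, then the set of labels obtained by each region is exactly the index set $J$ of its dominant exponential $E_J$ in $C$. -/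

import Mathlib

open Topology

noncomputable section

namespace KPSoliton

/-! ### The totally non-negative Grassmannian and its positroid cells -/

/-- The maximal minor of `A` in the columns `J` (taken in increasing order). -/
def minor {k n : ℕ} (A : Matrix (Fin k) (Fin n) ℝ) (J : Finset (Fin n)) : ℝ :=
  if h : J.card = k then (A.submatrix id (J.orderEmbOfFin h)).det else 0

/-- Matrices representing the points of the positroid cell of `M`: full rank, the minors indexed by
`M` are positive and all the other maximal minors vanish. -/
def positroidCell (k : ℕ) {n : ℕ} (M : Finset (Finset (Fin n))) :
    Set (Matrix (Fin k) (Fin n) ℝ) :=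
  {A | A.rank = k ∧ (∀ J ∈ M, 0 < minor A J) ∧
    ∀ J : Finset (Fin n), J.card = k → J ∉ M → minor A J = 0}

/-- `B` is in reduced row echelon form, of full row rank, with pivot of row `i` in column `p i`. -/
def IsRREF {k n : ℕ} (B : Matrix (Fin k) (Fin n) ℝ) (p : Fin k → Fin n) : Prop :=
  StrictMono p ∧ (∀ i, B i (p i) = 1) ∧ (∀ i j, j < p i → B i j = 0) ∧
    ∀ i i', i' ≠ i → B i' (p i) = 0

/-- Irreducibility of the cell of `M`: the reduced row echelon form of each of its points has no
zero column, and each of its rows has a nonzero entry besides the pivot. -/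
def IrreducibleCell (k : ℕ) {n : ℕ} (M : Finset (Finset (Fin n))) : Prop :=
  ∀ A ∈ positroidCell k M, ∃ (B : Matrix (Fin k) (Fin n) ℝ) (p : Fin k → Fin n),
    IsRREF B p ∧ (∃ g : Matrix (Fin k) (Fin k) ℝ, IsUnit g.det ∧ B = g * A) ∧
      (∀ j, ∃ i, B i j ≠ 0) ∧ ∀ i, ∃ j, j ≠ p i ∧ B i j ≠ 0

/-- `I` is the lexicographically minimal element of `M` for the order
`r < r + 1 < ⋯ < n < 1 < ⋯ < r - 1`, in which `j` has position `(j - r) mod n`. (For sets of equal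
size, `I` precedes `J ≠ I` lexicographically iff the first element of their symmetric difference
lies in `I`.) -/
def IsLexMin {n : ℕ} (M : Finset (Finset (Fin n))) (r : Fin n) (I : Finset (Fin n)) : Prop :=
  I ∈ M ∧ ∀ J ∈ M, J ≠ I → ∃ a ∈ I \ J, ∀ b ∈ J \ I, (a - r).val < (b - r).val

/-- `π` is the derangement indexing the cell of `M`: if `(I_1, …, I_n)` is the Grassmann necklace
of `M` and `I_{i+1} = (I_i \ {i}) ∪ {j}`, `j ≠ i` (indices mod `n`), then `π j = i`. -/
def IsCellPermutation {n : ℕ} (M : Finset (Finset (Fin n))) (π : Equiv.Perm (Fin n)) : Prop :=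
  (∀ i, π i ≠ i) ∧ ∃ I : Fin n → Finset (Fin n), (∀ r, IsLexMin M r (I r)) ∧
    ∀ i j, π j = i → I (finRotate n i) = insert j ((I i).erase i)

/-- Genericity of the parameters: for `2 ≤ d ≤ k` the sums of `d` of the `κ_j` are distinct. -/
def GenericParameters (k : ℕ) {n : ℕ} (κ : Fin n → ℝ) : Prop :=
  ∀ d, 2 ≤ d → d ≤ k → ∀ I J : Finset (Fin n), I.card = d → J.card = d →
    ∑ i ∈ I, κ i = ∑ j ∈ J, κ j → I = J

/-! ### Generalized plabic graphs, trips, and the labels they induce -/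

/-- The nodes of the drawing of a generalized plabic graph: black and white vertices, and
`X`-crossings. -/
inductive NodeKind
  | black
  | white
  | crossing

/-- The combinatorial data (rotation system) of a generalized plabic graph drawn in a disk, with
boundary vertices labelled by `Fin n`. Edges are cut at the `X`-crossings; a dart is such a piece
with one of its two directions. -/
structure PlabicGraph (n : ℕ) where
  /-- the directed pieces of edges -/
  Dart : Type
  /-- the internal vertices and the `X`-crossings -/
  Node : Type
  /-- the regions of the drawing -/
  Region : Type
  /-- the opposite direction -/
  rev : Dart → Dart
  /-- `d` leaves the node `v` -/
  tail : Dart → Node → Prop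
  /-- `d` and `d'` leave the same node, and `d'` is next to `d` in counterclockwise order -/
  ccw : Dart → Dart → Prop
  /-- colours of the vertices -/
  kind : Node → NodeKind
  /-- the region immediately to the left of a dart -/
  left : Dart → Region
  /-- `d` starts at the boundary vertex labelled `i` -/
  boundary : Fin n → Dart → Prop

namespace PlabicGraph

variable {n : ℕ} (G : PlabicGraph n)

/-- The rules of the road: `d'` follows `d` if `d` enters the node that `d'` leaves, turning right
at a black vertex (from the backward direction, the next dart counterclockwise), turning left at a
white vertex (the next one clockwise), and going straight through an `X`-crossing (the opposite one
of the four). -/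
def Next (d d' : G.Dart) : Prop :=
  ∃ v, G.tail (G.rev d) v ∧ G.tail d' v ∧
    match G.kind v with
    | .black => G.ccw (G.rev d) d'
    | .white => G.ccw d' (G.rev d)
    | .crossing => ∃ e, G.ccw (G.rev d) e ∧ G.ccw e d'

/-- `d` belongs to the trip `T_i` starting at the boundary vertex `i`. -/
def InTrip (i : Fin n) (d : G.Dart) : Prop :=
  ∃ s, G.boundary i s ∧ Relation.ReflTransGen G.Next s d

/-- The trip `T_i` ends at the boundary vertex `j`. -/
def TripEndsAt (i j : Fin n) : Prop :=
  ∃ d, G.InTrip i d ∧ G.boundary j (G.rev d)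

/-- The edge carrying the dart `d` receives the label `i`: it lies on the trip `T_i`. -/
def EdgeHasLabel (i : Fin n) (d : G.Dart) : Prop :=
  G.InTrip i d ∨ G.InTrip i (G.rev d)

/-- The region `R` receives the label `i`: it is in the part of the disk to the left of `T_i`, i.e.
one gets to `R` from a region immediately to the left of `T_i` without crossing `T_i`. -/
def RegionHasLabel (i : Fin n) (R : G.Region) : Prop :=
  ∃ d, G.InTrip i d ∧
    Relation.ReflTransGen
      (fun P Q => ∃ e, ¬ G.EdgeHasLabel i e ∧ G.left e = P ∧ G.left (G.rev e) = Q) (G.left d) R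

end PlabicGraph

/-! ### Contour plots and soliton graphs -/

/-- The type `{i, j}` of the line-soliton between regions with dominant exponentials `E_L` and
`E_R`: the two indices in which `L` and `R` differ. -/
def solitonType {n : ℕ} (L R : Finset (Fin n)) : Finset (Fin n) :=
  symmDiff L R

/-- The data from which a contour plot is made: the parameters `κ`, the matrix `A`, the time `t`. -/
structure Data (k n : ℕ) where
  /-- the parameters -/
  κ : Fin n → ℝ
  /-- the matrix -/
  A : Matrix (Fin k) (Fin n) ℝ
  /-- the time -/
  t : ℝ

namespace Data

variable {k n : ℕ} (C : Data k n)

/-- The index sets of the nonzero minors of `A`. -/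
def bases : Finset (Finset (Fin n)) :=
  {J ∈ Finset.powersetCard k Finset.univ | minor C.A J ≠ 0}

/-- The Vandermonde factor `K_J = ∏ (κ_m - κ_l)`, over `l < m` in `J`. -/
def vandermonde (J : Finset (Fin n)) : ℝ :=
  ∏ p ∈ (J ×ˢ J).filter (fun p => p.1 < p.2), (C.κ p.2 - C.κ p.1)

/-- The logarithm of the term `Δ_J(A) E_J` of the `τ`-function at `p = (x, y)` and time `t`. -/
def logTerm (J : Finset (Fin n)) (p : ℝ × ℝ) : ℝ :=
  Real.log (minor C.A J * C.vandermonde J) +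
    ∑ j ∈ J, (C.κ j * p.1 + C.κ j ^ 2 * p.2 + C.κ j ^ 3 * C.t)

/-- The maximum `f_A` of the logarithms of the terms of the `τ`-function. -/
def tropicalTau (p : ℝ × ℝ) : ℝ :=
  ⨆ J : {J // J ∈ C.bases}, C.logTerm J.1 p

/-- The contour plot: the locus where `f_A` is not (locally) linear. -/
def contourPlot : Set (ℝ × ℝ) :=
  {p | ¬ ∃ a b c : ℝ, ∀ᶠ q in 𝓝 p, C.tropicalTau q = a * q.1 + b * q.2 + c}

/-- The region of the complement of the contour plot in which `E_J` is the dominant exponential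
(empty if there is no such region). -/
def region (J : Finset (Fin n)) : Set (ℝ × ℝ) :=
  {p | J ∈ C.bases ∧ ∀ I ∈ C.bases, I ≠ J → C.logTerm I p < C.logTerm J p}

/-- The complement of the contour plot is the disjoint union of the regions, which are convex. -/
theorem contourPlot_compl (hκ : StrictMono C.κ) (hgen : GenericParameters k C.κ)
    (hne : C.bases.Nonempty) :
    C.contourPlotᶜ = ⋃ J, C.region J := by
  have hinj : ∀ I ∈ C.bases, ∀ J ∈ C.bases, ∑ i ∈ I, C.κ i = ∑ j ∈ J, C.κ j → I = J := by
    intro I hI J hJ h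
    have h1 : I.card = k := by simp [bases] at hI; exact hI.1
    have h2 : J.card = k := by simp [bases] at hJ; exact hJ.1
    rcases Nat.lt_or_ge k 2 with hk | hk
    · interval_cases k
      · rw [Finset.card_eq_zero.1 h1, Finset.card_eq_zero.1 h2]
      · obtain ⟨a, rfl⟩ := Finset.card_eq_one.1 h1
        obtain ⟨b, rfl⟩ := Finset.card_eq_one.1 h2
        simp at h
        rw [hκ.injective h]
    · exact hgen k hk le_rfl I J h1 h2 h
  have hphi : ∀ J (p q : ℝ × ℝ), C.logTerm J q = C.logTerm J p +
      (∑ j ∈ J, C.κ j) * (q.1 - p.1) + (∑ j ∈ J, C.κ j ^ 2) * (q.2 - p.2) := by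
    intro J p q
    simp only [logTerm, Finset.sum_add_distrib, ← Finset.sum_mul]
    ring
  have hle : ∀ J ∈ C.bases, ∀ q, C.logTerm J q ≤ C.tropicalTau q := fun J hJ q =>
    le_ciSup (f := fun J : {J // J ∈ C.bases} => C.logTerm J.1 q) (Set.finite_range _).bddAbove ⟨J, hJ⟩
  have : Nonempty {J // J ∈ C.bases} := hne.to_subtype
  ext p
  simp only [contourPlot, Set.mem_compl_iff, Set.mem_ofPred_eq, not_not, Set.mem_iUnion]
  constructor
  · rintro ⟨a, b, c, h⟩
    obtain ⟨⟨J, hJ⟩, hJm⟩ := exists_eq_ciSup_of_finite (f := fun J : {J // J ∈ C.bases} => C.logTerm J.1 p)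
    change C.logTerm J p = C.tropicalTau p at hJm
    have key : ∀ I ∈ C.bases, C.logTerm I p = C.tropicalTau p → ∑ i ∈ I, C.κ i = a := by
      intro I hI hIm
      have hp := h.self_of_nhds
      obtain ⟨ε, hε, hb⟩ := Metric.eventually_nhds_iff.1 h
      have e1 := hb (y := (p.1 + ε / 2, p.2)) (by
        rw [Prod.dist_eq]; simp [abs_of_pos hε, hε])
      have e2 := hb (y := (p.1 - ε / 2, p.2)) (by
        rw [Prod.dist_eq]; simp [abs_of_pos hε, hε])
      have l1 := hle I hI (p.1 + ε / 2, p.2)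
      have l2 := hle I hI (p.1 - ε / 2, p.2)
      rw [hphi I p] at l1 l2
      simp at e1 e2 l1 l2
      have : ((∑ i ∈ I, C.κ i) - a) * ε ≤ 0 := by nlinarith
      have : 0 ≤ ((∑ i ∈ I, C.κ i) - a) * ε := by nlinarith
      have h0 : ((∑ i ∈ I, C.κ i) - a) * ε = 0 := le_antisymm ‹_› this
      rcases mul_eq_zero.1 h0 with h0 | h0
      · linarith
      · exact absurd h0 hε.ne'
    refine ⟨J, hJ, fun I hI hne => lt_of_le_of_ne ((hle I hI p).trans hJm.ge) fun he => hne ?_⟩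
    exact hinj I hI J hJ ((key I hI (he.trans hJm)).trans (key J hJ hJm).symm)
  · rintro ⟨J, hJ, h⟩
    refine ⟨∑ j ∈ J, C.κ j, ∑ j ∈ J, C.κ j ^ 2,
      C.logTerm J p - (∑ j ∈ J, C.κ j) * p.1 - (∑ j ∈ J, C.κ j ^ 2) * p.2, ?_⟩
    have hcont : ∀ I, Continuous (C.logTerm I) := fun I => by unfold logTerm; fun_prop
    have hev : ∀ᶠ q in 𝓝 p, ∀ I ∈ C.bases, C.logTerm I q ≤ C.logTerm J q := by
      rw [Finset.eventually_all]
      intro I hI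
      by_cases hIJ : I = J
      · subst hIJ; exact Filter.Eventually.of_forall fun _ => le_rfl
      · exact ((hcont I).continuousAt.eventually_lt (hcont J).continuousAt (h I hI hIJ)).mono
          fun _ => le_of_lt
    filter_upwards [hev] with q hq
    rw [show C.tropicalTau q = C.logTerm J q from
      le_antisymm (ciSup_le fun I => hq I.1 I.2) (hle J hJ q), hphi J p q]
    ring

theorem convex_region (J : Finset (Fin n)) : Convex ℝ (C.region J) := by
  rintro p ⟨hJ, hp⟩ q ⟨_, hq⟩ a b ha hb hab
  refine ⟨hJ, fun I hI h => ?_⟩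
  have hphi : ∀ J, C.logTerm J (a • p + b • q) = a * C.logTerm J p + b * C.logTerm J q := by
    intro J
    simp only [logTerm, Finset.sum_add_distrib, ← Finset.sum_mul, Prod.fst_add, Prod.snd_add,
      Prod.smul_fst, Prod.smul_snd, smul_eq_mul]
    rw [← eq_sub_iff_add_eq'] at hab
    subst hab
    ring
  rw [hphi, hphi]
  rcases ha.eq_or_lt with rfl | ha
  · have : b = 1 := by linarith
    subst this; simpa using hq I hI h
  · have := mul_lt_mul_of_pos_left (hp I hI h) ha
    have := mul_le_mul_of_nonneg_left (hq I hI h).le hb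
    linarith

/-- The (labels of the) regions whose closure contains `p`. -/
def regionsAt (p : ℝ × ℝ) : Set (Finset (Fin n)) :=
  {J | p ∈ closure (C.region J)}

/-- The relatively open line segment (or ray, or line) of the contour plot that separates the
regions `L` and `R`. -/
def border (L R : Finset (Fin n)) : Set (ℝ × ℝ) :=
  {p | C.regionsAt p = {L, R}}

/-- The regions `L` and `R` are separated by a line-soliton (or a piece of it between two
interactions): they are adjacent, and their dominant exponentials have `k - 1` common phases. It is
directed so that `L` is on its left and `R` on its right. -/
def IsLineSoliton (L R : Finset (Fin n)) : Prop :=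
  (L \ R).card = 1 ∧ (R \ L).card = 1 ∧ (C.border L R).Nonempty

/-- A vector pointing in the direction of the border of `L` and `R` that has `L` on its left: the
gradient of `logTerm L - logTerm R`, rotated clockwise by a right angle. -/
def direction (L R : Finset (Fin n)) : ℝ × ℝ :=
  (∑ j ∈ L, C.κ j ^ 2 - ∑ j ∈ R, C.κ j ^ 2, -(∑ j ∈ L, C.κ j - ∑ j ∈ R, C.κ j))

/-- The part of the contour plot outside of the (open) line-solitons: the points where line-solitons
meet, and the phase-shift segments (where two regions meet whose dominant exponentials differ in
more than one phase). -/
def interactionLocus : Set (ℝ × ℝ) :=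
  C.contourPlot \ {p | ∃ L R, C.IsLineSoliton L R ∧ p ∈ C.border L R}

/-- The interactions of line-solitons are the connected components of that locus; phase-shifts are
ignored by regarding each interaction as one point of the soliton graph. -/
def IsInteraction (Z : Set (ℝ × ℝ)) : Prop :=
  ∃ p ∈ C.interactionLocus, Z = connectedComponentIn C.interactionLocus p

/-- The line-soliton directed with `L` on its left and `R` on its right starts at a point of `Z`. -/
def StartsAt (L R : Finset (Fin n)) (Z : Set (ℝ × ℝ)) : Prop :=
  ∃ v ∈ Z, v ∈ closure (C.border L R) ∧
    ∀ p ∈ C.border L R, ∃ s : ℝ, 0 < s ∧ p = v + s • C.direction L R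

/-- The line-soliton directed with `L` on its left and `R` on its right comes from infinity. -/
def FromInfinity (L R : Finset (Fin n)) : Prop :=
  ∀ p ∈ C.border L R, ∀ s : ℝ, 0 ≤ s → p - s • C.direction L R ∈ C.border L R

/-- A trivalent vertex: a point where exactly three regions meet, and no phase-shift. -/
def IsTrivalent (Z : Set (ℝ × ℝ)) : Prop :=
  ∃ v, Z = {v} ∧ (C.regionsAt v).ncard = 3

/-- A black vertex: a trivalent vertex with a unique edge extending downwards from it. -/
def IsBlack (Z : Set (ℝ × ℝ)) : Prop :=
  C.IsTrivalent Z ∧ ∃! d : Finset (Fin n) × Finset (Fin n),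
    C.IsLineSoliton d.1 d.2 ∧ C.StartsAt d.1 d.2 Z ∧ (C.direction d.1 d.2).2 < 0

/-- A white vertex: a trivalent vertex with a unique edge extending upwards from it. -/
def IsWhite (Z : Set (ℝ × ℝ)) : Prop :=
  C.IsTrivalent Z ∧ ∃! d : Finset (Fin n) × Finset (Fin n),
    C.IsLineSoliton d.1 d.2 ∧ C.StartsAt d.1 d.2 Z ∧ 0 < (C.direction d.1 d.2).2

/-- An `X`-crossing: exactly four regions touch `Z`, in counterclockwise order `R 0, R 1, R 2, R 3`;
consecutive ones are separated by line-solitons that start at `Z`, and opposite ones of these four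
pieces have the same type, i.e. two line-solitons cross each other at `Z`. -/
def IsXCrossing (Z : Set (ℝ × ℝ)) : Prop :=
  ∃ R : Fin 4 → Finset (Fin n), Function.Injective R ∧
    {J | (closure (C.region J) ∩ Z).Nonempty} = Set.range R ∧
    (∀ i, C.IsLineSoliton (R (i + 1)) (R i) ∧ C.StartsAt (R (i + 1)) (R i) Z) ∧
    ∀ i, solitonType (R (i + 1)) (R i) = solitonType (R (i + 3)) (R (i + 2))

/-- The contour plot is generic: all interactions of line-solitons are trivalent vertices or
`X`-crossings. -/
def IsGeneric : Prop :=
  ∀ Z, C.IsInteraction Z → C.IsTrivalent Z ∨ C.IsXCrossing Z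

/-- The edges of the soliton graph (pieces of line-solitons between interactions), with a direction:
the pair of the region on the left and the region on the right. As regions are convex, these two
regions determine the piece. -/
abbrev Piece : Type :=
  {d : Finset (Fin n) × Finset (Fin n) // C.IsLineSoliton d.1 d.2}

/-- The regions of the soliton graph. -/
abbrev Region : Type :=
  {J : Finset (Fin n) // (C.region J).Nonempty}

/-- The label of an edge of the soliton graph: the type of the line-soliton. -/
def edgeLabel (d : C.Piece) : Finset (Fin n) :=
  solitonType d.1.1 d.1.2

/-- The label of a region of the soliton graph: the index set of the dominant exponential. -/
def regionLabel (J : C.Region) : Finset (Fin n) :=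
  J.1

open Classical in
/-- The generalized plabic graph `Pl(C)` of the soliton graph `C`, drawn in the plane, i.e. in the
open disk; its boundary vertices are the ends at infinity of the unbounded line-solitons. The
labels of `C` serve as names of its regions only. The boundary vertex labelled `i` is that of the
unbounded line-soliton of type `{π⁻¹ i, i}` which goes to `y = ∞` if `π⁻¹ i < i`, and to `y = -∞` if
`i < π⁻¹ i`; so it is entered from there downwards or upwards, respectively. -/
def plabicGraph (π : Equiv.Perm (Fin n)) : PlabicGraph n where
  Dart := C.Piece
  Node := {Z : Set (ℝ × ℝ) // C.IsInteraction Z}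
  Region := C.Region
  rev d := ⟨(d.1.2, d.1.1), d.2.2.1, d.2.1, by
    have h := d.2.2.2
    simpa only [border, Set.pair_comm] using h⟩
  tail d Z := C.StartsAt d.1.1 d.1.2 Z.1
  ccw d d' := ∃ Z, C.IsInteraction Z ∧ C.StartsAt d.1.1 d.1.2 Z ∧ C.StartsAt d'.1.1 d'.1.2 Z ∧
    d.1.1 = d'.1.2
  kind Z := if C.IsBlack Z.1 then .black else if C.IsWhite Z.1 then .white else .crossing
  left d := ⟨d.1.1, by
    obtain ⟨p, hp⟩ := d.2.2.2
    have h : d.1.1 ∈ C.regionsAt p := by rw [show C.regionsAt p = _ from hp]; simp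
    exact closure_nonempty_iff.1 ⟨p, h⟩⟩
  boundary i d := C.FromInfinity d.1.1 d.1.2 ∧ C.edgeLabel d = {π.symm i, i} ∧
    ((π.symm i < i ∧ (C.direction d.1.1 d.1.2).2 < 0) ∨
      (i < π.symm i ∧ 0 < (C.direction d.1.1 d.1.2).2))

end Data

end KPSoliton

end

/-! The theorem rests on one description of trips (`inTrip_iff`): a directed piece lies on T_i
exactly when i belongs to the index set of the region on its left and not to the one on its right.
Granted this, an edge receives the symmetric difference of the index sets on its two sides, the
regions on the left of T_i are those whose index set contains i, and the end of T_i is read off from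
its last piece.

That trips keep this property is local (`Follows.next`). The three index sets at a trivalent vertex
are S ∪ {i}, S ∪ {j}, S ∪ {m}, or they are T minus one element each. The product of the vertical
components of the three outgoing edges is, up to a sign distinguishing the two cases, the
orientation of the triangle of gradients; so the first case is white and the second black
(`Tripod.colour`), and the rule of the road turns the right way. At an X-crossing opposite pieces
exchange the same indices, so going straight is right.

Conversely, a piece with i only on its left must be reached from infinity: following it backwards,
the path must not run in circles. Interactions are dual to pairwise disjoint convex tiles in the
plane of gradients (`disjoint_tile`). With ∑ (κ_j - κ_i)² over the index set, up to a constant, as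
vertical coordinate there, a piece that exchanges i for j crosses a dual edge whose height
difference is (κ_i - κ_j)² > 0, always of the same sign. Hence the trip passes from each tile to one
on its left (`Follows.leftOf_tile`), and being to the left is acyclic for finitely many disjoint
convex sets (`leftOf_acyclic`).

At infinity, the two regions along an end with l on the left and r on the right are the bases of
maximal weight for a quadratic function of κ. The columns heavier than l and r are exactly those
strictly between l and r in cyclic order (`setOf_weight_lt`), so maximality says that r is the first
column making l dependent on its successors, which the Grassmann necklace identifies as r = π⁻¹ l.
Genericity of sums of two parameters excludes further ties, so each label occurs exactly once. -/

noncomputable section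

namespace KPSoliton

namespace Data

variable {k n : ℕ} (C : Data k n)

/-! ### Affine pieces of `f_A` -/

/-- The first coordinate of the gradient of `logTerm J`. -/
def charge (J : Finset (Fin n)) : ℝ := ∑ j ∈ J, C.κ j

/-- The second coordinate of the gradient of `logTerm J`. -/
def charge₂ (J : Finset (Fin n)) : ℝ := ∑ j ∈ J, C.κ j ^ 2

/-- The derivative of `logTerm J` in the direction `w`. -/
def slope (J : Finset (Fin n)) (w : ℝ × ℝ) : ℝ := C.charge J * w.1 + C.charge₂ J * w.2

/-- The region of `J` is nonempty. -/
def Live (J : Finset (Fin n)) : Prop := (C.region J).Nonempty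

/-- The standing assumptions on the data of a contour plot. -/
structure Admissible : Prop where
  strictMono : StrictMono C.κ
  generic : GenericParameters k C.κ
  nonempty : C.bases.Nonempty

theorem logTerm_add (J : Finset (Fin n)) (p w : ℝ × ℝ) :
    C.logTerm J (p + w) = C.logTerm J p + C.slope J w := by
  simp only [logTerm, slope, charge, charge₂, Finset.sum_add_distrib, ← Finset.sum_mul,
    Prod.fst_add, Prod.snd_add]
  ring

theorem slope_smul (J : Finset (Fin n)) (s : ℝ) (w : ℝ × ℝ) :
    C.slope J (s • w) = s * C.slope J w := by
  simp only [slope, Prod.smul_fst, Prod.smul_snd, smul_eq_mul]; ring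

theorem logTerm_eq (J : Finset (Fin n)) (p q : ℝ × ℝ) :
    C.logTerm J q = C.logTerm J p + C.slope J (q - p) := by
  rw [← logTerm_add]; congr 1; abel

theorem logTerm_add_smul (J : Finset (Fin n)) (p : ℝ × ℝ) (s : ℝ) (w : ℝ × ℝ) :
    C.logTerm J (p + s • w) = C.logTerm J p + s * C.slope J w := by
  rw [logTerm_add, slope_smul]

theorem continuous_logTerm (J : Finset (Fin n)) : Continuous (C.logTerm J) := by
  unfold logTerm; fun_prop

theorem direction_eq (L R : Finset (Fin n)) :
    C.direction L R = (C.charge₂ L - C.charge₂ R, -(C.charge L - C.charge R)) := rfl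

theorem slope_direction (L R : Finset (Fin n)) :
    C.slope R (C.direction L R) = C.slope L (C.direction L R) := by
  simp only [slope, direction_eq]; ring

/-- The orientation of the triangle of the gradients of `L`, `R` and `N`: it is positive iff, at a
common point of the three regions, the border of `L` and `R` that has `L` on its left leaves the
region of `N`. -/
def ori (L R N : Finset (Fin n)) : ℝ :=
  C.slope L (C.direction L R) - C.slope N (C.direction L R)

theorem ori_eq (L R N : Finset (Fin n)) :
    C.ori L R N = (C.charge₂ L - C.charge₂ R) * (C.charge L - C.charge N) -
      (C.charge L - C.charge R) * (C.charge₂ L - C.charge₂ N) := by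
  simp only [ori, slope, direction_eq]; ring

theorem ori_rotate (L R N : Finset (Fin n)) : C.ori N L R = C.ori L R N := by
  simp only [ori_eq]; ring

theorem ori_swap (L R N : Finset (Fin n)) : C.ori R L N = -C.ori L R N := by
  simp only [ori_eq]; ring

variable {C}

theorem mem_bases {J : Finset (Fin n)} : J ∈ C.bases ↔ J.card = k ∧ minor C.A J ≠ 0 := by
  simp [bases]

/-- Genericity is used with d = k, which is allowed only for k ≥ 2; for k = 1 strict monotonicity of
κ takes its place. -/
theorem Admissible.charge_inj (hC : C.Admissible) {I J : Finset (Fin n)} (hI : I ∈ C.bases)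
    (hJ : J ∈ C.bases) (h : C.charge I = C.charge J) : I = J := by
  have h1 := (mem_bases.1 hI).1
  have h2 := (mem_bases.1 hJ).1
  rcases Nat.lt_or_ge k 2 with hk | hk
  · interval_cases k
    · rw [Finset.card_eq_zero.1 h1, Finset.card_eq_zero.1 h2]
    · obtain ⟨a, rfl⟩ := Finset.card_eq_one.1 h1
      obtain ⟨b, rfl⟩ := Finset.card_eq_one.1 h2
      simp only [charge, Finset.sum_singleton] at h
      rw [hC.strictMono.injective h]
  · exact hC.generic k hk le_rfl I J h1 h2 h

theorem Live.mem_bases {J : Finset (Fin n)} (h : C.Live J) : J ∈ C.bases := h.some_mem.1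

theorem Live.charge_ne (hC : C.Admissible) {I J : Finset (Fin n)} (hI : C.Live I) (hJ : C.Live J)
    (h : I ≠ J) : C.charge I ≠ C.charge J :=
  fun e => h (hC.charge_inj hI.mem_bases hJ.mem_bases e)

/-- No border is horizontal. Hence upwards and downwards make sense for every piece, and a point of
a border line is determined by its second coordinate. -/
theorem direction_snd_ne (hC : C.Admissible) {I J : Finset (Fin n)} (hI : C.Live I) (hJ : C.Live J)
    (h : I ≠ J) : (C.direction I J).2 ≠ 0 := by
  have := hI.charge_ne hC hJ h
  simp only [direction_eq, ne_eq, neg_eq_zero, sub_eq_zero]; exact this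

/-! ### Regions near a point -/

/-- `J` attains the maximum `f_A p`. -/
def IsMaxAt (C : Data k n) (J : Finset (Fin n)) (p : ℝ × ℝ) : Prop :=
  J ∈ C.bases ∧ ∀ I ∈ C.bases, C.logTerm I p ≤ C.logTerm J p

/-- For small s only the terms tied with `J` at `p` compete, and for those the slopes decide. -/
theorem eventually_mem_region {J : Finset (Fin n)} {p w : ℝ × ℝ} (hJ : C.IsMaxAt J p)
    (hw : ∀ I ∈ C.bases, I ≠ J → C.logTerm I p = C.logTerm J p → C.slope I w < C.slope J w) :
    ∀ᶠ s : ℝ in 𝓝[>] 0, p + s • w ∈ C.region J := by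
  have : ∀ᶠ s : ℝ in 𝓝[>] 0, ∀ I ∈ C.bases, I ≠ J →
      C.logTerm I (p + s • w) < C.logTerm J (p + s • w) := by
    rw [Finset.eventually_all]
    intro I hI
    by_cases hIJ : I = J
    · simp [hIJ]
    rcases (hJ.2 I hI).eq_or_lt with h | h
    · filter_upwards [self_mem_nhdsWithin] with s hs _
      rw [logTerm_add_smul, logTerm_add_smul, h]
      have := mul_lt_mul_of_pos_left (hw I hI hIJ h) (show (0 : ℝ) < s from hs)
      linarith
    · have hc : ∀ K, Continuous fun s : ℝ => C.logTerm K (p + s • w) := fun K =>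
        (C.continuous_logTerm K).comp (by fun_prop)
      have := ((hc I).continuousAt (x := 0)).eventually_lt ((hc J).continuousAt (x := 0))
        (by simpa using h)
      exact (this.filter_mono nhdsWithin_le_nhds).mono fun s hs _ => hs
  exact this.mono fun s hs => ⟨hJ.1, hs⟩

theorem tendsto_add_smul (p w : ℝ × ℝ) :
    Filter.Tendsto (fun s : ℝ => p + s • w) (𝓝[>] 0) (𝓝 p) := by
  have : Continuous fun s : ℝ => p + s • w := by fun_prop
  have h := this.tendsto 0
  simp only [zero_smul, add_zero] at h
  exact h.mono_left nhdsWithin_le_nhds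

theorem mem_closure_of_eventually {S : Set (ℝ × ℝ)} {p w : ℝ × ℝ}
    (h : ∀ᶠ s : ℝ in 𝓝[>] 0, p + s • w ∈ S) : p ∈ closure S :=
  mem_closure_of_tendsto (tendsto_add_smul p w) h

theorem mem_regionsAt_of_slope {J : Finset (Fin n)} {p w : ℝ × ℝ} (hJ : C.IsMaxAt J p)
    (hw : ∀ I ∈ C.bases, I ≠ J → C.logTerm I p = C.logTerm J p → C.slope I w < C.slope J w) :
    J ∈ C.regionsAt p :=
  mem_closure_of_eventually (eventually_mem_region hJ hw)

theorem live_of_mem_regionsAt {J : Finset (Fin n)} {p : ℝ × ℝ} (h : J ∈ C.regionsAt p) :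
    C.Live J := closure_nonempty_iff.1 ⟨p, h⟩

theorem isMaxAt_of_mem_regionsAt {J : Finset (Fin n)} {p : ℝ × ℝ} (h : J ∈ C.regionsAt p) :
    C.IsMaxAt J p := by
  refine ⟨(live_of_mem_regionsAt h).mem_bases, fun I hI => ?_⟩
  have hcl : IsClosed {q | C.logTerm I q ≤ C.logTerm J q} :=
    isClosed_le (C.continuous_logTerm I) (C.continuous_logTerm J)
  refine closure_minimal (fun q hq => ?_) hcl h
  by_cases hIJ : I = J
  · subst hIJ; exact le_refl (C.logTerm I q)
  · exact (hq.2 I hI hIJ).le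

/-- For the converse one moves from `p` towards a point `q` of the region: a term tied with `J` at
`p` and smaller at `q` has smaller slope in the direction `q - p`. -/
theorem mem_regionsAt_iff {J : Finset (Fin n)} {p : ℝ × ℝ} :
    J ∈ C.regionsAt p ↔ C.Live J ∧ C.IsMaxAt J p := by
  refine ⟨fun h => ⟨live_of_mem_regionsAt h, isMaxAt_of_mem_regionsAt h⟩, fun ⟨⟨q, hq⟩, h⟩ => ?_⟩
  refine mem_regionsAt_of_slope (w := q - p) h fun I hI hIJ he => ?_
  have := hq.2 I hI hIJ
  rw [C.logTerm_eq I p q, C.logTerm_eq J p q] at this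
  linarith

/-- Among the terms maximal at `p`, the one of largest charge wins when x increases slightly; it is
unique because charges are distinct. -/
theorem exists_mem_regionsAt (hC : C.Admissible) (p : ℝ × ℝ) : ∃ J, J ∈ C.regionsAt p := by
  classical
  obtain ⟨J₀, hJ₀, hmax⟩ := C.bases.exists_max_image (fun J => C.logTerm J p) hC.nonempty
  obtain ⟨J, hJ, hJm⟩ := (C.bases.filter fun J => C.IsMaxAt J p).exists_max_image C.charge
    ⟨J₀, by simp only [Finset.mem_filter]; exact ⟨hJ₀, hJ₀, hmax⟩⟩
  rw [Finset.mem_filter] at hJ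
  refine ⟨J, mem_regionsAt_of_slope (w := (1, 0)) hJ.2 fun I hI hIJ he => ?_⟩
  have hle := hJm I (by
    rw [Finset.mem_filter]
    exact ⟨hI, hI, fun K hK => he ▸ hJ.2.2 K hK⟩)
  have hne : C.charge I ≠ C.charge J := fun e => hIJ (hC.charge_inj hI hJ.1 e)
  simp only [slope, mul_one, mul_zero, add_zero]
  exact lt_of_le_of_ne hle hne

/-- The maximum at any point is attained by some live term, so the other terms need not be tested.
-/
theorem isMaxAt_of_live (hC : C.Admissible) {J : Finset (Fin n)} {p : ℝ × ℝ} (hJ : J ∈ C.bases)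
    (h : ∀ I, C.Live I → C.logTerm I p ≤ C.logTerm J p) : C.IsMaxAt J p := by
  obtain ⟨K, hK⟩ := exists_mem_regionsAt hC p
  have hK' := mem_regionsAt_iff.1 hK
  exact ⟨hJ, fun I hI => (hK'.2.2 I hI).trans (h K hK'.1)⟩

theorem logTerm_eq_of_mem_regionsAt {I J : Finset (Fin n)} {p : ℝ × ℝ} (hI : I ∈ C.regionsAt p)
    (hJ : J ∈ C.regionsAt p) : C.logTerm I p = C.logTerm J p :=
  have hI' := isMaxAt_of_mem_regionsAt hI
  have hJ' := isMaxAt_of_mem_regionsAt hJ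
  le_antisymm (hJ'.2 I hI'.1) (hI'.2 J hJ'.1)

/-! ### Borders -/

theorem mem_border_iff (hC : C.Admissible) {L R : Finset (Fin n)} (hL : C.Live L) (hR : C.Live R)
    {p : ℝ × ℝ} : p ∈ C.border L R ↔ C.logTerm L p = C.logTerm R p ∧
      ∀ N, C.Live N → N ≠ L → N ≠ R → C.logTerm N p < C.logTerm L p := by
  constructor
  · intro h
    have h' : C.regionsAt p = {L, R} := h
    have hLp : L ∈ C.regionsAt p := by rw [h']; simp
    have hRp : R ∈ C.regionsAt p := by rw [h']; simp
    refine ⟨logTerm_eq_of_mem_regionsAt hLp hRp, fun N hN hNL hNR => ?_⟩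
    refine lt_of_le_of_ne ((isMaxAt_of_mem_regionsAt hLp).2 N hN.mem_bases) fun he => ?_
    have hNp : N ∈ C.regionsAt p := mem_regionsAt_iff.2 ⟨hN, hN.mem_bases, fun I hI =>
      he ▸ (isMaxAt_of_mem_regionsAt hLp).2 I hI⟩
    rw [h'] at hNp
    rcases hNp with h | h
    exacts [hNL h, hNR h]
  · rintro ⟨he, hlt⟩
    have hLp : C.IsMaxAt L p := isMaxAt_of_live hC hL.mem_bases fun I hI => by
      by_cases h1 : I = L
      · rw [h1]
      by_cases h2 : I = R
      · rw [h2, he]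
      exact (hlt I hI h1 h2).le
    have hRp : C.IsMaxAt R p := ⟨hR.mem_bases, fun I hI => he ▸ hLp.2 I hI⟩
    refine Set.Subset.antisymm (fun N hN => ?_) ?_
    · by_contra hNN
      simp only [Set.mem_insert_iff, Set.mem_singleton_iff, not_or] at hNN
      have := hlt N (live_of_mem_regionsAt hN) hNN.1 hNN.2
      exact this.not_ge ((isMaxAt_of_mem_regionsAt hN).2 L hL.mem_bases)
    · rintro N (rfl | rfl)
      exacts [mem_regionsAt_iff.2 ⟨hL, hLp⟩, mem_regionsAt_iff.2 ⟨hR, hRp⟩]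

theorem border_swap (L R : Finset (Fin n)) : C.border L R = C.border R L := by
  simp only [border, Set.pair_comm]

theorem mem_regionsAt_of_border {L R : Finset (Fin n)} {p : ℝ × ℝ} (h : p ∈ C.border L R) :
    L ∈ C.regionsAt p ∧ R ∈ C.regionsAt p := by
  have h' : C.regionsAt p = {L, R} := h
  rw [h']; simp

theorem IsLineSoliton.live {L R : Finset (Fin n)} (h : C.IsLineSoliton L R) :
    C.Live L ∧ C.Live R := by
  obtain ⟨p, hp⟩ := h.2.2
  have := mem_regionsAt_of_border hp
  exact ⟨live_of_mem_regionsAt this.1, live_of_mem_regionsAt this.2⟩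

theorem IsLineSoliton.ne {L R : Finset (Fin n)} (h : C.IsLineSoliton L R) : L ≠ R := by
  rintro rfl
  simpa using h.1

theorem IsLineSoliton.symm {L R : Finset (Fin n)} (h : C.IsLineSoliton L R) :
    C.IsLineSoliton R L := ⟨h.2.1, h.1, border_swap L R ▸ h.2.2⟩

/-- A point of the line through `v` where `logTerm L = logTerm R`. -/
theorem exists_eq_add_smul_direction (hC : C.Admissible) {L R : Finset (Fin n)} (hL : C.Live L)
    (hR : C.Live R) (hne : L ≠ R) {v q : ℝ × ℝ} (hv : C.logTerm L v = C.logTerm R v)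
    (hq : C.logTerm L q = C.logTerm R q) : ∃ s : ℝ, q = v + s • C.direction L R := by
  have hc := hL.charge_ne hC hR hne
  rw [C.logTerm_eq L v q, C.logTerm_eq R v q, hv] at hq
  simp only [slope, Prod.fst_sub, Prod.snd_sub] at hq
  have hc' : C.charge L - C.charge R ≠ 0 := sub_ne_zero.2 hc
  refine ⟨-(q.2 - v.2) / (C.charge L - C.charge R), Prod.ext ?_ ?_⟩
  · simp only [direction_eq, Prod.fst_add, Prod.smul_fst, smul_eq_mul]
    field_simp
    linarith
  · simp only [direction_eq, Prod.snd_add, Prod.smul_snd, smul_eq_mul]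
    field_simp
    ring

/-- `L` and `R` stay tied along `direction L R`, and `ori L R N` is the rate at which `N` falls
behind them. -/
theorem eventually_mem_border (hC : C.Admissible) {L R : Finset (Fin n)} {v : ℝ × ℝ}
    (hL : L ∈ C.regionsAt v) (hR : R ∈ C.regionsAt v)
    (h : ∀ N ∈ C.regionsAt v, N ≠ L → N ≠ R → 0 < C.ori L R N) :
    ∀ᶠ s : ℝ in 𝓝[>] 0, v + s • C.direction L R ∈ C.border L R := by
  have hL' := mem_regionsAt_iff.1 hL
  have key : ∀ N : Finset (Fin n), ∀ᶠ s : ℝ in 𝓝[>] 0, C.Live N → N ≠ L → N ≠ R →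
      C.logTerm N (v + s • C.direction L R) < C.logTerm L (v + s • C.direction L R) := by
    intro N
    by_cases hN : C.Live N ∧ N ≠ L ∧ N ≠ R
    swap
    · exact Filter.Eventually.of_forall fun s h1 h2 h3 => (hN ⟨h1, h2, h3⟩).elim
    obtain ⟨h1, h2, h3⟩ := hN
    rcases (hL'.2.2 N h1.mem_bases).eq_or_lt with he | hlt
    · have hNv : N ∈ C.regionsAt v := mem_regionsAt_iff.2 ⟨h1, h1.mem_bases, fun I hI =>
        he ▸ hL'.2.2 I hI⟩
      have := h N hNv h2 h3
      rw [ori] at this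
      filter_upwards [self_mem_nhdsWithin] with s hs _ _ _
      rw [logTerm_add_smul, logTerm_add_smul, he]
      have := mul_pos (show (0 : ℝ) < s from hs) this
      linarith
    · have hc : ∀ K, Continuous fun s : ℝ => C.logTerm K (v + s • C.direction L R) := fun K =>
        (C.continuous_logTerm K).comp (by fun_prop)
      have := ((hc N).continuousAt (x := 0)).eventually_lt ((hc L).continuousAt (x := 0))
        (by simpa using hlt)
      exact (this.filter_mono nhdsWithin_le_nhds).mono fun s hs _ _ _ => hs
  filter_upwards [Filter.eventually_all.2 key] with s hs
  rw [mem_border_iff hC hL'.1 (live_of_mem_regionsAt hR)]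
  refine ⟨?_, hs⟩
  rw [logTerm_add_smul, logTerm_add_smul, slope_direction, logTerm_eq_of_mem_regionsAt hL hR]

/-- `v` is the starting point of the border of `L` and `R`, directed with `L` on its left. -/
def StartPoint (C : Data k n) (L R : Finset (Fin n)) (v : ℝ × ℝ) : Prop :=
  v ∈ closure (C.border L R) ∧ ∀ p ∈ C.border L R, ∃ s : ℝ, 0 < s ∧ p = v + s • C.direction L R

theorem closure_border_subset (L R : Finset (Fin n)) :
    closure (C.border L R) ⊆ closure (C.region L) ∩ closure (C.region R) :=
  closure_minimal (fun _ hp => mem_regionsAt_of_border hp)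
    (isClosed_closure.inter isClosed_closure)

theorem StartPoint.mem_regionsAt {L R : Finset (Fin n)} {v : ℝ × ℝ} (h : C.StartPoint L R v) :
    L ∈ C.regionsAt v ∧ R ∈ C.regionsAt v :=
  closure_border_subset L R h.1

theorem StartPoint.notMem_border {L R : Finset (Fin n)} (hC : C.Admissible)
    (hL : C.Live L) (hR : C.Live R) (hne : L ≠ R) {v : ℝ × ℝ}
    (h : C.StartPoint L R v) : v ∉ C.border L R := by
  intro hv
  obtain ⟨s, hs, he⟩ := h.2 v hv
  have h0 : s • C.direction L R = 0 := by
    have : v + 0 = v + s • C.direction L R := by rw [add_zero]; exact he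
    exact (add_left_cancel this).symm
  have := congrArg Prod.snd h0
  simp only [Prod.smul_snd, smul_eq_mul, Prod.snd_zero, mul_eq_zero] at this
  rcases this with h | h
  · exact hs.ne' h
  · exact direction_snd_ne hC hL hR hne h

/-- `N` is tied with `L` at `v` and smaller at a border point further along the ray, so the constant
rate `ori L R N` is positive. -/
theorem StartPoint.ori_pos {L R N : Finset (Fin n)} {v : ℝ × ℝ} (hC : C.Admissible)
    (hb : (C.border L R).Nonempty) (h : C.StartPoint L R v) (hN : N ∈ C.regionsAt v) (hNL : N ≠ L)
    (hNR : N ≠ R) : 0 < C.ori L R N := by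
  obtain ⟨p, hp⟩ := hb
  obtain ⟨s, hs, rfl⟩ := h.2 p hp
  have hv := h.mem_regionsAt
  have hlt := ((mem_border_iff hC (live_of_mem_regionsAt hv.1) (live_of_mem_regionsAt hv.2)).1 hp).2
    N (live_of_mem_regionsAt hN) hNL hNR
  rw [logTerm_add_smul, logTerm_add_smul, logTerm_eq_of_mem_regionsAt hN hv.1] at hlt
  have : C.slope N (C.direction L R) < C.slope L (C.direction L R) :=
    lt_of_mul_lt_mul_left (by linarith) hs.le
  rw [ori]; linarith

/-- With only `L` and `R` present, `v` would itself belong to the relatively open border. -/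
theorem StartPoint.exists_third {L R : Finset (Fin n)} (hC : C.Admissible)
    (hL : C.Live L) (hR : C.Live R) (hne : L ≠ R) {v : ℝ × ℝ}
    (h : C.StartPoint L R v) : ∃ N ∈ C.regionsAt v, N ≠ L ∧ N ≠ R := by
  by_contra hcon
  push Not at hcon
  apply h.notMem_border hC hL hR hne
  refine Set.Subset.antisymm (fun N hN => ?_) ?_
  · by_cases h1 : N = L
    · exact Or.inl h1
    · exact Or.inr (hcon N hN h1)
  · rintro N (rfl | rfl)
    exacts [h.mem_regionsAt.1, h.mem_regionsAt.2]

/-- At a common point of the regions `L`, `R`, `N, …`, a border of `L` and `R` starts as soon as the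
gradients of the other regions are on the correct side. -/
theorem startPoint_of_ori_pos (hC : C.Admissible) {L R : Finset (Fin n)} {v : ℝ × ℝ} (hne : L ≠ R)
    (hL : L ∈ C.regionsAt v) (hR : R ∈ C.regionsAt v)
    (h : ∀ N ∈ C.regionsAt v, N ≠ L → N ≠ R → 0 < C.ori L R N)
    (hex : ∃ N ∈ C.regionsAt v, N ≠ L ∧ N ≠ R) :
    (C.border L R).Nonempty ∧ C.StartPoint L R v := by
  have hev := eventually_mem_border hC hL hR h
  refine ⟨?_, mem_closure_of_eventually hev, fun p hp => ?_⟩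
  · obtain ⟨s, hs⟩ := hev.exists
    exact ⟨_, hs⟩
  · have hLl := live_of_mem_regionsAt hL
    have hRl := live_of_mem_regionsAt hR
    have hp' := (mem_border_iff hC hLl hRl).1 hp
    obtain ⟨s, rfl⟩ := exists_eq_add_smul_direction hC hLl hRl hne
      (logTerm_eq_of_mem_regionsAt hL hR) hp'.1
    refine ⟨s, ?_, rfl⟩
    obtain ⟨N, hN, hNL, hNR⟩ := hex
    have hlt := hp'.2 N (live_of_mem_regionsAt hN) hNL hNR
    rw [logTerm_add_smul, logTerm_add_smul, logTerm_eq_of_mem_regionsAt hN hL] at hlt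
    have h0 := h N hN hNL hNR
    rw [ori] at h0
    by_contra hs
    push Not at hs
    nlinarith

/-- A border that does not come from infinity has a starting point. -/
theorem exists_startPoint (hC : C.Admissible) {L R : Finset (Fin n)} (hL : C.Live L)
    (hR : C.Live R) (hne : L ≠ R) (hinf : ¬ C.FromInfinity L R) :
    ∃ v, C.StartPoint L R v := by
  classical
  simp only [FromInfinity, not_forall] at hinf
  obtain ⟨p, hp, s₀, hs₀, hnot⟩ := hinf
  have hp' := (mem_border_iff hC hL hR).1 hp
  have hval : ∀ N (s : ℝ), C.logTerm N (p - s • C.direction L R) =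
      C.logTerm N p - s * C.slope N (C.direction L R) := by
    intro N s
    rw [show p - s • C.direction L R = p + (-s) • C.direction L R by
      rw [neg_smul, sub_eq_add_neg], logTerm_add_smul]; ring
  -- Moving backwards from `p`, the lead of `L` over `N` shrinks at rate `ori L R N`. Only the
  -- members of `T` ever catch up, `N` after the time `ρ N`; the first one to do so determines the
  -- starting point.
  let T : Finset (Finset (Fin n)) := Finset.univ.filter fun N =>
    C.Live N ∧ N ≠ L ∧ N ≠ R ∧ 0 < C.ori L R N
  let ρ : Finset (Fin n) → ℝ := fun N => (C.logTerm L p - C.logTerm N p) / C.ori L R N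
  have hT : T.Nonempty := by
    by_contra hT
    rw [Finset.not_nonempty_iff_eq_empty] at hT
    apply hnot
    rw [mem_border_iff hC hL hR]
    refine ⟨by rw [hval, hval, hp'.1, slope_direction], fun N hN h1 h2 => ?_⟩
    have hlt := hp'.2 N hN h1 h2
    have : ¬ 0 < C.ori L R N := fun h0 => by
      have : N ∈ T := by simp only [T, Finset.mem_filter, Finset.mem_univ, true_and]; exact ⟨hN, h1, h2, h0⟩
      rw [hT] at this; simp at this
    rw [ori] at this
    rw [hval, hval]
    nlinarith
  obtain ⟨N₀, hN₀, hmin⟩ := T.exists_min_image ρ hT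
  simp only [T, Finset.mem_filter, Finset.mem_univ, true_and] at hN₀ hmin
  obtain ⟨hN₀l, hN₀L, hN₀R, hpos⟩ := hN₀
  set r := ρ N₀ with hr
  have hr0 : 0 < r := div_pos (by linarith [hp'.2 N₀ hN₀l hN₀L hN₀R]) hpos
  have hrN : r * C.ori L R N₀ = C.logTerm L p - C.logTerm N₀ p := by
    rw [hr]; exact div_mul_cancel₀ _ hpos.ne'
  have hle : ∀ N, C.Live N → N ≠ L → N ≠ R → r * C.ori L R N ≤ C.logTerm L p - C.logTerm N p := by
    intro N hN h1 h2
    have hlt := hp'.2 N hN h1 h2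
    by_cases h0 : 0 < C.ori L R N
    · have := hmin N ⟨hN, h1, h2, h0⟩
      rwa [← le_div_iff₀ h0]
    · nlinarith
  set v := p - r • C.direction L R with hv
  have hvLR : C.logTerm L v = C.logTerm R v := by
    rw [hv, hval, hval, hp'.1, slope_direction]
  have hmaxL : C.IsMaxAt L v := isMaxAt_of_live hC hL.mem_bases fun N hN => by
    by_cases h1 : N = L
    · rw [h1]
    by_cases h2 : N = R
    · rw [h2, hvLR]
    have := hle N hN h1 h2
    rw [ori] at this
    rw [hv, hval, hval]
    linarith
  have hLv : L ∈ C.regionsAt v := mem_regionsAt_iff.2 ⟨hL, hmaxL⟩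
  have hRv : R ∈ C.regionsAt v := mem_regionsAt_iff.2 ⟨hR, hR.mem_bases, fun I hI =>
    hvLR ▸ hmaxL.2 I hI⟩
  have hNv : N₀ ∈ C.regionsAt v := by
    have he : C.logTerm N₀ v = C.logTerm L v := by
      rw [ori] at hrN
      rw [hv, hval, hval]; linarith
    exact mem_regionsAt_iff.2 ⟨hN₀l, hN₀l.mem_bases, fun I hI => he ▸ hmaxL.2 I hI⟩
  refine ⟨v, (startPoint_of_ori_pos hC hne hLv hRv (fun N hN h1 h2 => ?_)
    ⟨N₀, hNv, hN₀L, hN₀R⟩).2⟩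
  have hlt := hp'.2 N (live_of_mem_regionsAt hN) h1 h2
  have he := logTerm_eq_of_mem_regionsAt hN hLv
  rw [hv, hval, hval] at he
  rw [ori]
  by_contra hcon
  push Not at hcon
  nlinarith

/-! ### Interactions -/

/-- The index sets `L` and `R` differ in exactly one element. -/
def Adjacent (L R : Finset (Fin n)) : Prop := (L \ R).card = 1 ∧ (R \ L).card = 1

theorem Adjacent.symm {L R : Finset (Fin n)} (h : Adjacent L R) : Adjacent R L := ⟨h.2, h.1⟩

theorem mem_contourPlot (hC : C.Admissible) {L R : Finset (Fin n)} {v : ℝ × ℝ} (hne : L ≠ R)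
    (hL : L ∈ C.regionsAt v) (hR : R ∈ C.regionsAt v) : v ∈ C.contourPlot := by
  by_contra hcon
  rw [← Set.mem_compl_iff, C.contourPlot_compl hC.strictMono hC.generic hC.nonempty,
    Set.mem_iUnion] at hcon
  obtain ⟨J, hJ⟩ := hcon
  have key : ∀ K ∈ C.regionsAt v, K = J := fun K hK => by
    by_contra hKJ
    exact (hJ.2 K (live_of_mem_regionsAt hK).mem_bases hKJ).not_ge
      ((isMaxAt_of_mem_regionsAt hK).2 J hJ.1)
  exact hne ((key L hL).trans (key R hR).symm)

theorem mem_interactionLocus (hC : C.Admissible) {L R : Finset (Fin n)} {v : ℝ × ℝ} (hne : L ≠ R)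
    (hL : L ∈ C.regionsAt v) (hR : R ∈ C.regionsAt v)
    (h : v ∉ C.border L R ∨ ¬ Adjacent L R) : v ∈ C.interactionLocus := by
  refine ⟨mem_contourPlot hC hne hL hR, ?_⟩
  rintro ⟨L', R', hs, hv⟩
  have hv' : C.regionsAt v = {L', R'} := hv
  rw [hv'] at hL hR
  rcases hL with rfl | hL <;> rcases hR with rfl | hR
  · exact hne rfl
  · obtain rfl : R = R' := hR
    exact h.elim (fun h => h hv) fun h => h ⟨hs.1, hs.2.1⟩
  · obtain rfl : L = R' := hL
    exact h.elim (fun h => h (border_swap L R ▸ hv)) fun h => h ⟨hs.2.1, hs.1⟩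
  · exact hne (hL.trans hR.symm)

theorem exists_interaction {v : ℝ × ℝ} (hv : v ∈ C.interactionLocus) :
    ∃ Z, C.IsInteraction Z ∧ v ∈ Z :=
  ⟨_, ⟨v, hv, rfl⟩, mem_connectedComponentIn hv⟩

theorem IsInteraction.eq_of_mem {Z : Set (ℝ × ℝ)} (hZ : C.IsInteraction Z) {v : ℝ × ℝ}
    (hv : v ∈ Z) : Z = connectedComponentIn C.interactionLocus v := by
  obtain ⟨p, -, rfl⟩ := hZ
  exact connectedComponentIn_eq hv

theorem IsInteraction.eq_of_mem_mem {Z Z' : Set (ℝ × ℝ)} (hZ : C.IsInteraction Z)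
    (hZ' : C.IsInteraction Z') {v : ℝ × ℝ} (hv : v ∈ Z) (hv' : v ∈ Z') : Z = Z' :=
  (hZ.eq_of_mem hv).trans (hZ'.eq_of_mem hv').symm

theorem IsInteraction.mem_of_segment {Z : Set (ℝ × ℝ)} (hZ : C.IsInteraction Z) {v w : ℝ × ℝ}
    (hv : v ∈ Z) (h : segment ℝ v w ⊆ C.interactionLocus) : w ∈ Z := by
  rw [hZ.eq_of_mem hv]
  exact (convex_segment v w).isPreconnected.subset_connectedComponentIn (left_mem_segment ℝ v w) h
    (right_mem_segment ℝ v w)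

theorem exists_startsAt (hC : C.Admissible) {L R : Finset (Fin n)} (hs : C.IsLineSoliton L R)
    (hinf : ¬ C.FromInfinity L R) : ∃ Z, C.IsInteraction Z ∧ C.StartsAt L R Z := by
  obtain ⟨hL, hR⟩ := hs.live
  obtain ⟨v, hv⟩ := exists_startPoint hC hL hR hs.ne hinf
  obtain ⟨Z, hZ, hvZ⟩ := exists_interaction (mem_interactionLocus hC hs.ne hv.mem_regionsAt.1
    hv.mem_regionsAt.2 (Or.inl (hv.notMem_border hC hL hR hs.ne)))
  exact ⟨Z, hZ, v, hvZ, hv⟩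

/-- Common points of two regions whose index sets differ in more than one element belong to one
interaction. -/
theorem IsInteraction.mem_of_not_adjacent (hC : C.Admissible) {Z : Set (ℝ × ℝ)}
    (hZ : C.IsInteraction Z) {L R : Finset (Fin n)} (hne : L ≠ R) (hLR : ¬ Adjacent L R)
    {v w : ℝ × ℝ} (hv : v ∈ Z) (hLv : L ∈ C.regionsAt v) (hRv : R ∈ C.regionsAt v)
    (hLw : L ∈ C.regionsAt w) (hRw : R ∈ C.regionsAt w) : w ∈ Z := by
  refine hZ.mem_of_segment hv fun q hq => ?_
  exact mem_interactionLocus hC hne ((C.convex_region L).closure.segment_subset hLv hLw hq)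
    ((C.convex_region R).closure.segment_subset hRv hRw hq) (Or.inr hLR)

/-- Otherwise the border leaving `v` would be a phase-shift segment, all of whose points lie in the
same interaction as `v`, but this interaction is a single point. -/
theorem IsTrivalent.adjacent (hC : C.Admissible) {v : ℝ × ℝ} (hZ : C.IsInteraction {v})
    {L R : Finset (Fin n)} (hL : L ∈ C.regionsAt v) (hR : R ∈ C.regionsAt v)
    (hne : L ≠ R) (h : ∀ N ∈ C.regionsAt v, N ≠ L → N ≠ R → 0 < C.ori L R N) :
    Adjacent L R := by
  by_contra hcon
  have hev := eventually_mem_border hC hL hR h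
  obtain ⟨s, hs, hs0⟩ := (hev.and self_mem_nhdsWithin).exists
  have hs0 : 0 < s := hs0
  have hw := mem_regionsAt_of_border hs
  have := hZ.mem_of_not_adjacent hC hne hcon rfl hL hR hw.1 hw.2
  have h2 := congrArg Prod.snd (show v + s • C.direction L R = v from this)
  simp only [Prod.snd_add, Prod.smul_snd, smul_eq_mul, add_eq_left, mul_eq_zero] at h2
  rcases h2 with h2 | h2
  · exact hs0.ne' h2
  · exact direction_snd_ne hC (live_of_mem_regionsAt hL) (live_of_mem_regionsAt hR) hne h2

end Data

end KPSoliton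

end

noncomputable section

namespace KPSoliton

namespace Data

variable {k n : ℕ} {C : Data k n}

/-! ### Local structure of the soliton graph at its vertices -/

/-- Each starting point is a limit of border points, which lie ahead of the other one; so neither is
strictly ahead. As borders are not horizontal, comparing second coordinates suffices. -/
theorem StartPoint.unique (hC : C.Admissible) {L R : Finset (Fin n)} (hs : C.IsLineSoliton L R)
    {v v' : ℝ × ℝ} (h : C.StartPoint L R v) (h' : C.StartPoint L R v') : v = v' := by
  have key : ∀ {a b : ℝ × ℝ}, C.StartPoint L R a → C.StartPoint L R b →
      0 ≤ (a.2 - b.2) * (C.direction L R).2 := by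
    intro a b ha hb
    have hcl : IsClosed {p : ℝ × ℝ | 0 ≤ (p.2 - b.2) * (C.direction L R).2} :=
      isClosed_le (by fun_prop) (by fun_prop)
    refine closure_minimal (fun p hp => ?_) hcl ha.1
    obtain ⟨s, hs, rfl⟩ := hb.2 p hp
    simp only [Set.mem_ofPred_eq, Prod.snd_add, Prod.smul_snd, smul_eq_mul, add_sub_cancel_left]
    nlinarith [mul_self_nonneg (C.direction L R).2]
  have hd := direction_snd_ne hC hs.live.1 hs.live.2 hs.ne
  have h0 : (v.2 - v'.2) * (C.direction L R).2 = 0 := by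
    linarith [key h h', key h' h]
  have h1 : v.2 = v'.2 := by
    rcases mul_eq_zero.1 h0 with h | h
    · linarith
    · exact (hd h).elim
  obtain ⟨s, hs'⟩ := exists_eq_add_smul_direction hC hs.live.1 hs.live.2 hs.ne
    (logTerm_eq_of_mem_regionsAt h'.mem_regionsAt.1 h'.mem_regionsAt.2)
    (logTerm_eq_of_mem_regionsAt h.mem_regionsAt.1 h.mem_regionsAt.2)
  have h2 := congrArg Prod.snd hs'
  simp only [Prod.snd_add, Prod.smul_snd, smul_eq_mul, h1, left_eq_add, mul_eq_zero] at h2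
  rcases h2 with h2 | h2
  · rw [hs', h2, zero_smul, add_zero]
  · exact (hd h2).elim

theorem StartsAt.unique (hC : C.Admissible) {L R : Finset (Fin n)} (hs : C.IsLineSoliton L R)
    {Z Z' : Set (ℝ × ℝ)} (hZ : C.IsInteraction Z) (hZ' : C.IsInteraction Z')
    (h : C.StartsAt L R Z) (h' : C.StartsAt L R Z') : Z = Z' := by
  obtain ⟨v, hv, hv'⟩ := h
  obtain ⟨w, hw, hw'⟩ := h'
  obtain rfl := StartPoint.unique hC hs hv' hw'
  exact hZ.eq_of_mem_mem hZ' hv hw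

theorem charge_sub (L R : Finset (Fin n)) :
    C.charge L - C.charge R = C.charge (L \ R) - C.charge (R \ L) := by
  simp only [charge]
  rw [← Finset.sum_inter_add_sum_sdiff L R, ← Finset.sum_inter_add_sum_sdiff R L,
    Finset.inter_comm R L]
  ring

theorem charge₂_sub (L R : Finset (Fin n)) :
    C.charge₂ L - C.charge₂ R = C.charge₂ (L \ R) - C.charge₂ (R \ L) := by
  simp only [charge₂]
  rw [← Finset.sum_inter_add_sum_sdiff L R, ← Finset.sum_inter_add_sum_sdiff R L,
    Finset.inter_comm R L]
  ring

theorem charge_sub_of_sdiff {L R : Finset (Fin n)} {i j : Fin n} (hi : L \ R = {i})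
    (hj : R \ L = {j}) : C.charge L - C.charge R = C.κ i - C.κ j := by
  rw [charge_sub, hi, hj]; simp [charge]

theorem charge₂_sub_of_sdiff {L R : Finset (Fin n)} {i j : Fin n} (hi : L \ R = {i})
    (hj : R \ L = {j}) : C.charge₂ L - C.charge₂ R = C.κ i ^ 2 - C.κ j ^ 2 := by
  rw [charge₂_sub, hi, hj]; simp [charge₂]

theorem mem_sdiff_of_eq {L R : Finset (Fin n)} {i : Fin n} (h : L \ R = {i}) : i ∈ L ∧ i ∉ R := by
  rw [← Finset.mem_sdiff, h]; simp

theorem Adjacent.exists_sdiff {L R : Finset (Fin n)} (h : Adjacent L R) :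
    ∃ i j, L \ R = {i} ∧ R \ L = {j} := by
  obtain ⟨i, hi⟩ := Finset.card_eq_one.1 h.1
  obtain ⟨j, hj⟩ := Finset.card_eq_one.1 h.2
  exact ⟨i, j, hi, hj⟩

theorem Adjacent.sdiff_eq {L R : Finset (Fin n)} (h : Adjacent L R) {i : Fin n} (hi : i ∈ L)
    (hi' : i ∉ R) : L \ R = {i} := by
  obtain ⟨a, ha⟩ := Finset.card_eq_one.1 h.1
  have : i ∈ L \ R := Finset.mem_sdiff.2 ⟨hi, hi'⟩
  rw [ha, Finset.mem_singleton] at this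
  rw [ha, this]

/-- Three pairwise adjacent index sets `L = S ∪ {i}`, `R = S ∪ {j}`, `N` are `S ∪ {i}`, `S ∪ {j}`,
`S ∪ {m}`, or the complements of `j`, `i`, `m` in `S ∪ {i, j}`. -/
theorem Adjacent.triple {L R N : Finset (Fin n)} {i j : Fin n} (hi : L \ R = {i})
    (hj : R \ L = {j}) (hLN : Adjacent L N) (hRN : Adjacent R N) :
    (i ∉ N ∧ j ∉ N ∧ ∃ m, L \ N = {i} ∧ N \ L = {m} ∧ R \ N = {j} ∧ N \ R = {m}) ∨
      (i ∈ N ∧ j ∈ N ∧ ∃ m, L \ N = {m} ∧ N \ L = {j} ∧ R \ N = {m} ∧ N \ R = {i}) := by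
  have hi' := mem_sdiff_of_eq hi
  have hj' := mem_sdiff_of_eq hj
  have hLR : ∀ x, x ≠ i → x ≠ j → (x ∈ L ↔ x ∈ R) := by
    intro x hxi hxj
    have h1 : x ∉ L \ R := by rw [hi]; simpa
    have h2 : x ∉ R \ L := by rw [hj]; simpa
    simp only [Finset.mem_sdiff] at h1 h2
    tauto
  by_cases hiN : i ∈ N
  · right
    have h1 := hRN.symm.sdiff_eq hiN hi'.2
    have hjN : j ∈ N := by
      by_contra hjN
      have h2 := hRN.sdiff_eq hj'.1 hjN
      have : N = L := by
        ext x
        by_cases hxi : x = i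
        · subst hxi; exact ⟨fun _ => hi'.1, fun _ => hiN⟩
        by_cases hxj : x = j
        · subst hxj; exact ⟨fun h => (hjN h).elim, fun h => (hj'.2 h).elim⟩
        have h3 : x ∉ N \ R := by rw [h1]; simpa
        have h4 : x ∉ R \ N := by rw [h2]; simpa
        simp only [Finset.mem_sdiff] at h3 h4
        rw [hLR x hxi hxj]; tauto
      subst this
      simpa using hLN.1
    have h2 := hLN.symm.sdiff_eq hjN hj'.2
    obtain ⟨m, hm⟩ := Finset.card_eq_one.1 hLN.1
    have hm' := mem_sdiff_of_eq hm
    refine ⟨hiN, hjN, m, hm, h2, ?_, h1⟩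
    refine hRN.sdiff_eq ((hLR m ?_ ?_).1 hm'.1) hm'.2
    · rintro rfl; exact hm'.2 hiN
    · rintro rfl; exact hm'.2 hjN
  · left
    have h1 := hLN.sdiff_eq hi'.1 hiN
    have hjN : j ∉ N := by
      intro hjN
      have h2 := hLN.symm.sdiff_eq hjN hj'.2
      have : N = R := by
        ext x
        by_cases hxi : x = i
        · subst hxi; exact ⟨fun h => (hiN h).elim, fun h => (hi'.2 h).elim⟩
        by_cases hxj : x = j
        · subst hxj; exact ⟨fun _ => hj'.1, fun _ => hjN⟩
        have h3 : x ∉ L \ N := by rw [h1]; simpa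
        have h4 : x ∉ N \ L := by rw [h2]; simpa
        simp only [Finset.mem_sdiff] at h3 h4
        rw [← hLR x hxi hxj]; tauto
      subst this
      simpa using hRN.1
    have h2 := hRN.sdiff_eq hj'.1 hjN
    obtain ⟨m, hm⟩ := Finset.card_eq_one.1 hLN.2
    have hm' := mem_sdiff_of_eq hm
    refine ⟨hiN, hjN, m, h1, hm, h2, ?_⟩
    refine hRN.symm.sdiff_eq hm'.1 fun hmR => hm'.2 ((hLR m ?_ ?_).2 hmR)
    · rintro rfl; exact hiN hm'.1
    · rintro rfl; exact hjN hm'.1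

/-- Three nonzero numbers with sum zero and positive product: exactly one is positive. -/
theorem existsUnique_pos_of_sum_zero {α : Type*} {P : α → Prop} {f : α → ℝ} {a b c : α}
    (hab : a ≠ b) (hbc : b ≠ c) (hac : a ≠ c) (hP : ∀ x, P x ↔ x = a ∨ x = b ∨ x = c)
    (hsum : f a + f b + f c = 0) (hprod : 0 < f a * f b * f c) :
    (∃! x, P x ∧ 0 < f x) ∧ ¬ ∃! x, P x ∧ f x < 0 := by
  have ha : P a := (hP a).2 (by simp)
  have hb : P b := (hP b).2 (by simp)
  have hc : P c := (hP c).2 (by simp)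
  have key : (0 < f a ∧ f b < 0 ∧ f c < 0) ∨ (f a < 0 ∧ 0 < f b ∧ f c < 0) ∨
      (f a < 0 ∧ f b < 0 ∧ 0 < f c) := by
    have ha0 : f a ≠ 0 := fun h => by simp [h] at hprod
    have hb0 : f b ≠ 0 := fun h => by simp [h] at hprod
    have hc0 : f c ≠ 0 := fun h => by simp [h] at hprod
    rcases lt_or_gt_of_ne ha0 with h1 | h1 <;> rcases lt_or_gt_of_ne hb0 with h2 | h2 <;>
      rcases lt_or_gt_of_ne hc0 with h3 | h3
    · linarith
    · exact Or.inr (Or.inr ⟨h1, h2, h3⟩)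
    · exact Or.inr (Or.inl ⟨h1, h2, h3⟩)
    · nlinarith [mul_pos_of_neg_of_neg h1 (neg_lt_zero.2 h2), mul_pos h2 h3]
    · exact Or.inl ⟨h1, h2, h3⟩
    · nlinarith [mul_pos h1 h3]
    · nlinarith [mul_pos h1 h2]
    · linarith
  rcases key with ⟨h1, h2, h3⟩ | ⟨h1, h2, h3⟩ | ⟨h1, h2, h3⟩
  · refine ⟨⟨a, ⟨ha, h1⟩, ?_⟩, fun h => hbc (h.unique ⟨hb, h2⟩ ⟨hc, h3⟩)⟩
    rintro y ⟨hy, hy'⟩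
    rcases (hP y).1 hy with rfl | rfl | rfl
    exacts [rfl, (lt_asymm hy' h2).elim, (lt_asymm hy' h3).elim]
  · refine ⟨⟨b, ⟨hb, h2⟩, ?_⟩, fun h => hac (h.unique ⟨ha, h1⟩ ⟨hc, h3⟩)⟩
    rintro y ⟨hy, hy'⟩
    rcases (hP y).1 hy with rfl | rfl | rfl
    exacts [(lt_asymm hy' h1).elim, rfl, (lt_asymm hy' h3).elim]
  · refine ⟨⟨c, ⟨hc, h3⟩, ?_⟩, fun h => hab (h.unique ⟨ha, h1⟩ ⟨hb, h2⟩)⟩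
    rintro y ⟨hy, hy'⟩
    rcases (hP y).1 hy with rfl | rfl | rfl
    exacts [(lt_asymm hy' h1).elim, (lt_asymm hy' h2).elim, rfl]

/-- A trivalent vertex at `v`, with the regions `R`, `L`, `N` in counterclockwise order. -/
structure Tripod (C : Data k n) (v : ℝ × ℝ) (L R N : Finset (Fin n)) : Prop where
  isInteraction : C.IsInteraction {v}
  mem_iff : ∀ J, J ∈ C.regionsAt v ↔ J = L ∨ J = R ∨ J = N
  ne : L ≠ R
  ne_left : N ≠ L
  ne_right : N ≠ R
  pos : 0 < C.ori L R N

theorem Tripod.rotate {v : ℝ × ℝ} {L R N : Finset (Fin n)} (h : C.Tripod v L R N) :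
    C.Tripod v N L R where
  isInteraction := h.isInteraction
  mem_iff J := by rw [h.mem_iff]; tauto
  ne := h.ne_left
  ne_left := h.ne_right.symm
  ne_right := h.ne.symm
  pos := by rw [ori_rotate]; exact h.pos

theorem Tripod.isTrivalent {v : ℝ × ℝ} {L R N : Finset (Fin n)} (h : C.Tripod v L R N) :
    C.IsTrivalent {v} := by
  refine ⟨v, rfl, ?_⟩
  have : C.regionsAt v = {L, R, N} := by
    ext J; rw [h.mem_iff]; simp
  rw [this, Set.ncard_eq_three]
  exact ⟨L, R, N, h.ne, h.ne_left.symm, h.ne_right.symm, rfl⟩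

theorem Tripod.soliton (hC : C.Admissible) {v : ℝ × ℝ} {L R N : Finset (Fin n)}
    (h : C.Tripod v L R N) : C.IsLineSoliton L R ∧ C.StartsAt L R {v} := by
  have hL : L ∈ C.regionsAt v := (h.mem_iff L).2 (by simp)
  have hR : R ∈ C.regionsAt v := (h.mem_iff R).2 (by simp)
  have hN : N ∈ C.regionsAt v := (h.mem_iff N).2 (by simp)
  have hpos : ∀ J ∈ C.regionsAt v, J ≠ L → J ≠ R → 0 < C.ori L R J := by
    intro J hJ h1 h2
    rcases (h.mem_iff J).1 hJ with h3 | h3 | rfl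
    exacts [(h1 h3).elim, (h2 h3).elim, h.pos]
  have had := IsTrivalent.adjacent hC h.isInteraction hL hR h.ne hpos
  obtain ⟨hb, hs⟩ := startPoint_of_ori_pos hC h.ne hL hR hpos ⟨N, hN, h.ne_left, h.ne_right⟩
  exact ⟨⟨had.1, had.2, hb⟩, v, rfl, hs⟩

theorem Tripod.of_startsAt (hC : C.Admissible) {Z : Set (ℝ × ℝ)} (hZ : C.IsInteraction Z)
    (ht : C.IsTrivalent Z) {L R : Finset (Fin n)} (hs : C.IsLineSoliton L R)
    (hst : C.StartsAt L R Z) : ∃ v N, Z = {v} ∧ C.Tripod v L R N := by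
  obtain ⟨v, rfl, hcard⟩ := ht
  obtain ⟨w, hw, hst⟩ := hst
  obtain rfl : w = v := hw
  obtain ⟨N, hN, hNL, hNR⟩ := StartPoint.exists_third hC hs.live.1 hs.live.2 hs.ne hst
  have hLR := StartPoint.mem_regionsAt hst
  have hsub : ({L, R, N} : Set (Finset (Fin n))) ⊆ C.regionsAt w := by
    rintro J (rfl | rfl | rfl)
    exacts [hLR.1, hLR.2, hN]
  have h3 : ({L, R, N} : Set (Finset (Fin n))).ncard = 3 :=
    Set.ncard_eq_three.2 ⟨L, R, N, hs.ne, hNL.symm, hNR.symm, rfl⟩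
  have heq := Set.eq_of_subset_of_ncard_le hsub (by rw [h3, hcard]) (Set.toFinite _)
  refine ⟨w, N, rfl, hZ, fun J => ?_, hs.ne, hNL, hNR,
    StartPoint.ori_pos hC hs.2.2 hst hN hNL hNR⟩
  rw [← heq]; simp

/-- Of the six ordered pairs of distinct regions, the three counterclockwise ones have positive
orientation with respect to the third region; the reversed ones have negative orientation and cannot
start at `v`. -/
theorem Tripod.startsAt_iff (hC : C.Admissible) {v : ℝ × ℝ} {L R N : Finset (Fin n)}
    (h : C.Tripod v L R N) (d : Finset (Fin n) × Finset (Fin n)) :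
    (C.IsLineSoliton d.1 d.2 ∧ C.StartsAt d.1 d.2 {v}) ↔
      d = (L, R) ∨ d = (N, L) ∨ d = (R, N) := by
  constructor
  · rintro ⟨hs, w, hw, hst⟩
    obtain rfl : w = v := hw
    have hmem := StartPoint.mem_regionsAt hst
    have hp := h.pos
    have hori : ∀ X ∈ C.regionsAt w, X ≠ d.1 → X ≠ d.2 → 0 < C.ori d.1 d.2 X := fun X hX h1 h2 =>
      StartPoint.ori_pos hC hs.2.2 hst hX h1 h2
    have hne := hs.ne
    obtain ⟨X, Y⟩ := d
    simp only [Prod.mk.injEq] at *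
    have e1 := C.ori_rotate L R N
    have e2 := C.ori_rotate N L R
    have hN := h.ne_left
    have hNR := h.ne_right
    have hLR := h.ne
    rcases (h.mem_iff X).1 hmem.1 with rfl | rfl | rfl <;>
      rcases (h.mem_iff Y).1 hmem.2 with rfl | rfl | rfl
    · exact (hne rfl).elim
    · simp
    · have := hori R ((h.mem_iff _).2 (by simp)) hLR.symm hNR.symm
      have e := C.ori_swap Y X R
      linarith
    · have := hori N ((h.mem_iff _).2 (by simp)) hNR hN
      have e := C.ori_swap Y X N
      linarith
    · exact (hne rfl).elim
    · simp
    · simp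
    · have := hori L ((h.mem_iff _).2 (by simp)) hN.symm hLR
      have e := C.ori_swap Y X L
      linarith
    · exact (hne rfl).elim
  · rintro (rfl | rfl | rfl)
    exacts [h.soliton hC, h.rotate.soliton hC, h.rotate.rotate.soliton hC]

/-- The colour of a trivalent vertex is determined by the index sets of the regions. -/
theorem Tripod.colour (hC : C.Admissible) {v : ℝ × ℝ} {L R N : Finset (Fin n)}
    (h : C.Tripod v L R N) {i j : Fin n} (hi : L \ R = {i}) (hj : R \ L = {j}) :
    (i ∉ N ∧ j ∉ N ∧ C.IsWhite {v} ∧ ¬ C.IsBlack {v}) ∨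
      (i ∈ N ∧ j ∈ N ∧ C.IsBlack {v}) := by
  have s2 := (h.rotate.soliton hC).1
  have s3 := (h.rotate.rotate.soliton hC).1
  have hP := h.startsAt_iff hC
  have hLR := h.ne
  have hNL := h.ne_left
  have hNR := h.ne_right
  have n1 : ((L, R) : Finset (Fin n) × Finset (Fin n)) ≠ (N, L) := by simp [hLR.symm]
  have n2 : ((N, L) : Finset (Fin n) × Finset (Fin n)) ≠ (R, N) := by simp [hNR]
  have n3 : ((L, R) : Finset (Fin n) × Finset (Fin n)) ≠ (R, N) := by simp [hLR]
  have hsum : (C.direction L R).2 + (C.direction N L).2 + (C.direction R N).2 = 0 := by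
    simp only [direction_eq]; ring
  have hpos := h.pos
  rw [ori_eq] at hpos
  have c1 := C.charge_sub_of_sdiff hi hj
  have c2 := C.charge₂_sub_of_sdiff hi hj
  rcases Adjacent.triple hi hj ⟨s2.2.1, s2.1⟩ ⟨s3.1, s3.2.1⟩ with
    ⟨hiN, hjN, m, h1, h2, h3, h4⟩ | ⟨hiN, hjN, m, h1, h2, h3, h4⟩
  · left
    have c3 := C.charge_sub_of_sdiff h1 h2
    have c4 := C.charge₂_sub_of_sdiff h1 h2
    have c5 := C.charge_sub_of_sdiff h4 h3
    -- Here the product of the three vertical components equals (κ_i - κ_j)(κ_i - κ_m)(κ_j - κ_m),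
    -- which is `ori L R N` itself.
    have := existsUnique_pos_of_sum_zero (f := fun d => (C.direction d.1 d.2).2) n1 n2 n3 hP hsum (by
      simp only [direction_eq]
      rw [c1, c2, c3, c4] at hpos
      rw [c1, ← neg_sub (C.charge L) (C.charge N), ← neg_sub (C.charge N) (C.charge R), c3, c5]
      nlinarith)
    simp only [and_assoc] at this
    exact ⟨hiN, hjN, ⟨h.isTrivalent, this.1⟩, fun hb => this.2 hb.2⟩
  · right
    have c3 := C.charge_sub_of_sdiff h1 h2
    have c4 := C.charge₂_sub_of_sdiff h1 h2
    have c5 := C.charge_sub_of_sdiff h4 h3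
    -- For complements of single elements the product of the vertical components is minus the
    -- orientation, so their negatives are used.
    have := existsUnique_pos_of_sum_zero (f := fun d => -(C.direction d.1 d.2).2) n1 n2 n3 hP
      (by linarith) (by
      simp only [direction_eq]
      rw [c1, c2, c3, c4] at hpos
      rw [c1, ← neg_sub (C.charge L) (C.charge N), ← neg_sub (C.charge N) (C.charge R), c3, c5]
      nlinarith)
    simp only [and_assoc, neg_pos] at this
    exact ⟨hiN, hjN, h.isTrivalent, this.1⟩

/-! ### `X`-crossings -/

/-- Opposite pieces at an `X`-crossing exchange the same indices. -/
theorem sdiff_eq_of_symmDiff_eq {A₀ A₁ A₂ A₃ : Finset (Fin n)} (h₁ : Adjacent A₁ A₀)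
    (h₂ : Adjacent A₂ A₁) (h₃ : Adjacent A₃ A₂) (hs : symmDiff A₁ A₀ = symmDiff A₃ A₂)
    (hne : A₂ ≠ A₀) : A₁ \ A₀ = A₂ \ A₃ ∧ A₀ \ A₁ = A₃ \ A₂ := by
  obtain ⟨b, a, hb, ha⟩ := h₁.exists_sdiff
  obtain ⟨b1, b2⟩ := mem_sdiff_of_eq hb
  obtain ⟨a1, a2⟩ := mem_sdiff_of_eq ha
  have hab : a ≠ b := by rintro rfl; exact a2 b1
  have hbs : b ∈ symmDiff A₃ A₂ := by rw [← hs, Finset.mem_symmDiff]; exact Or.inl ⟨b1, b2⟩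
  have has : a ∈ symmDiff A₃ A₂ := by rw [← hs, Finset.mem_symmDiff]; exact Or.inr ⟨a1, a2⟩
  rw [Finset.mem_symmDiff] at hbs has
  rcases hbs with ⟨hb3, hb2⟩ | ⟨hb2, hb3⟩
  -- If b were lost from `A₁` to `A₂` and regained in `A₃`, then a would be gained from `A₁` to
  -- `A₂`; the second step would undo the first and give `A₂ = A₀`.
  · exfalso
    have e1 := h₂.symm.sdiff_eq b1 hb2
    rcases has with ⟨ha3, ha2⟩ | ⟨ha2, ha3⟩
    · have e := h₃.sdiff_eq hb3 hb2
      have : a ∈ A₃ \ A₂ := Finset.mem_sdiff.2 ⟨ha3, ha2⟩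
      rw [e, Finset.mem_singleton] at this
      exact hab this
    · have e2 := h₂.sdiff_eq ha2 a2
      apply hne
      ext x
      by_cases hxa : x = a
      · subst hxa; exact ⟨fun _ => a1, fun _ => ha2⟩
      by_cases hxb : x = b
      · subst hxb; exact ⟨fun h => (hb2 h).elim, fun h => (b2 h).elim⟩
      have f1 : x ∉ A₁ \ A₂ := by rw [e1]; simpa
      have f2 : x ∉ A₂ \ A₁ := by rw [e2]; simpa
      have f3 : x ∉ A₁ \ A₀ := by rw [hb]; simpa
      have f4 : x ∉ A₀ \ A₁ := by rw [ha]; simpa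
      simp only [Finset.mem_sdiff] at f1 f2 f3 f4
      tauto
  · have e := h₃.symm.sdiff_eq hb2 hb3
    rcases has with ⟨ha3, ha2⟩ | ⟨ha2, ha3⟩
    · exact ⟨by rw [hb, e], by rw [ha, h₃.sdiff_eq ha3 ha2]⟩
    · exfalso
      have : a ∈ A₂ \ A₃ := Finset.mem_sdiff.2 ⟨ha2, ha3⟩
      rw [e, Finset.mem_singleton] at this
      exact hab this

/-- The element gained from `A₀` to `A₁` is still in `A₂`, and the one gained from `A₁` to `A₂` is
not in `A₀`; so `A₂ \ A₀` has two elements. -/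
theorem not_adjacent_of_sdiff {A₀ A₁ A₂ A₃ : Finset (Fin n)} (h₁ : Adjacent A₁ A₀)
    (h₂ : Adjacent A₂ A₁) (h : A₁ \ A₀ = A₂ \ A₃ ∧ A₀ \ A₁ = A₃ \ A₂) : ¬ Adjacent A₂ A₀ := by
  obtain ⟨b, a, hb, ha⟩ := h₁.exists_sdiff
  obtain ⟨d, -, hd, -⟩ := h₂.exists_sdiff
  obtain ⟨b1, b2⟩ := mem_sdiff_of_eq hb
  obtain ⟨d1, d2⟩ := mem_sdiff_of_eq hd
  have hb' : b ∈ A₂ \ A₀ := by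
    have : b ∈ A₂ \ A₃ := by rw [← h.1, hb]; simp
    exact Finset.mem_sdiff.2 ⟨(Finset.mem_sdiff.1 this).1, b2⟩
  have hd' : d ∈ A₂ \ A₀ := by
    refine Finset.mem_sdiff.2 ⟨d1, fun hd0 => ?_⟩
    have : d ∈ A₃ \ A₂ := by rw [← h.2]; exact Finset.mem_sdiff.2 ⟨hd0, d2⟩
    exact (Finset.mem_sdiff.1 this).2 d1
  rintro ⟨hcard, -⟩
  obtain ⟨x, hx⟩ := Finset.card_eq_one.1 hcard
  rw [hx, Finset.mem_singleton] at hb' hd'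
  rw [hb', ← hd'] at b1
  exact d2 b1

/-- An `X`-crossing `Z`, with the regions `R 0`, `R 1`, `R 2`, `R 3` in counterclockwise order. -/
structure Crossing (C : Data k n) (Z : Set (ℝ × ℝ)) (R : Fin 4 → Finset (Fin n)) : Prop where
  isInteraction : C.IsInteraction Z
  injective : Function.Injective R
  mem_iff : ∀ J, (closure (C.region J) ∩ Z).Nonempty ↔ ∃ m, J = R m
  soliton : ∀ m, C.IsLineSoliton (R (m + 1)) (R m)
  starts : ∀ m, C.StartsAt (R (m + 1)) (R m) Z
  sdiff : ∀ m, R (m + 1) \ R m = R (m + 2) \ R (m + 3) ∧ R m \ R (m + 1) = R (m + 3) \ R (m + 2)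
  not_adjacent : ∀ m, ¬ Adjacent (R (m + 2)) (R m)

theorem IsXCrossing.crossing {Z : Set (ℝ × ℝ)} (hZ : C.IsInteraction Z) (h : C.IsXCrossing Z) :
    ∃ R, C.Crossing Z R := by
  obtain ⟨R, hinj, hrange, hst, htype⟩ := h
  have had : ∀ m, Adjacent (R (m + 1)) (R m) := fun m => ⟨(hst m).1.1, (hst m).1.2.1⟩
  have e1 : ∀ m : Fin 4, m + 1 + 1 = m + 2 := by decide
  have e2 : ∀ m : Fin 4, m + 2 + 1 = m + 3 := by decide
  have e3 : ∀ m : Fin 4, m + 2 ≠ m := by decide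
  have h2 : ∀ m, Adjacent (R (m + 2)) (R (m + 1)) := fun m => e1 m ▸ had (m + 1)
  have h3 : ∀ m, Adjacent (R (m + 3)) (R (m + 2)) := fun m => e2 m ▸ had (m + 2)
  have hsd := fun m => sdiff_eq_of_symmDiff_eq (had m) (h2 m) (h3 m) (htype m)
    (fun h => e3 m (hinj h))
  refine ⟨R, hZ, hinj, fun J => ?_, fun m => (hst m).1, fun m => (hst m).2, hsd,
    fun m => not_adjacent_of_sdiff (had m) (h2 m) (hsd m)⟩
  have := Set.ext_iff.1 hrange J
  simp only [Set.mem_ofPred_eq, Set.mem_range] at this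
  rw [this]; exact exists_congr fun m => eq_comm

theorem fin_four_cases (m j : Fin 4) : j = m ∨ j = m + 1 ∨ j = m + 2 ∨ j = m + 3 := by
  revert m j; decide

namespace Crossing

variable {Z : Set (ℝ × ℝ)} {R : Fin 4 → Finset (Fin n)}

theorem charge_eq (h : C.Crossing Z R) (m : Fin 4) :
    C.charge (R (m + 1)) - C.charge (R m) = C.charge (R (m + 2)) - C.charge (R (m + 3)) := by
  rw [charge_sub, charge_sub (R (m + 2)), (h.sdiff m).1, (h.sdiff m).2]

theorem charge₂_eq (h : C.Crossing Z R) (m : Fin 4) :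
    C.charge₂ (R (m + 1)) - C.charge₂ (R m) = C.charge₂ (R (m + 2)) - C.charge₂ (R (m + 3)) := by
  rw [charge₂_sub, charge₂_sub (R (m + 2)), (h.sdiff m).1, (h.sdiff m).2]

/-- The four gradients form a parallelogram, and `ori L R` is constant on lines parallel to the one
through the gradients of `L` and `R`. -/
theorem ori_eq (h : C.Crossing Z R) (m : Fin 4) :
    C.ori (R (m + 1)) (R m) (R (m + 2)) = C.ori (R (m + 1)) (R m) (R (m + 3)) := by
  have h1 := h.charge_eq m
  have h2 := h.charge₂_eq m
  simp only [Data.ori_eq]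
  linear_combination (C.charge (R (m + 1)) - C.charge (R m)) * -h2 -
    (C.charge₂ (R (m + 1)) - C.charge₂ (R m)) * -h1

theorem mem_of_startsAt (h : C.Crossing Z R) {L K : Finset (Fin n)} (hst : C.StartsAt L K Z) :
    (∃ m, L = R m) ∧ ∃ m, K = R m := by
  obtain ⟨v, hv, hst⟩ := hst
  have := StartPoint.mem_regionsAt hst
  exact ⟨(h.mem_iff L).1 ⟨v, this.1, hv⟩, (h.mem_iff K).1 ⟨v, this.2, hv⟩⟩

/-- Where the piece starts a third region is present. This gives the sign for one of the two
remaining regions, and `ori_eq` transfers it to the other. -/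
theorem ori_pos (hC : C.Admissible) (h : C.Crossing Z R) (m : Fin 4) :
    0 < C.ori (R (m + 1)) (R m) (R (m + 2)) ∧ 0 < C.ori (R (m + 1)) (R m) (R (m + 3)) := by
  obtain ⟨v, hv, hst⟩ := h.starts m
  have hs := h.soliton m
  obtain ⟨N, hN, h1, h2⟩ := StartPoint.exists_third hC hs.live.1 hs.live.2 hs.ne hst
  have hpos := StartPoint.ori_pos hC hs.2.2 hst hN h1 h2
  obtain ⟨j, rfl⟩ := (h.mem_iff N).1 ⟨v, hN, hv⟩
  have e := h.ori_eq m
  rcases fin_four_cases m j with rfl | rfl | rfl | rfl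
  · exact (h2 rfl).elim
  · exact (h1 rfl).elim
  · exact ⟨hpos, e ▸ hpos⟩
  · exact ⟨e ▸ hpos, hpos⟩

/-- The line-solitons that start at an `X`-crossing. -/
theorem startsAt_cases (hC : C.Admissible) (h : C.Crossing Z R) {L K : Finset (Fin n)}
    (hs : C.IsLineSoliton L K) (hst : C.StartsAt L K Z) : ∃ m, L = R (m + 1) ∧ K = R m := by
  obtain ⟨⟨m', rfl⟩, m, rfl⟩ := h.mem_of_startsAt hst
  have had : Adjacent (R m') (R m) := ⟨hs.1, hs.2.1⟩
  rcases fin_four_cases m m' with rfl | rfl | rfl | rfl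
  · exact (hs.ne rfl).elim
  · exact ⟨m, rfl, rfl⟩
  · exact (h.not_adjacent m had).elim
  -- The remaining ordered pair is the reverse of a counterclockwise one, with orientations of the
  -- wrong sign.
  · exfalso
    obtain ⟨v, hv, hst⟩ := hst
    obtain ⟨N, hN, h1, h2⟩ := StartPoint.exists_third hC hs.live.1 hs.live.2 hs.ne hst
    have hpos := StartPoint.ori_pos hC hs.2.2 hst hN h1 h2
    obtain ⟨j, rfl⟩ := (h.mem_iff N).1 ⟨v, hN, hv⟩
    have e : ∀ m : Fin 4, m + 3 + 1 = m ∧ m + 3 + 2 = m + 1 ∧ m + 3 + 3 = m + 2 := by decide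
    obtain ⟨e1, e2, e3⟩ := e m
    have hop := h.ori_pos hC (m + 3)
    rw [e1, e2, e3] at hop
    have hsw := fun J => C.ori_swap (R m) (R (m + 3)) J
    rcases fin_four_cases m j with rfl | rfl | rfl | rfl
    · exact h2 rfl
    · linarith [hop.1, hsw (R (m + 1))]
    · linarith [hop.2, hsw (R (m + 2))]
    · exact h1 rfl

end Crossing

/-- All the other regions touching the interaction at which a line-soliton starts are on the same
side of it. -/
theorem StartsAt.side (hC : C.Admissible) {Z : Set (ℝ × ℝ)} (hZ : C.IsInteraction Z)
    (hgen : C.IsTrivalent Z ∨ C.IsXCrossing Z) {L R : Finset (Fin n)} (hs : C.IsLineSoliton L R)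
    (hst : C.StartsAt L R Z) :
    (∀ J, (closure (C.region J) ∩ Z).Nonempty → J ≠ L → J ≠ R → 0 < C.ori L R J) ∧
      ∃ J, (closure (C.region J) ∩ Z).Nonempty ∧ J ≠ L ∧ J ≠ R := by
  constructor
  · intro J hJ h1 h2
    rcases hgen with ht | hx
    · obtain ⟨v, N, rfl, h⟩ := Tripod.of_startsAt hC hZ ht hs hst
      obtain ⟨w, hw, hwv⟩ := hJ
      obtain rfl : w = v := hwv
      rcases (h.mem_iff J).1 hw with rfl | rfl | rfl
      exacts [(h1 rfl).elim, (h2 rfl).elim, h.pos]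
    · obtain ⟨X, h⟩ := hx.crossing hZ
      obtain ⟨m, rfl, rfl⟩ := h.startsAt_cases hC hs hst
      obtain ⟨j, rfl⟩ := (h.mem_iff J).1 hJ
      have := h.ori_pos hC m
      rcases fin_four_cases m j with rfl | rfl | rfl | rfl
      exacts [(h2 rfl).elim, (h1 rfl).elim, this.1, this.2]
  · obtain ⟨v, hv, hst⟩ := hst
    obtain ⟨N, hN, h1, h2⟩ := StartPoint.exists_third hC hs.live.1 hs.live.2 hs.ne hst
    exact ⟨N, ⟨v, hN, hv⟩, h1, h2⟩

/-- A third region touching `Z` would have to lie on both sides of the piece. -/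
theorem StartsAt.not_rev (hC : C.Admissible) {Z : Set (ℝ × ℝ)} (hZ : C.IsInteraction Z)
    (hgen : C.IsTrivalent Z ∨ C.IsXCrossing Z) {L R : Finset (Fin n)} (hs : C.IsLineSoliton L R)
    (hst : C.StartsAt L R Z) : ¬ C.StartsAt R L Z := by
  intro hst'
  obtain ⟨h1, J, hJ, hJL, hJR⟩ := StartsAt.side hC hZ hgen hs hst
  have h2 := (StartsAt.side hC hZ hgen hs.symm hst').1 J hJ hJR hJL
  rw [ori_swap] at h2
  linarith [h1 J hJ hJL hJR]

/-! ### Trips follow the boundary of the union of the regions containing a given index -/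

theorem plabicGraph_next_iff (π : Equiv.Perm (Fin n)) (d d' : C.Piece) :
    (C.plabicGraph π).Next d d' ↔ ∃ Z, C.IsInteraction Z ∧ C.StartsAt d.1.2 d.1.1 Z ∧
      C.StartsAt d'.1.1 d'.1.2 Z ∧
      ((C.IsBlack Z ∧ ∃ Z', C.IsInteraction Z' ∧ C.StartsAt d.1.2 d.1.1 Z' ∧
          C.StartsAt d'.1.1 d'.1.2 Z' ∧ d.1.2 = d'.1.2) ∨
        (¬ C.IsBlack Z ∧ C.IsWhite Z ∧ ∃ Z', C.IsInteraction Z' ∧ C.StartsAt d'.1.1 d'.1.2 Z' ∧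
          C.StartsAt d.1.2 d.1.1 Z' ∧ d'.1.1 = d.1.1) ∨
        (¬ C.IsBlack Z ∧ ¬ C.IsWhite Z ∧ ∃ e : C.Piece,
          (∃ Z', C.IsInteraction Z' ∧ C.StartsAt d.1.2 d.1.1 Z' ∧
            C.StartsAt e.1.1 e.1.2 Z' ∧ d.1.2 = e.1.2) ∧
          ∃ Z', C.IsInteraction Z' ∧ C.StartsAt e.1.1 e.1.2 Z' ∧
            C.StartsAt d'.1.1 d'.1.2 Z' ∧ e.1.1 = d'.1.2)) := by
  constructor
  · rintro ⟨⟨Z, hZ⟩, h1, h2, h3⟩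
    refine ⟨Z, hZ, h1, h2, ?_⟩
    by_cases hb : C.IsBlack Z
    · simp only [plabicGraph, hb, if_true] at h3
      exact Or.inl ⟨hb, h3⟩
    by_cases hw : C.IsWhite Z
    · simp only [plabicGraph, hb, hw, if_true, if_false] at h3
      exact Or.inr (Or.inl ⟨hb, hw, h3⟩)
    · simp only [plabicGraph, hb, hw, if_false] at h3
      exact Or.inr (Or.inr ⟨hb, hw, h3⟩)
  · rintro ⟨Z, hZ, h1, h2, h3⟩
    refine ⟨⟨Z, hZ⟩, h1, h2, ?_⟩
    rcases h3 with ⟨hb, h3⟩ | ⟨hb, hw, h3⟩ | ⟨hb, hw, h3⟩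
    · simp only [plabicGraph, hb, if_true]
      exact h3
    · simp only [plabicGraph, hb, hw, if_true, if_false]
      exact h3
    · simp only [plabicGraph, hb, hw, if_false]
      exact h3

/-- The directed piece `d` has `i` in the index set on its left, but not on its right. -/
def Follows (i : Fin n) (d : C.Piece) : Prop := i ∈ d.1.1 ∧ i ∉ d.1.2

theorem Crossing.not_isTrivalent {Z : Set (ℝ × ℝ)} {R : Fin 4 → Finset (Fin n)}
    (h : C.Crossing Z R) : ¬ C.IsTrivalent Z := by
  rintro ⟨v, rfl, hv⟩
  have : C.regionsAt v = Set.range R := by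
    ext J
    have := h.mem_iff J
    simp only [Set.inter_singleton_nonempty] at this
    exact this.trans (exists_congr fun m => eq_comm)
  rw [this, ← Set.image_univ, Set.ncard_image_of_injective _ h.injective, Set.ncard_univ] at hv
  simp at hv

/-- Let N be the third region at a trivalent vertex. If it is white, N omits i and a left turn keeps
the region on the left; if it is black, N contains i and a right turn keeps the region on the right.
At an X-crossing the opposite piece exchanges the same two indices in the same sense. -/
theorem Follows.next (hC : C.Admissible) (hgen : C.IsGeneric) {π : Equiv.Perm (Fin n)} {i : Fin n}
    {d d' : C.Piece} (hd : Follows i d) (h : (C.plabicGraph π).Next d d') : Follows i d' := by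
  obtain ⟨⟨L, R⟩, hs⟩ := d
  obtain ⟨⟨X, Y⟩, hs'⟩ := d'
  obtain ⟨hiL, hiR⟩ := hd
  obtain ⟨Z, hZ, h1, h2, h3⟩ := (plabicGraph_next_iff π _ _).1 h
  simp only [Follows] at *
  have hadj : Adjacent L R := ⟨hs.1, hs.2.1⟩
  have hiLR := hadj.sdiff_eq hiL hiR
  obtain ⟨-, j, -, hjRL⟩ := hadj.exists_sdiff
  rcases hgen Z hZ with ht | hx
  · obtain ⟨v, N, rfl, htr⟩ := Tripod.of_startsAt hC hZ ht hs.symm h1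
    have hcol := htr.colour hC hjRL hiLR
    have hcases := (htr.startsAt_iff hC (X, Y)).1 ⟨hs', h2⟩
    simp only [Prod.mk.injEq] at hcases
    have hne := htr.ne
    have hNL := htr.ne_right
    have hNR := htr.ne_left
    rcases hcol with ⟨hjN, hiN, hw, hb⟩ | ⟨hjN, hiN, hb⟩
    · rcases h3 with ⟨hb', -⟩ | ⟨-, -, Z', -, -, -, rfl⟩ | ⟨-, hw', -⟩
      · exact (hb hb').elim
      · refine ⟨hiL, ?_⟩
        rcases hcases with ⟨e, rfl⟩ | ⟨rfl, rfl⟩ | ⟨-, rfl⟩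
        · exact (hne e.symm).elim
        · exact hiR
        · exact hiN
      · exact (hw' hw).elim
    · rcases h3 with ⟨-, Z', -, -, -, rfl⟩ | ⟨hb', -⟩ | ⟨hb', -⟩
      · refine ⟨?_, hiR⟩
        rcases hcases with ⟨-, e⟩ | ⟨rfl, -⟩ | ⟨rfl, -⟩
        · exact (hne e).elim
        · exact hiN
        · exact hiL
      · exact (hb' hb).elim
      · exact (hb' hb).elim
  · obtain ⟨W, hcr⟩ := hx.crossing hZ
    have hnt := hcr.not_isTrivalent
    rcases h3 with ⟨hb, -⟩ | ⟨-, hw, -⟩ | ⟨-, -, ⟨⟨E, F⟩, hse⟩, ⟨Z', hZ', e1, e2, e3⟩, Z'', -, -, -, e4⟩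
    · exact (hnt hb.1).elim
    · exact (hnt hw.1).elim
    · obtain rfl := StartsAt.unique hC hs.symm hZ hZ' h1 e1
      simp only at e2 e3 e4
      subst e3 e4
      obtain ⟨m, rfl, rfl⟩ := hcr.startsAt_cases hC hs.symm h1
      obtain ⟨m₁, rfl, h4⟩ := hcr.startsAt_cases hC hse e2
      obtain rfl := hcr.injective h4
      obtain ⟨m₂, rfl, h5⟩ := hcr.startsAt_cases hC hs' h2
      have h6 := hcr.injective h5
      obtain rfl : m₂ = m + 2 := by rw [← h6, add_assoc]; rfl
      rw [show m + 2 + 1 = m + 3 by rw [add_assoc]; rfl, show m + 1 + 1 = m + 2 by rw [add_assoc]; rfl,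
        ← Finset.mem_sdiff, ← (hcr.sdiff m).2]
      exact Finset.mem_sdiff.2 ⟨hiL, hiR⟩

/-- Backwards continuation of trips. -/
theorem Follows.exists_prev (hC : C.Admissible) (hgen : C.IsGeneric) (π : Equiv.Perm (Fin n))
    {i : Fin n} {d : C.Piece} (hd : Follows i d) {Z : Set (ℝ × ℝ)} (hZ : C.IsInteraction Z)
    (hst : C.StartsAt d.1.1 d.1.2 Z) :
    ∃ d' : C.Piece, Follows i d' ∧ C.StartsAt d'.1.2 d'.1.1 Z ∧ (C.plabicGraph π).Next d' d := by
  obtain ⟨⟨L, R⟩, hs⟩ := d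
  obtain ⟨hiL, hiR⟩ := hd
  simp only [Follows] at *
  have hadj : Adjacent L R := ⟨hs.1, hs.2.1⟩
  have hiLR := hadj.sdiff_eq hiL hiR
  obtain ⟨-, j, -, hjRL⟩ := hadj.exists_sdiff
  rcases hgen Z hZ with ht | hx
  · obtain ⟨v, N, rfl, htr⟩ := Tripod.of_startsAt hC hZ ht hs hst
    obtain ⟨s2, st2⟩ := htr.rotate.soliton hC
    obtain ⟨s3, st3⟩ := htr.rotate.rotate.soliton hC
    -- The predecessor separates `N` from whichever of `L` and `R` disagrees with it about i; the
    -- colour makes the rule of the road choose that turn.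
    rcases htr.colour hC hiLR hjRL with ⟨hiN, -, hw, hb⟩ | ⟨hiN, -, hb⟩
    · exact ⟨⟨(L, N), s2.symm⟩, ⟨hiL, hiN⟩, st2, (plabicGraph_next_iff π _ _).2 ⟨_, hZ, st2, hst,
        Or.inr (Or.inl ⟨hb, hw, _, hZ, hst, st2, rfl⟩)⟩⟩
    · exact ⟨⟨(N, R), s3.symm⟩, ⟨hiN, hiR⟩, st3, (plabicGraph_next_iff π _ _).2 ⟨_, hZ, st3, hst,
        Or.inl ⟨hb, _, hZ, st3, hst, rfl⟩⟩⟩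
  · obtain ⟨W, hcr⟩ := hx.crossing hZ
    have hnt := hcr.not_isTrivalent
    obtain ⟨m, rfl, rfl⟩ := hcr.startsAt_cases hC hs hst
    have e1 : m + 2 + 1 = m + 3 := by rw [add_assoc]; rfl
    have e2 : m + 3 + 1 = m := (by decide : ∀ m : Fin 4, m + 3 + 1 = m) m
    have s2 := hcr.soliton (m + 2)
    have st2 := hcr.starts (m + 2)
    have s3 := hcr.soliton (m + 3)
    have st3 := hcr.starts (m + 3)
    rw [e1] at s2 st2
    rw [e2] at s3 st3
    have hmem : i ∈ W (m + 2) \ W (m + 3) := by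
      rw [← (hcr.sdiff m).1]; exact Finset.mem_sdiff.2 ⟨hiL, hiR⟩
    refine ⟨⟨(W (m + 2), W (m + 3)), s2.symm⟩, Finset.mem_sdiff.1 hmem, st2,
      (plabicGraph_next_iff π _ _).2 ⟨_, hZ, st2, hst, Or.inr (Or.inr ⟨fun h => hnt h.1,
        fun h => hnt h.1, ⟨(W m, W (m + 3)), s3⟩, ⟨Z, hZ, st2, st3, rfl⟩,
        ⟨Z, hZ, st3, hst, rfl⟩⟩)⟩⟩

end Data

end KPSoliton

end

noncomputable section

namespace KPSoliton

/-! ### Disjoint convex sets in the plane can be ordered from left to right -/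

/-- At some height, `O i` has a point to the left of a point of `O j`. -/
def LeftOf {ι : Type*} (O : ι → Set (ℝ × ℝ)) (i j : ι) : Prop :=
  i ≠ j ∧ ∃ p ∈ O i, ∃ q ∈ O j, p.2 = q.2 ∧ p.1 < q.1

/-- If the order were reversed or equality held at the second height, the horizontal gap, which is
affine along the two segments, would vanish somewhere between, at a common point. The weights are
those for which it vanishes. -/
theorem fst_lt_of_disjoint_convex {S T : Set (ℝ × ℝ)} (hS : Convex ℝ S) (hT : Convex ℝ T)
    (hd : Disjoint S T) {p p' q q' : ℝ × ℝ} (hp : p ∈ S) (hp' : p' ∈ S) (hq : q ∈ T) (hq' : q' ∈ T)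
    (h : p.2 = q.2) (h' : p'.2 = q'.2) (hlt : p.1 < q.1) : p'.1 < q'.1 := by
  by_contra hcon
  push Not at hcon
  set D := (q.1 - p.1) + (p'.1 - q'.1) with hD
  have hD0 : 0 < D := by linarith
  have hsum : (p'.1 - q'.1) / D + (q.1 - p.1) / D = 1 := by
    field_simp; rw [hD]; ring
  have h1 := hS hp hp' (a := (p'.1 - q'.1) / D) (b := (q.1 - p.1) / D)
    (div_nonneg (by linarith) hD0.le) (div_nonneg (by linarith) hD0.le) hsum
  have h2 := hT hq hq' (a := (p'.1 - q'.1) / D) (b := (q.1 - p.1) / D)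
    (div_nonneg (by linarith) hD0.le) (div_nonneg (by linarith) hD0.le) hsum
  refine Set.disjoint_left.1 hd h1 ?_
  convert h2 using 1
  refine Prod.ext ?_ ?_
  · simp only [Prod.fst_add, Prod.smul_fst, smul_eq_mul]; field_simp; ring
  · simp only [Prod.snd_add, Prod.smul_snd, smul_eq_mul, h, h']

theorem exists_snd_eq_of_convex {S : Set (ℝ × ℝ)} (hS : Convex ℝ S) {p q : ℝ × ℝ} (hp : p ∈ S)
    (hq : q ∈ S) {h : ℝ} (h1 : p.2 ≤ h) (h2 : h ≤ q.2) : ∃ x ∈ S, x.2 = h := by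
  have hc : Convex ℝ (Prod.snd '' S) := hS.linear_image (LinearMap.snd ℝ ℝ ℝ)
  obtain ⟨x, hx, rfl⟩ := hc.ordConnected.out ⟨p, hp, rfl⟩ ⟨q, hq, rfl⟩ ⟨h1, h2⟩
  exact ⟨x, hx, rfl⟩

/-- When `O a` and `O c` reach at least as high as `O b`, all three sets have points at the larger
of the two heights where the comparisons are made, and there transitivity is that of real numbers.
-/
theorem leftOf_trans_of_lowest {ι : Type*} {O : ι → Set (ℝ × ℝ)} (hO : ∀ i, Convex ℝ (O i))
    (hd : Pairwise fun i j => Disjoint (O i) (O j)) {a b c : ι}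
    (ha : ∀ p ∈ O b, ∃ q ∈ O a, p.2 ≤ q.2) (hc : ∀ p ∈ O b, ∃ q ∈ O c, p.2 ≤ q.2)
    (hab : LeftOf O a b) (hbc : LeftOf O b c) : LeftOf O a c := by
  obtain ⟨nab, p, hp, q, hq, e1, l1⟩ := hab
  obtain ⟨nbc, q', hq', w, hw, e2, l2⟩ := hbc
  obtain ⟨x, hx, y, hy, z, hz, exy, eyz, lxy, lyz⟩ : ∃ x ∈ O a, ∃ y ∈ O b, ∃ z ∈ O c,
      x.2 = y.2 ∧ y.2 = z.2 ∧ x.1 < y.1 ∧ y.1 < z.1 := by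
    rcases le_total q'.2 q.2 with h | h
    · obtain ⟨r, hr, hqr⟩ := hc q hq
      obtain ⟨z, hz, hz'⟩ := exists_snd_eq_of_convex (hO c) hw hr (e2 ▸ h) hqr
      exact ⟨p, hp, q, hq, z, hz, e1, hz'.symm, l1,
        fst_lt_of_disjoint_convex (hO b) (hO c) (hd nbc) hq' hq hw hz e2 hz'.symm l2⟩
    · obtain ⟨r, hr, hqr⟩ := ha q' hq'
      obtain ⟨x, hx, hx'⟩ := exists_snd_eq_of_convex (hO a) hp hr (e1 ▸ h) hqr
      exact ⟨x, hx, q', hq', w, hw, hx', e2,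
        fst_lt_of_disjoint_convex (hO a) (hO b) (hd nab) hp hx hq hq' e1 hx' l1, l2⟩
  refine ⟨?_, x, hx, z, hz, exy.trans eyz, lxy.trans lyz⟩
  rintro rfl
  exact lyz.not_gt (fst_lt_of_disjoint_convex (hO a) (hO b) (hd nab) hx hz hy hy exy eyz.symm lxy)

open Relation in
/-- The relation of being to the left is acyclic on a finite family of disjoint convex sets. -/
theorem leftOf_acyclic {ι : Type*} {O : ι → Set (ℝ × ℝ)} (hO : ∀ i, Convex ℝ (O i))
    (hd : Pairwise fun i j => Disjoint (O i) (O j)) (s : Finset ι) (a : ι) :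
    ¬ TransGen (fun x y => x ∈ s ∧ y ∈ s ∧ LeftOf O x y) a a := by
  classical
  induction hs : s.card generalizing s a with
  | zero =>
    intro h
    obtain ⟨b, h, -⟩ := TransGen.head'_iff.1 h
    rw [Finset.card_eq_zero.1 hs] at h
    simp at h
  | succ m ih =>
    -- The set with the lowest top is removed. Comparing the lower sets of attained heights, which
    -- are totally ordered by inclusion, covers unbounded sets and suprema that are not attained.
    let U : ι → Set ℝ := fun i => {h | ∃ p ∈ O i, h ≤ p.2}
    have hU : ∀ i, IsLowerSet (U i) := fun i x y hyx ⟨p, hp, hx⟩ => ⟨p, hp, hyx.trans hx⟩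
    obtain ⟨b, hb⟩ := s.exists_minimalFor U (Finset.card_pos.1 (by omega))
    have hlow : ∀ c ∈ s, ∀ p ∈ O b, ∃ q ∈ O c, p.2 ≤ q.2 := by
      intro c hc p hp
      have : U b ⊆ U c := ((hU b).total (hU c)).elim id fun h => hb.2 hc h
      exact this ⟨p, hp, le_rfl⟩
    have htrans : ∀ {a c}, a ∈ s → c ∈ s → LeftOf O a b → LeftOf O b c → LeftOf O a c :=
      fun ha hc h1 h2 => leftOf_trans_of_lowest hO hd (hlow _ ha) (hlow _ hc) h1 h2
    set r := fun x y => x ∈ s ∧ y ∈ s ∧ LeftOf O x y with hr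
    set r' := fun x y => x ∈ s.erase b ∧ y ∈ s.erase b ∧ LeftOf O x y with hr'
    have hirr : ∀ x, ¬ r x x := fun x h => h.2.2.1 rfl
    have hrr' : ∀ {x y}, r x y → x ≠ b → y ≠ b → r' x y := fun h hx hy =>
      ⟨Finset.mem_erase.2 ⟨hx, h.1⟩, Finset.mem_erase.2 ⟨hy, h.2.1⟩, h.2.2⟩
    have ih' : ∀ x, ¬ TransGen r' x x := fun x => ih (s.erase b) x (by
      rw [Finset.card_erase_of_mem hb.1, hs]; rfl)
    -- Every passage through `b` is short-circuited by transitivity at `b`; a path that starts at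
    -- `b` only loses its first step.
    have key : ∀ {x y}, TransGen r x y → y ≠ b → (x ≠ b → TransGen r' x y) ∧
        (x = b → ∃ c, c ≠ b ∧ r b c ∧ ReflTransGen r' c y) := by
      intro x y h hy
      induction h using TransGen.head_induction_on with
      | single h =>
        refine ⟨fun hx => .single (hrr' h hx hy), ?_⟩
        rintro rfl
        exact ⟨y, hy, h, .refl⟩
      | @head x c h h' ih =>
        refine ⟨fun hx => ?_, ?_⟩
        · by_cases hc : c = b
          · subst hc
            obtain ⟨c', hc', h1, h2⟩ := ih.2 rfl
            exact TransGen.head' (hrr' ⟨h.1, h1.2.1, htrans h.1 h1.2.1 h.2.2 h1.2.2⟩ hx hc') h2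
          · exact TransGen.head (hrr' h hx hc) (ih.1 hc)
        · rintro rfl
          have hc : c ≠ x := by rintro rfl; exact hirr _ h
          exact ⟨c, hc, h, (ih.1 hc).to_reflTransGen⟩
    intro h
    by_cases ha : a = b
    · subst ha
      obtain ⟨c, h1, h2⟩ := TransGen.tail'_iff.1 h
      have hc : c ≠ a := by rintro rfl; exact hirr _ h2
      have h3 : TransGen r a c := by
        rcases reflTransGen_iff_eq_or_transGen.1 h1 with h | h
        · exact (hc h).elim
        · exact h
      obtain ⟨c', hc', h4, h5⟩ := (key h3 hc).2 rfl
      exact ih' c (TransGen.head' (hrr' ⟨h2.1, h4.2.1, htrans h2.1 h4.2.1 h2.2.2 h4.2.2⟩ hc hc') h5)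
    · exact ih' a ((key h ha).1 ha)

namespace Data

variable {k n : ℕ} {C : Data k n}

/-! ### The tiles dual to the interactions -/

/-- The three regions at a trivalent vertex have gradients that are not collinear. -/
theorem ori_ne_zero (hC : C.Admissible) {v : ℝ × ℝ} {L R N : Finset (Fin n)}
    (hL : L ∈ C.regionsAt v) (hR : R ∈ C.regionsAt v) (hN : N ∈ C.regionsAt v) (h1 : L ≠ R)
    (h2 : N ≠ L) (h3 : N ≠ R) : C.ori L R N ≠ 0 := by
  -- If the gradient of `Y` were a convex combination of those of `X` and `W`, the term of `Y`, tied
  -- with both at `v`, could not exceed both of them anywhere.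
  have key : ∀ {X Y W}, X ∈ C.regionsAt v → Y ∈ C.regionsAt v → W ∈ C.regionsAt v →
      C.charge X < C.charge Y → C.charge Y < C.charge W → C.ori X Y W ≠ 0 := by
    intro X Y W hX hY hW hXY hYW h0
    obtain ⟨q, hq⟩ := live_of_mem_regionsAt hY
    have e1 := hq.2 X (live_of_mem_regionsAt hX).mem_bases (by rintro rfl; exact hXY.ne rfl)
    have e2 := hq.2 W (live_of_mem_regionsAt hW).mem_bases (by rintro rfl; exact hYW.ne rfl)
    rw [C.logTerm_eq _ v q, C.logTerm_eq Y v q] at e1 e2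
    have f1 := logTerm_eq_of_mem_regionsAt hX hY
    have f2 := logTerm_eq_of_mem_regionsAt hW hY
    rw [ori_eq] at h0
    simp only [slope] at e1 e2
    have g1 : 0 < (C.charge Y - C.charge X) * (q - v).1 + (C.charge₂ Y - C.charge₂ X) * (q - v).2 := by
      linarith
    have g2 : 0 < (C.charge Y - C.charge W) * (q - v).1 + (C.charge₂ Y - C.charge₂ W) * (q - v).2 := by
      linarith
    have g3 := mul_pos g1 (sub_pos.2 hYW)
    have g4 := mul_pos g2 (sub_pos.2 hXY)
    have : ∀ z : ℝ, ((C.charge₂ X - C.charge₂ Y) * (C.charge X - C.charge W) -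
      (C.charge X - C.charge Y) * (C.charge₂ X - C.charge₂ W)) * z = 0 := by
      intro z; rw [h0, zero_mul]
    linarith [this (q - v).2]
  have c1 := (live_of_mem_regionsAt hL).charge_ne hC (live_of_mem_regionsAt hR) h1
  have c2 := (live_of_mem_regionsAt hN).charge_ne hC (live_of_mem_regionsAt hL) h2
  have c3 := (live_of_mem_regionsAt hN).charge_ne hC (live_of_mem_regionsAt hR) h3
  have r1 := C.ori_rotate L R N
  have r2 := C.ori_rotate N L R
  have s1 := C.ori_swap L R N
  have s2 := C.ori_swap N L R
  have s3 := C.ori_swap R N L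
  intro h0
  rcases lt_or_gt_of_ne c1 with c1 | c1 <;> rcases lt_or_gt_of_ne c2 with c2 | c2 <;>
    rcases lt_or_gt_of_ne c3 with c3 | c3
  · exact key hN hL hR c2 c1 (by linarith)
  · linarith
  · exact key hL hN hR c2 c3 (by linarith)
  · exact key hL hR hN c1 c3 (by linarith)
  · exact key hN hR hL c3 c1 (by linarith)
  · exact key hR hN hL c3 c2 (by linarith)
  · linarith
  · exact key hR hL hN c1 c2 (by linarith)

theorem IsTrivalent.tripod (hC : C.Admissible) {Z : Set (ℝ × ℝ)} (hZ : C.IsInteraction Z)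
    (h : C.IsTrivalent Z) : ∃ v L R N, Z = {v} ∧ C.Tripod v L R N := by
  obtain ⟨v, rfl, hcard⟩ := h
  obtain ⟨L, R, N, h1, h2, h3, he⟩ := Set.ncard_eq_three.1 hcard
  have hiff : ∀ J, J ∈ C.regionsAt v ↔ J = L ∨ J = R ∨ J = N := fun J => by rw [he]; simp
  have hL := (hiff L).2 (by simp)
  have hR := (hiff R).2 (by simp)
  have hN := (hiff N).2 (by simp)
  rcases lt_or_gt_of_ne (ori_ne_zero hC hL hR hN h1 h2.symm h3.symm) with h | h
  · exact ⟨v, R, L, N, rfl, hZ, fun J => by rw [hiff]; tauto, h1.symm, h3.symm, h2.symm, by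
      rw [ori_swap]; linarith⟩
  · exact ⟨v, L, R, N, rfl, hZ, hiff, h1, h2.symm, h3.symm, h⟩

/-- The closure of the region of `J` meets `Z`. -/
def Touches (C : Data k n) (J : Finset (Fin n)) (Z : Set (ℝ × ℝ)) : Prop :=
  (closure (C.region J) ∩ Z).Nonempty

/-- The gradient of `logTerm J`, in coordinates sheared such that the second one is
`∑ j ∈ J, (κ_j - κ_i)²` up to a constant. -/
def height (C : Data k n) (i : Fin n) (J : Finset (Fin n)) : ℝ :=
  C.charge₂ J - 2 * C.κ i * C.charge J

/-- The relative interior of the polygon dual to an interaction, i.e. of the convex hull of the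
gradients of the regions touching it. -/
def tile (C : Data k n) (i : Fin n) (Z : Set (ℝ × ℝ)) : Set (ℝ × ℝ) :=
  {x | ∃ w : Finset (Fin n) → ℝ, (∀ J, C.Touches J Z → 0 < w J) ∧
    (∀ J, ¬ C.Touches J Z → w J = 0) ∧ ∑ J, w J = 1 ∧
    ∑ J, w J * C.charge J = x.1 ∧ ∑ J, w J * C.height i J = x.2}

theorem convex_tile (i : Fin n) (Z : Set (ℝ × ℝ)) : Convex ℝ (C.tile i Z) := by
  rintro x ⟨w, h1, h2, h3, h4, h5⟩ y ⟨w', h1', h2', h3', h4', h5'⟩ a b ha hb hab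
  have hsum : ∀ f : Finset (Fin n) → ℝ, ∑ J, (a * w J + b * w' J) * f J =
      a * ∑ J, w J * f J + b * ∑ J, w' J * f J := by
    intro f
    rw [Finset.mul_sum, Finset.mul_sum, ← Finset.sum_add_distrib]
    exact Finset.sum_congr rfl fun J _ => by ring
  refine ⟨fun J => a * w J + b * w' J, fun J hJ => ?_, fun J hJ => ?_, ?_, ?_, ?_⟩
  · have p1 := h1 J hJ
    have p2 := h1' J hJ
    rcases ha.eq_or_lt with rfl | ha
    · have : b = 1 := by linarith
      subst this; linarith
    · have := mul_pos ha p1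
      have := mul_nonneg hb p2.le
      linarith
  · simp [h2 J hJ, h2' J hJ]
  · have := hsum fun _ => 1
    simp only [mul_one, h3, h3'] at this
    rw [this]; exact hab
  · rw [hsum, h4, h4']; simp
  · rw [hsum, h5, h5']; simp

theorem tile_nonempty (hC : C.Admissible) (i : Fin n) {Z : Set (ℝ × ℝ)} (hZ : Z.Nonempty) :
    (C.tile i Z).Nonempty := by
  classical
  obtain ⟨p, hp⟩ := hZ
  obtain ⟨J₀, hJ₀⟩ := exists_mem_regionsAt hC p
  set S : Finset (Finset (Fin n)) := Finset.univ.filter fun J => C.Touches J Z with hS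
  have hJS : J₀ ∈ S := by simp only [hS, Finset.mem_filter, Finset.mem_univ, true_and]; exact ⟨p, hJ₀, hp⟩
  have hpos : (0 : ℝ) < S.card := by exact_mod_cast Finset.card_pos.2 ⟨J₀, hJS⟩
  refine ⟨(_, _), fun J => if C.Touches J Z then (S.card : ℝ)⁻¹ else 0, fun J hJ => ?_,
    fun J hJ => by simp [hJ], ?_, rfl, rfl⟩
  · simp only [hJ, if_true]; exact inv_pos.2 hpos
  · rw [← Finset.sum_filter, ← hS, Finset.sum_const, nsmul_eq_mul]
    exact mul_inv_cancel₀ hpos.ne'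

/-- A point of the tile of `Z` is a convex combination of the gradients of regions which have a
common point in `Z`, but no common point outside of `Z`. -/
theorem exists_weights (hC : C.Admissible) {i : Fin n} {Z : Set (ℝ × ℝ)} (hZ : C.IsInteraction Z)
    (hgen : C.IsTrivalent Z ∨ C.IsXCrossing Z) {x : ℝ × ℝ} (hx : x ∈ C.tile i Z) :
    ∃ z ∈ Z, ∃ w : Finset (Fin n) → ℝ, (∀ J, 0 ≤ w J) ∧ (∀ J, w J ≠ 0 → J ∈ C.regionsAt z) ∧
      ∑ J, w J = 1 ∧ ∑ J, w J * C.charge J = x.1 ∧ ∑ J, w J * C.height i J = x.2 ∧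
      ∀ z', (∀ J, w J ≠ 0 → J ∈ C.regionsAt z') → z' ∈ Z := by
  obtain ⟨w, h1, h2, h3, h4, h5⟩ := hx
  have h0 : ∀ J, 0 ≤ w J := fun J => by
    by_cases hJ : C.Touches J Z
    · exact (h1 J hJ).le
    · exact (h2 J hJ).ge
  rcases hgen with ht | hX
  · obtain ⟨v, L, R, N, rfl, htr⟩ := IsTrivalent.tripod hC hZ ht
    have htouch : ∀ J, C.Touches J {v} ↔ J ∈ C.regionsAt v := fun J => by
      simp only [Touches, Set.inter_singleton_nonempty]; rfl
    refine ⟨v, rfl, w, h0, fun J hJ => ?_, h3, h4, h5, fun z' hz' => ?_⟩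
    · by_contra hcon
      exact hJ (h2 J fun h => hcon ((htouch J).1 h))
    have hm : ∀ J, J ∈ C.regionsAt v → J ∈ C.regionsAt z' := fun J hJ =>
      hz' J (h1 J ((htouch J).2 hJ)).ne'
    have hL := (htr.mem_iff L).2 (by simp)
    have hR := (htr.mem_iff R).2 (by simp)
    have hN := (htr.mem_iff N).2 (by simp)
    obtain ⟨s, rfl⟩ := exists_eq_add_smul_direction hC (live_of_mem_regionsAt hL)
      (live_of_mem_regionsAt hR) htr.ne (logTerm_eq_of_mem_regionsAt hL hR)
      (logTerm_eq_of_mem_regionsAt (hm L hL) (hm R hR))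
    have e := logTerm_eq_of_mem_regionsAt (hm L hL) (hm N hN)
    rw [logTerm_add_smul, logTerm_add_smul, logTerm_eq_of_mem_regionsAt hL hN] at e
    have hp := htr.pos
    rw [ori] at hp
    have hs : s = 0 := by
      have : s * (C.slope L (C.direction L R) - C.slope N (C.direction L R)) = 0 := by linarith
      exact (mul_eq_zero.1 this).resolve_right hp.ne'
    simp [hs]
  · obtain ⟨A, hA⟩ := hX.crossing hZ
    have htouch : ∀ J, C.Touches J Z ↔ ∃ m, J = A m := hA.mem_iff
    have e4 : ∀ m : Fin 4, m ≠ m + 1 ∧ m ≠ m + 2 ∧ m ≠ m + 3 ∧ m + 1 ≠ m + 2 ∧ m + 1 ≠ m + 3 ∧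
      m + 2 ≠ m + 3 := by decide
    -- The parallelogram relation permits moving weight t from the diagonal `m + 1`, `m + 3` to the
    -- diagonal `m`, `m + 2` without changing the point. The latter two weights stay positive, and
    -- the common points of these non-adjacent regions all lie in `Z`.
    have main : ∀ (m : Fin 4) (t : ℝ) (z : ℝ × ℝ), z ∈ Z → A m ∈ C.regionsAt z →
        A (m + 2) ∈ C.regionsAt z → 0 ≤ t → t ≤ w (A (m + 1)) → t ≤ w (A (m + 3)) →
        (w (A (m + 1)) ≠ t → A (m + 1) ∈ C.regionsAt z) →
        (w (A (m + 3)) ≠ t → A (m + 3) ∈ C.regionsAt z) →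
        ∃ z ∈ Z, ∃ w : Finset (Fin n) → ℝ, (∀ J, 0 ≤ w J) ∧ (∀ J, w J ≠ 0 → J ∈ C.regionsAt z) ∧
        ∑ J, w J = 1 ∧ ∑ J, w J * C.charge J = x.1 ∧ ∑ J, w J * C.height i J = x.2 ∧
        ∀ z', (∀ J, w J ≠ 0 → J ∈ C.regionsAt z') → z' ∈ Z := by
      intro m t z hz hm hm2 ht0 ht1 ht3 hm1 hm3
      obtain ⟨n01, n02, n03, n12, n13, n23⟩ := e4 m
      have i01 := hA.injective.ne n01
      have i02 := hA.injective.ne n02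
      have i03 := hA.injective.ne n03
      have i12 := hA.injective.ne n12
      have i13 := hA.injective.ne n13
      have i23 := hA.injective.ne n23
      have hsum : ∀ f : Finset (Fin n) → ℝ,
          ∑ J, (w J + (if J = A m then t else 0) + (if J = A (m + 2) then t else 0) -
            (if J = A (m + 1) then t else 0) - (if J = A (m + 3) then t else 0)) * f J =
          ∑ J, w J * f J + t * (f (A m) + f (A (m + 2)) - f (A (m + 1)) - f (A (m + 3))) := by
        intro f
        simp only [sub_mul, add_mul, Finset.sum_sub_distrib, Finset.sum_add_distrib, ite_mul,
          zero_mul, Finset.sum_ite_eq', Finset.mem_univ, if_true]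
        ring
      have hw : ∀ m, 0 < w (A m) := fun m => h1 _ ((htouch _).2 ⟨m, rfl⟩)
      have v0 : ∀ J, J = A m ∨ J = A (m + 1) ∨ J = A (m + 2) ∨ J = A (m + 3) ∨ (w J = 0 ∧
          J ≠ A m ∧ J ≠ A (m + 1) ∧ J ≠ A (m + 2) ∧ J ≠ A (m + 3)) := by
        intro J
        by_cases hJ : C.Touches J Z
        · obtain ⟨j, rfl⟩ := (htouch J).1 hJ
          rcases fin_four_cases m j with rfl | rfl | rfl | rfl <;> simp
        · have := h2 J hJ
          have hne : ∀ j, J ≠ A j := fun j hj => hJ ((htouch J).2 ⟨j, hj⟩)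
          right; right; right; right
          exact ⟨this, hne _, hne _, hne _, hne _⟩
      have c1 := hA.charge_eq m
      have c2 := hA.charge₂_eq m
      refine ⟨z, hz, fun J => w J + (if J = A m then t else 0) + (if J = A (m + 2) then t else 0) -
            (if J = A (m + 1) then t else 0) - (if J = A (m + 3) then t else 0),
            fun J => ?_, fun J => ?_, ?_, ?_, ?_, fun z' hz' => ?_⟩
      · rcases v0 J with rfl | rfl | rfl | rfl | ⟨h, g0, g1, g2, g3⟩
        · simp only [i01, i02, i03, if_true, if_false]; linarith [hw m]
        · simp only [Ne.symm i01, i12, i13, if_true, if_false]; linarith [hw m]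
        · simp only [Ne.symm i02, Ne.symm i12, i23, if_true, if_false]; linarith [hw (m + 2)]
        · simp only [Ne.symm i03, Ne.symm i13, Ne.symm i23, if_true, if_false]; linarith [hw m]
        · simp [h, g0, g1, g2, g3]
      · rcases v0 J with rfl | rfl | rfl | rfl | ⟨h, g0, g1, g2, g3⟩
        · exact fun _ => hm
        · simp only [Ne.symm i01, i12, i13, if_true, if_false]
          exact fun h => hm1 fun h' => h (by linarith)
        · exact fun _ => hm2
        · simp only [Ne.symm i03, Ne.symm i13, Ne.symm i23, if_true, if_false]
          exact fun h => hm3 fun h' => h (by linarith)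
        · simp [h, g0, g1, g2, g3]
      · have := hsum fun _ => 1
        simp only [mul_one] at this
        rw [this, h3]; ring
      · rw [hsum, h4]
        linear_combination t * -c1
      · rw [hsum, h5]
        simp only [height]
        linear_combination -t * c2 + 2 * C.κ i * t * c1
      · refine hZ.mem_of_not_adjacent hC (Ne.symm i02) (hA.not_adjacent m) hz hm2 hm
          (hz' _ ?_) (hz' _ ?_)
        · simp only [Ne.symm i02, Ne.symm i12, i23, if_true, if_false]
          have := hw (m + 2)
          intro h; linarith
        · simp only [i01, i02, i03, if_true, if_false]
          have := hw m
          intro h; linarith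
    -- The diagonal cuts the parallelogram into two triangles, each realised by a point of `Z`;
    -- cancelling the smaller of the other two weights places the point in one of them.
    have step : ∀ m : Fin 4, (∃ z ∈ Z, A m ∈ C.regionsAt z ∧ A (m + 1) ∈ C.regionsAt z ∧
        A (m + 2) ∈ C.regionsAt z) → (∃ z ∈ Z, A m ∈ C.regionsAt z ∧ A (m + 2) ∈ C.regionsAt z ∧
        A (m + 3) ∈ C.regionsAt z) → ∃ z ∈ Z, ∃ w : Finset (Fin n) → ℝ, (∀ J, 0 ≤ w J) ∧
        (∀ J, w J ≠ 0 → J ∈ C.regionsAt z) ∧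
        ∑ J, w J = 1 ∧ ∑ J, w J * C.charge J = x.1 ∧ ∑ J, w J * C.height i J = x.2 ∧
        ∀ z', (∀ J, w J ≠ 0 → J ∈ C.regionsAt z') → z' ∈ Z := by
      rintro m ⟨z, hz, a0, a1, a2⟩ ⟨z', hz', b0, b2, b3⟩
      rcases le_total (w (A (m + 1))) (w (A (m + 3))) with h | h
      · exact main m (w (A (m + 1))) z' hz' b0 b2 (h0 _) le_rfl h (fun h => (h rfl).elim) fun _ => b3
      · exact main m (w (A (m + 3))) z hz a0 a2 (h0 _) h le_rfl (fun _ => a1) fun h => (h rfl).elim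
    have third : ∀ m : Fin 4, ∃ z ∈ Z, A m ∈ C.regionsAt z ∧ A (m + 1) ∈ C.regionsAt z ∧
        (A (m + 2) ∈ C.regionsAt z ∨ A (m + 3) ∈ C.regionsAt z) := by
      intro m
      obtain ⟨v, hv, hst⟩ := hA.starts m
      have hs := hA.soliton m
      obtain ⟨N, hN, g1, g2⟩ := StartPoint.exists_third hC hs.live.1 hs.live.2 hs.ne hst
      have hLR := StartPoint.mem_regionsAt hst
      obtain ⟨j, rfl⟩ := (htouch N).1 ⟨v, hN, hv⟩
      refine ⟨v, hv, hLR.2, hLR.1, ?_⟩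
      rcases fin_four_cases m j with rfl | rfl | rfl | rfl
      exacts [(g2 rfl).elim, (g1 rfl).elim, Or.inl hN, Or.inr hN]
    have par : ∀ p : ℝ × ℝ, C.logTerm (A 0) p + C.logTerm (A 2) p - C.logTerm (A 1) p -
        C.logTerm (A 3) p = C.logTerm (A 0) 0 + C.logTerm (A 2) 0 - C.logTerm (A 1) 0 -
        C.logTerm (A 3) 0 := by
      intro p
      have c1 : C.charge (A 1) - C.charge (A 0) = C.charge (A 2) - C.charge (A 3) := hA.charge_eq 0
      have c2 : C.charge₂ (A 1) - C.charge₂ (A 0) = C.charge₂ (A 2) - C.charge₂ (A 3) :=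
        hA.charge₂_eq 0
      simp only [C.logTerm_eq _ 0 p, slope, sub_zero]
      linear_combination (-p.1) * c1 - p.2 * c2
    have hbase : ∀ m, A m ∈ C.bases := fun m => (hA.soliton m).live.2.mem_bases
    have hmem : ∀ {v : ℝ × ℝ} {m m' : Fin 4}, A m ∈ C.regionsAt v →
        C.logTerm (A m) v ≤ C.logTerm (A m') v → A m' ∈ C.regionsAt v := by
      intro v m m' h hle
      exact mem_regionsAt_iff.2 ⟨(hA.soliton m').live.2, hbase m', fun I hI =>
        ((isMaxAt_of_mem_regionsAt h).2 I hI).trans hle⟩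
    obtain ⟨z, hz, a0, a1, ha⟩ := third 0
    obtain ⟨z', hz', b2, b3, hb⟩ := third 2
    rw [show (0 : Fin 4) + 1 = 1 from rfl] at a1
    rw [show (0 : Fin 4) + 2 = 2 from rfl, show (0 : Fin 4) + 3 = 3 from rfl] at ha
    rw [show (2 : Fin 4) + 1 = 3 from rfl] at b3
    rw [show (2 : Fin 4) + 2 = 0 from rfl, show (2 : Fin 4) + 3 = 1 from rfl] at hb
    have pz := par z
    have pz' := par z'
    -- Two triangles on opposite sides of one diagonal are the case of `step`. If they belong to
    -- different diagonals, the constant value in `par` is both nonnegative and nonpositive, and all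
    -- four regions meet at `z`.
    rcases ha with a2 | a3 <;> rcases hb with b0 | b1
    · exact step 0 ⟨z, hz, a0, a1, a2⟩ ⟨z', hz', b0, b2, b3⟩
    · have a3 : A 3 ∈ C.regionsAt z := hmem a0 (by
        have := (isMaxAt_of_mem_regionsAt b1).2 (A 0) (hbase 0)
        have := logTerm_eq_of_mem_regionsAt b2 b1
        have := logTerm_eq_of_mem_regionsAt b3 b1
        have := logTerm_eq_of_mem_regionsAt a2 a1
        linarith)
      exact step 0 ⟨z, hz, a0, a1, a2⟩ ⟨z, hz, a0, a2, a3⟩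
    · have a2 : A 2 ∈ C.regionsAt z := hmem a0 (by
        have := (isMaxAt_of_mem_regionsAt b0).2 (A 1) (hbase 1)
        have := logTerm_eq_of_mem_regionsAt b2 b0
        have := logTerm_eq_of_mem_regionsAt b3 b0
        have := logTerm_eq_of_mem_regionsAt a3 a0
        have := logTerm_eq_of_mem_regionsAt a1 a0
        linarith)
      exact step 0 ⟨z, hz, a0, a1, a2⟩ ⟨z, hz, a0, a2, a3⟩
    · exact step 1 ⟨z', hz', b1, b2, b3⟩ ⟨z, hz, a1, a3, a0⟩

/-- Convex duality: a point x of a tile is a subgradient of the maximum of the terms at a point of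
the interaction. If x lies in two tiles, the two weighted averages of terms are affine in p with the
same gradient, and comparing them at `z` and `z'` shows them equal. So the regions supporting x at
`z'` are also maximal at `z`, which forces `z` into `Z'`. -/
theorem disjoint_tile (hC : C.Admissible) (hgen : C.IsGeneric) (i : Fin n) {Z Z' : Set (ℝ × ℝ)}
    (hZ : C.IsInteraction Z) (hZ' : C.IsInteraction Z') (hne : Z ≠ Z') :
    Disjoint (C.tile i Z) (C.tile i Z') := by
  rw [Set.disjoint_left]
  intro x hx hx'
  obtain ⟨z, hz, w, h0, h1, h2, h3, h4, h5⟩ := exists_weights hC hZ (hgen Z hZ) hx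
  obtain ⟨z', hz', w', h0', h1', h2', h3', h4', h5'⟩ := exists_weights hC hZ' (hgen Z' hZ') hx'
  have expand : ∀ (u : Finset (Fin n) → ℝ) (p : ℝ × ℝ), ∑ J, u J * C.charge J = x.1 →
      ∑ J, u J * C.height i J = x.2 → ∑ J, u J * C.logTerm J p =
      ∑ J, u J * C.logTerm J 0 + (x.1 * p.1 + (x.2 + 2 * C.κ i * x.1) * p.2) := by
    intro u p e1 e2
    rw [← e1, ← e2, Finset.mul_sum, ← Finset.sum_add_distrib, Finset.sum_mul, Finset.sum_mul,
      ← Finset.sum_add_distrib, ← Finset.sum_add_distrib]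
    refine Finset.sum_congr rfl fun J _ => ?_
    rw [C.logTerm_eq J 0 p, slope, height, sub_zero]; ring
  obtain ⟨M, hM⟩ : ∃ M : ℝ × ℝ → ℝ, ∀ p J, (J ∈ C.bases → C.logTerm J p ≤ M p) ∧
      (J ∈ C.regionsAt p → C.logTerm J p = M p) := by
    refine ⟨fun p => C.logTerm (exists_mem_regionsAt hC p).choose p, fun p J => ⟨fun hJ => ?_,
      fun hJ => ?_⟩⟩
    · exact (isMaxAt_of_mem_regionsAt (exists_mem_regionsAt hC p).choose_spec).2 J hJ
    · exact logTerm_eq_of_mem_regionsAt hJ (exists_mem_regionsAt hC p).choose_spec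
  have eqM : ∀ (u : Finset (Fin n) → ℝ) (p : ℝ × ℝ), (∀ J, u J ≠ 0 → J ∈ C.regionsAt p) →
      ∑ J, u J = 1 → ∑ J, u J * C.logTerm J p = M p := by
    intro u p hu hs
    rw [← one_mul (M p), ← hs, Finset.sum_mul]
    refine Finset.sum_congr rfl fun J _ => ?_
    by_cases hJ : u J = 0
    · simp [hJ]
    · rw [(hM p J).2 (hu J hJ)]
  have leM : ∀ (u : Finset (Fin n) → ℝ) (p q : ℝ × ℝ), (∀ J, u J ≠ 0 → J ∈ C.regionsAt q) →
      (∀ J, 0 ≤ u J) → ∀ J, u J * C.logTerm J p ≤ u J * M p := by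
    intro u p q hu h0 J
    by_cases hJ : u J = 0
    · simp [hJ]
    · exact mul_le_mul_of_nonneg_left ((hM p J).1 (live_of_mem_regionsAt (hu J hJ)).mem_bases) (h0 J)
  have sumM : ∀ (u : Finset (Fin n) → ℝ) (p : ℝ × ℝ), ∑ J, u J = 1 → ∑ J, u J * M p = M p := by
    intro u p hs
    rw [← Finset.sum_mul, hs, one_mul]
  have k1 := Finset.sum_le_sum fun J (_ : J ∈ Finset.univ) => leM w' z z' h1' h0' J
  have k2 := Finset.sum_le_sum fun J (_ : J ∈ Finset.univ) => leM w z' z h1 h0 J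
  rw [sumM _ _ h2', expand w' z h3' h4'] at k1
  rw [sumM _ _ h2, expand w z' h3 h4] at k2
  have k3 := eqM w z h1 h2
  have k4 := eqM w' z' h1' h2'
  rw [expand w z h3 h4] at k3
  rw [expand w' z' h3' h4'] at k4
  -- Equality of the weighted average with the maximum forces equality in every term of nonzero
  -- weight.
  have k5 : ∑ J, w' J * C.logTerm J z = ∑ J, w' J * M z := by
    rw [sumM _ _ h2', expand w' z h3' h4']; linarith
  have k6 := (Finset.sum_eq_sum_iff_of_le fun J _ => leM w' z z' h1' h0' J).1 k5
  have : z ∈ Z' := h5' z fun J hJ => by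
    have h := mul_left_cancel₀ hJ (k6 J (Finset.mem_univ J))
    have hl := live_of_mem_regionsAt (h1' J hJ)
    exact mem_regionsAt_iff.2 ⟨hl, hl.mem_bases, fun I hI => h ▸ (hM z I).1 hI⟩
  exact hne (hZ.eq_of_mem_mem hZ' hz this)

/-! ### Trips cross the tiles from right to left -/

theorem sum_ori (i : Fin n) (L R : Finset (Fin n)) (w : Finset (Fin n) → ℝ) (x : ℝ × ℝ)
    (h3 : ∑ J, w J = 1) (h4 : ∑ J, w J * C.charge J = x.1) (h5 : ∑ J, w J * C.height i J = x.2) :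
    ∑ J, w J * C.ori L R J = (C.height i L - C.height i R) * (C.charge L - x.1) -
      (C.charge L - C.charge R) * (C.height i L - x.2) := by
  have : ∀ J, w J * C.ori L R J =
      ((C.height i L - C.height i R) * C.charge L - (C.charge L - C.charge R) * C.height i L) * w J -
      (C.height i L - C.height i R) * (w J * C.charge J) +
      (C.charge L - C.charge R) * (w J * C.height i J) := by
    intro J; simp only [ori_eq, height]; ring
  simp only [this, Finset.sum_add_distrib, Finset.sum_sub_distrib, ← Finset.mul_sum, h3, h4, h5]
  ring

/-- Near its edge dual to a line-soliton, the tile has points at the height of the midpoint of this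
edge. -/
theorem exists_mem_tile_snd_eq {i : Fin n} {Z : Set (ℝ × ℝ)} {L R : Finset (Fin n)}
    (hL : C.Touches L Z) (hR : C.Touches R Z) (hh : C.height i L < C.height i R)
    {c : ℝ × ℝ} (hc : c ∈ C.tile i Z) :
    ∃ q ∈ C.tile i Z, q.2 = (C.height i L + C.height i R) / 2 ∧ ∃ t : ℝ, 0 < t ∧
      (C.height i L - C.height i R) * (C.charge L - q.1) -
        (C.charge L - C.charge R) * (C.height i L - q.2) =
      t * ((C.height i L - C.height i R) * (C.charge L - c.1) -
        (C.charge L - C.charge R) * (C.height i L - c.2)) := by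
  obtain ⟨w, h1, h2, h3, h4, h5⟩ := hc
  set D := C.height i R - C.height i L with hD
  have hD0 : 0 < D := by linarith
  set e := (C.height i L + C.height i R) / 2 - c.2 with he
  -- The midpoint of the edge is pushed slightly towards `c`, with relative weight τ, and slid along
  -- the edge by s to correct its height. This τ is small enough for |s| ≤ 1/2, so both end weights
  -- remain nonnegative.
  set τ := D / (2 * (1 + |e|)) with hτ
  have hae : 0 < 1 + |e| := by positivity
  have hτ0 : 0 < τ := by positivity
  have hτe : |τ * e| ≤ D / 2 := by
    rw [abs_mul, abs_of_pos hτ0, hτ, div_mul_eq_mul_div, div_le_div_iff₀ (by positivity) (by norm_num)]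
    nlinarith [abs_nonneg e]
  have hse : |τ * e / D| ≤ 1 / 2 := by
    rw [abs_div, abs_of_pos hD0, div_le_iff₀ hD0]; linarith
  obtain ⟨hs1, hs2⟩ := abs_le.1 hse
  set s := τ * e / D with hs
  have hsD : s * D = τ * e := div_mul_cancel₀ _ hD0.ne'
  have hτ1 : 0 < 1 + τ := by linarith
  have hsum : ∀ f : Finset (Fin n) → ℝ,
      ∑ J, ((if J = L then 1 / 2 - s else 0) + (if J = R then 1 / 2 + s else 0) + τ * w J) /
        (1 + τ) * f J =
      ((1 / 2 - s) * f L + (1 / 2 + s) * f R + τ * ∑ J, w J * f J) / (1 + τ) := by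
    intro f
    have : ∀ J, ((if J = L then 1 / 2 - s else 0) + (if J = R then 1 / 2 + s else 0) + τ * w J) /
        (1 + τ) * f J = (1 + τ)⁻¹ * ((if J = L then (1 / 2 - s) * f J else 0) +
          (if J = R then (1 / 2 + s) * f J else 0) + τ * (w J * f J)) := by
      intro J; split_ifs <;> field_simp <;> ring
    simp only [this]
    rw [← Finset.mul_sum, Finset.sum_add_distrib, Finset.sum_add_distrib, ← Finset.mul_sum]
    simp only [Finset.sum_ite_eq', Finset.mem_univ, if_true]
    field_simp
  refine ⟨(((1 / 2 - s) * C.charge L + (1 / 2 + s) * C.charge R + τ * c.1) / (1 + τ),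
    (C.height i L + C.height i R) / 2),
    ⟨fun J => ((if J = L then 1 / 2 - s else 0) + (if J = R then 1 / 2 + s else 0) + τ * w J) /
        (1 + τ), fun J hJ => ?_, fun J hJ => ?_, ?_, ?_, ?_⟩, rfl, τ / (1 + τ), div_pos hτ0 hτ1, ?_⟩
  · have hw := mul_pos hτ0 (h1 J hJ)
    refine div_pos ?_ hτ1
    split_ifs <;> linarith
  · have n1 : J ≠ L := by rintro rfl; exact hJ hL
    have n2 : J ≠ R := by rintro rfl; exact hJ hR
    simp [n1, n2, h2 J hJ]
  · have := hsum fun _ => 1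
    simp only [mul_one, h3] at this
    rw [this]; field_simp; ring
  · rw [hsum, h4]
  · rw [hsum, h5, div_eq_iff hτ1.ne']
    simp only
    have : c.2 = (C.height i L + C.height i R) / 2 - e := by rw [he]; ring
    rw [this]
    linear_combination hsD
  · simp only
    field_simp
    have : c.2 = (C.height i L + C.height i R) / 2 - e := by rw [he]; ring
    rw [this]
    have hDs : s * (C.height i R - C.height i L) = τ * e := by rw [← hD]; exact hsD
    linear_combination (-2 * (C.charge L - C.charge R)) * hDs

/-- `d` leads from `Z'` to `Z`. The two tiles lie on opposite sides of the dual edge, by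
`StartsAt.side`, and this edge is not horizontal; so both have points at the height of its midpoint,
that of `Z` further left. -/
theorem Follows.leftOf_tile (hC : C.Admissible) (hgen : C.IsGeneric) {i : Fin n} {d : C.Piece}
    (hd : Follows i d) {Z Z' : {Z : Set (ℝ × ℝ) // C.IsInteraction Z}}
    (hst : C.StartsAt d.1.1 d.1.2 Z'.1) (hst' : C.StartsAt d.1.2 d.1.1 Z.1) :
    LeftOf (fun Z : {Z : Set (ℝ × ℝ) // C.IsInteraction Z} => C.tile i Z.1) Z Z' := by
  obtain ⟨⟨L, R⟩, hs⟩ := d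
  obtain ⟨Z, hZ⟩ := Z
  obtain ⟨Z', hZ'⟩ := Z'
  obtain ⟨hiL, hiR⟩ := hd
  simp only at *
  have hadj : Adjacent L R := ⟨hs.1, hs.2.1⟩
  have hi := hadj.sdiff_eq hiL hiR
  obtain ⟨-, j, -, hj⟩ := hadj.exists_sdiff
  have hij : i ≠ j := by rintro rfl; exact hiR (mem_sdiff_of_eq hj).1
  have c1 := C.charge_sub_of_sdiff hi hj
  have c2 := C.charge₂_sub_of_sdiff hi hj
  have hκ : C.κ i - C.κ j ≠ 0 := sub_ne_zero.2 fun h => hij (hC.strictMono.injective h)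
  -- The shear by κ_i makes this difference a square, so its sign does not depend on the exchanged
  -- index j.
  have hheight : C.height i R - C.height i L = (C.κ i - C.κ j) ^ 2 := by
    simp only [height]; linear_combination -c2 + 2 * C.κ i * c1
  have hlt : C.height i L < C.height i R := by
    have := pow_pos (abs_pos.2 hκ) 2
    rw [sq_abs] at this
    linarith
  refine ⟨fun h => ?_, ?_⟩
  · obtain rfl : Z = Z' := congrArg Subtype.val h
    exact StartsAt.not_rev hC hZ (hgen Z hZ) hs hst hst'
  have touch : ∀ {X Y W}, C.StartsAt X Y W → C.Touches X W ∧ C.Touches Y W := by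
    rintro X Y W ⟨v, hv, h⟩
    have := StartPoint.mem_regionsAt h
    exact ⟨⟨v, this.1, hv⟩, ⟨v, this.2, hv⟩⟩
  have ori_self : C.ori L R L = 0 ∧ C.ori L R R = 0 := by
    constructor
    · rw [ori]; ring
    · rw [ori, slope_direction]; ring
  have nonempty : ∀ {W}, C.IsInteraction W → W.Nonempty := by
    rintro W ⟨p, hp, rfl⟩
    exact ⟨p, mem_connectedComponentIn hp⟩
  obtain ⟨c, hc⟩ := tile_nonempty hC i (nonempty hZ)
  obtain ⟨c', hc'⟩ := tile_nonempty hC i (nonempty hZ')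
  obtain ⟨p, hp, hp2, t, ht, het⟩ := exists_mem_tile_snd_eq (touch hst').2 (touch hst').1 hlt hc
  obtain ⟨q, hq, hq2, t', ht', het'⟩ := exists_mem_tile_snd_eq (touch hst).1 (touch hst).2 hlt hc'
  refine ⟨p, hp, q, hq, hp2.trans hq2.symm, ?_⟩
  have neg : (C.height i L - C.height i R) * (C.charge L - c.1) -
      (C.charge L - C.charge R) * (C.height i L - c.2) < 0 := by
    obtain ⟨w, h1, h2, h3, h4, h5⟩ := hc
    obtain ⟨hside, J, hJ, hJR, hJL⟩ := StartsAt.side hC hZ (hgen Z hZ) hs.symm hst'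
    rw [← sum_ori i L R w c h3 h4 h5]
    refine Finset.sum_neg' (fun K _ => ?_) ⟨J, Finset.mem_univ J, ?_⟩
    · by_cases hK : C.Touches K Z
      · by_cases hKL : K = L
        · rw [hKL, ori_self.1, mul_zero]
        by_cases hKR : K = R
        · rw [hKR, ori_self.2, mul_zero]
        have := hside K hK hKR hKL
        rw [ori_swap] at this
        exact mul_nonpos_of_nonneg_of_nonpos (h1 K hK).le (by linarith)
      · rw [h2 K hK, zero_mul]
    · have := hside J hJ hJR hJL
      rw [ori_swap] at this
      exact mul_neg_of_pos_of_neg (h1 J hJ) (by linarith)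
  have pos : 0 < (C.height i L - C.height i R) * (C.charge L - c'.1) -
      (C.charge L - C.charge R) * (C.height i L - c'.2) := by
    obtain ⟨w, h1, h2, h3, h4, h5⟩ := hc'
    obtain ⟨hside, J, hJ, hJL, hJR⟩ := StartsAt.side hC hZ' (hgen Z' hZ') hs hst
    rw [← sum_ori i L R w c' h3 h4 h5]
    refine Finset.sum_pos' (fun K _ => ?_) ⟨J, Finset.mem_univ J, mul_pos (h1 J hJ) (hside J hJ hJL hJR)⟩
    by_cases hK : C.Touches K Z'
    · by_cases hKL : K = L
      · rw [hKL, ori_self.1, mul_zero]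
      by_cases hKR : K = R
      · rw [hKR, ori_self.2, mul_zero]
      exact mul_nonneg (h1 K hK).le (hside K hK hKL hKR).le
    · rw [h2 K hK, zero_mul]
  have n1 := mul_neg_of_pos_of_neg ht neg
  have n2 := mul_pos ht' pos
  rw [← het] at n1
  rw [← het', hq2] at n2
  rw [hp2] at n1
  have : (C.height i R - C.height i L) * p.1 < (C.height i R - C.height i L) * q.1 := by linarith
  exact lt_of_mul_lt_mul_left this (by linarith)

/-- A tile depends only on the set of regions touching its interaction; since tiles are nonempty and
disjoint, this finite datum determines the interaction. -/
theorem finite_interaction (hC : C.Admissible) (hgen : C.IsGeneric) (i : Fin n) :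
    Finite {Z : Set (ℝ × ℝ) // C.IsInteraction Z} := by
  refine Finite.of_injective
    (fun Z : {Z : Set (ℝ × ℝ) // C.IsInteraction Z} => {J : Finset (Fin n) | C.Touches J Z.1}) ?_
  rintro ⟨Z, hZ⟩ ⟨Z', hZ'⟩ h
  simp only at h
  have h' : ∀ J, C.Touches J Z ↔ C.Touches J Z' := fun J => Set.ext_iff.1 h J
  by_contra hne
  have hne' : Z ≠ Z' := fun e => hne (by subst e; rfl)
  obtain ⟨p, hp, e⟩ := id hZ
  obtain ⟨c, hc⟩ := tile_nonempty hC i (Z := Z) ⟨p, e ▸ mem_connectedComponentIn hp⟩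
  refine Set.disjoint_left.1 (disjoint_tile hC hgen i hZ hZ' hne') hc ?_
  simpa only [tile, h'] using hc

/-- Every directed piece with `i` on its left, but not on its right, is obtained by following such
pieces from one that comes from infinity. -/
theorem Follows.induction (hC : C.Admissible) (hgen : C.IsGeneric) (π : Equiv.Perm (Fin n))
    {i : Fin n} {P : C.Piece → Prop}
    (inf : ∀ d : C.Piece, Follows i d → C.FromInfinity d.1.1 d.1.2 → P d)
    (step : ∀ d d' : C.Piece, P d → (C.plabicGraph π).Next d d' → P d') (d : C.Piece)
    (hd : Follows i d) : P d := by
  classical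
  -- Going back along a trip leads to tiles further right. On finitely many interactions an acyclic
  -- relation has a well-founded transitive closure, which supports the induction.
  set r : {Z : Set (ℝ × ℝ) // C.IsInteraction Z} → {Z : Set (ℝ × ℝ) // C.IsInteraction Z} → Prop :=
    Function.swap (LeftOf (fun Z : {Z : Set (ℝ × ℝ) // C.IsInteraction Z} => C.tile i Z.1)) with hr
  have := finite_interaction hC hgen i
  have := Fintype.ofFinite {Z : Set (ℝ × ℝ) // C.IsInteraction Z}
  have hirr : Std.Irrefl (Relation.TransGen r) := ⟨fun Z h => by
    refine leftOf_acyclic (fun Z => convex_tile i Z.1) (fun Z Z' h => disjoint_tile hC hgen i Z.2 Z'.2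
      fun e => h (Subtype.ext e)) Finset.univ Z (O := fun Z : {Z : Set (ℝ × ℝ) // C.IsInteraction Z} =>
      C.tile i Z.1) ?_
    simp only [Finset.mem_univ, true_and]
    rw [hr, Relation.transGen_swap] at h
    exact h⟩
  have hwf : WellFounded (Relation.TransGen r) := Finite.wellFounded_of_trans_of_irrefl _
  have main : ∀ Z : {Z : Set (ℝ × ℝ) // C.IsInteraction Z}, ∀ d : C.Piece, Follows i d →
      C.StartsAt d.1.1 d.1.2 Z.1 → P d := by
    intro Z
    induction Z using hwf.induction with
    | _ Z ih =>
      intro d hd hst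
      obtain ⟨d', hd', hst', hnext⟩ := hd.exists_prev hC hgen π Z.2 hst
      refine step d' d ?_ hnext
      by_cases hinf : C.FromInfinity d'.1.1 d'.1.2
      · exact inf d' hd' hinf
      obtain ⟨Z', hZ', hst''⟩ := exists_startsAt hC d'.2 hinf
      exact ih ⟨Z', hZ'⟩ (.single (hd'.leftOf_tile hC hgen (Z' := ⟨Z', hZ'⟩) hst'' hst')) d' hd' hst''
  by_cases hinf : C.FromInfinity d.1.1 d.1.2
  · exact inf d hd hinf
  obtain ⟨Z, hZ, hst⟩ := exists_startsAt hC d.2 hinf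
  exact main ⟨Z, hZ⟩ d hd hst

end Data

end KPSoliton

end

noncomputable section

namespace KPSoliton

namespace Data

variable {k n : ℕ} {C : Data k n}

/-! ### The matroid of the columns of `A` -/

/-- The column `m` of `A` is in the span of the columns in `s`. -/
def InSpan (C : Data k n) (m : Fin n) (s : Set (Fin n)) : Prop :=
  C.A.col m ∈ Submodule.span ℝ (C.A.col '' s)

theorem inSpan_of_mem {m : Fin n} {s : Set (Fin n)} (h : m ∈ s) : C.InSpan m s :=
  Submodule.subset_span ⟨m, h, rfl⟩

theorem InSpan.trans {m : Fin n} {s t : Set (Fin n)} (h : C.InSpan m s)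
    (hs : ∀ a ∈ s, C.InSpan a t) : C.InSpan m t := by
  refine Submodule.span_le.2 ?_ h
  rintro _ ⟨a, ha, rfl⟩
  exact hs a ha

theorem InSpan.mono {m : Fin n} {s t : Set (Fin n)} (h : C.InSpan m s) (hs : s ⊆ t) :
    C.InSpan m t :=
  h.trans fun _ ha => inSpan_of_mem (hs ha)

theorem InSpan.exchange {x y : Fin n} {s : Set (Fin n)} (h : C.InSpan x (insert y s))
    (h' : ¬ C.InSpan x s) : C.InSpan y (insert x s) := by
  rw [InSpan, Set.image_insert_eq] at h ⊢
  exact mem_span_insert_exchange h h'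

theorem mem_bases_iff_linearIndepOn {J : Finset (Fin n)} :
    J ∈ C.bases ↔ J.card = k ∧ LinearIndepOn ℝ C.A.col (J : Set (Fin n)) := by
  rw [mem_bases]
  refine and_congr_right fun h => ?_
  have e : (C.A.submatrix id (J.orderEmbOfFin h)).col = C.A.col ∘ J.orderEmbOfFin h := rfl
  rw [minor, dif_pos h, ← isUnit_iff_ne_zero, ← Matrix.isUnit_iff_isUnit_det,
    ← Matrix.linearIndependent_cols_iff_isUnit, e, ← linearIndepOn_range_iff
    (J.orderEmbOfFin h).injective, Finset.range_orderEmbOfFin]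

theorem not_inSpan_of_mem_bases {B : Finset (Fin n)} (hB : B ∈ C.bases) {a : Fin n} (ha : a ∈ B)
    {s : Set (Fin n)} (hs : ∀ x ∈ s, x ∈ B ∧ x ≠ a) : ¬ C.InSpan a s := by
  intro h
  have hi := (mem_bases_iff_linearIndepOn.1 hB).2
  have h1 : (B : Set (Fin n)) = insert a ((B : Set (Fin n)) \ {a}) := by simp [ha]
  rw [h1, linearIndepOn_insert (by simp)] at hi
  exact hi.2 (h.mono fun x hx => ⟨(hs x hx).1, (hs x hx).2⟩)

theorem insert_erase_mem_bases {B : Finset (Fin n)} (hB : B ∈ C.bases) {a m : Fin n} (ha : a ∈ B)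
    (hm : m ∉ B) (h : ¬ C.InSpan m ((B : Set (Fin n)) \ {a})) : insert m (B.erase a) ∈ C.bases := by
  have hB' := mem_bases_iff_linearIndepOn.1 hB
  have hme : m ∉ B.erase a := fun h => hm (Finset.mem_of_mem_erase h)
  rw [mem_bases_iff_linearIndepOn]
  constructor
  · rw [Finset.card_insert_of_notMem hme, Finset.card_erase_of_mem ha, ← hB'.1]
    have := Finset.card_pos.2 ⟨a, ha⟩
    omega
  · rw [Finset.coe_insert, linearIndepOn_insert (by exact_mod_cast hme), Finset.coe_erase]
    exact ⟨hB'.2.mono Set.sdiff_subset, h⟩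

/-- In coordinates with respect to the basis `B`, being spanned by `B \ {a}` means that the
coordinate at a vanishes; so several elements can be left out simultaneously. -/
theorem inSpan_sep_of_mem_bases {B : Finset (Fin n)} (hB : B ∈ C.bases) {m : Fin n}
    {G : Fin n → Prop} (h : ∀ a ∈ B, ¬ G a → C.InSpan m ((B : Set (Fin n)) \ {a})) :
    C.InSpan m {a | a ∈ B ∧ G a} := by
  obtain ⟨hc, hi⟩ := mem_bases_iff_linearIndepOn.1 hB
  have hi' : LinearIndependent ℝ fun x : (B : Set (Fin n)) => C.A.col x := hi
  let b := basisOfLinearIndependentOfCardEqFinrank' _ hi' (by simp [hc])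
  have hb : ∀ s : Set (B : Set (Fin n)), b '' s = C.A.col '' (Subtype.val '' s) := by
    intro s
    rw [Set.image_image]
    exact Set.image_congr fun x _ => by
      rw [show b = basisOfLinearIndependentOfCardEqFinrank' _ hi' _ from rfl,
        coe_basisOfLinearIndependentOfCardEqFinrank']
  have key : ∀ t : Set (Fin n), t ⊆ B → (C.InSpan m t ↔
      ((b.repr (C.A.col m)).support : Set (B : Set (Fin n))) ⊆ Subtype.val ⁻¹' t) := by
    intro t ht
    rw [← b.mem_span_image, hb, Subtype.image_preimage_coe, Set.inter_eq_right.2 ht]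
    rfl
  rw [key _ fun a ha => ha.1]
  rintro ⟨a, ha⟩ hsupp
  refine ⟨ha, ?_⟩
  by_contra hG
  have := (key _ Set.sdiff_subset).1 (h a ha hG) hsupp
  exact this.2 rfl

theorem inSpan_of_mem_bases {B : Finset (Fin n)} (hB : B ∈ C.bases) (m : Fin n) :
    C.InSpan m B := by
  have := inSpan_sep_of_mem_bases hB (m := m) (G := fun _ => True) (by simp)
  exact this.mono fun a ha => ha.1

/-! ### Bases of maximal weight -/

/-- `B` is a basis of maximal weight. -/
def IsMaxWeight (C : Data k n) (W : Fin n → ℝ) (B : Finset (Fin n)) : Prop :=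
  B ∈ C.bases ∧ ∀ B' ∈ C.bases, ∑ j ∈ B', W j ≤ ∑ j ∈ B, W j

/-- If the expansion of column m used a lighter element of `B`, exchanging that element for m would
increase the weight. -/
theorem IsMaxWeight.inSpan {W : Fin n → ℝ} {B : Finset (Fin n)} (hB : C.IsMaxWeight W B) {m : Fin n}
    (hm : m ∉ B) : C.InSpan m {a | a ∈ B ∧ W m ≤ W a} := by
  refine inSpan_sep_of_mem_bases hB.1 fun a ha hlt => ?_
  by_contra hcon
  have := hB.2 _ (insert_erase_mem_bases hB.1 ha hm hcon)
  rw [Finset.sum_insert fun h => hm (Finset.mem_of_mem_erase h)] at this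
  have := Finset.add_sum_erase B W ha
  push Not at hlt
  linarith

/-- The greedy property: the elements of `B` above a threshold span every column above it. -/
theorem IsMaxWeight.inSpan_lt {W : Fin n → ℝ} {B : Finset (Fin n)} (hB : C.IsMaxWeight W B)
    {m : Fin n} {c : ℝ} (h : C.InSpan m {a | c < W a}) : C.InSpan m {a | a ∈ B ∧ c < W a} := by
  refine h.trans fun a ha => ?_
  have ha : c < W a := ha
  by_cases haB : a ∈ B
  · exact inSpan_of_mem ⟨haB, ha⟩
  · exact (hB.inSpan haB).mono fun b hb => ⟨hb.1, ha.trans_le hb.2⟩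

theorem IsMaxWeight.not_inSpan {W : Fin n → ℝ} {B : Finset (Fin n)} (hB : C.IsMaxWeight W B)
    {m : Fin n} (hm : m ∈ B) : ¬ C.InSpan m {a | W m < W a} := fun h =>
  not_inSpan_of_mem_bases hB.1 hm (fun a ha => ⟨ha.1, by rintro rfl; exact lt_irrefl _ ha.2⟩)
    (hB.inSpan_lt h)

/-! ### The permutation of the cell -/

/-- The elements strictly between `l` and `r` in cyclic order. -/
def cyclicIoo (l r : Fin n) : Set (Fin n) :=
  {m | (l < r ∧ l < m ∧ m < r) ∨ (r < l ∧ (l < m ∨ m < r))}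

/-- `r` is the first element after `l` in cyclic order such that the column `l` is in the span of the
columns up to `r`. -/
def IsNextDependent (C : Data k n) (l r : Fin n) : Prop :=
  C.InSpan r (insert l (cyclicIoo l r)) ∧ ¬ C.InSpan r (cyclicIoo l r)

theorem val_sub_eq (a ρ : Fin n) :
    (a - ρ).val = if ρ.val ≤ a.val then a.val - ρ.val else n + a.val - ρ.val := by
  split_ifs with h
  · exact Fin.coe_sub_iff_le.2 h
  · exact Fin.coe_sub_iff_lt.2 (by rw [Fin.lt_def]; omega)

theorem mem_cyclicIoo_iff {l r m : Fin n} (h : r ≠ l) :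
    m ∈ cyclicIoo l r ↔ 0 < (m - l).val ∧ (m - l).val < (r - l).val := by
  have h' : r.val ≠ l.val := fun e => h (Fin.ext e)
  have := r.isLt
  have := l.isLt
  have := m.isLt
  simp only [cyclicIoo, Set.mem_ofPred_eq, val_sub_eq, Fin.lt_def]
  split_ifs <;> omega

/-- If r came before r', column l would already be spanned by columns strictly between l and r', and
r' would then be spanned by them without l. -/
theorem IsNextDependent.unique {l r r' : Fin n} (hr : r ≠ l) (hr' : r' ≠ l)
    (h : C.IsNextDependent l r) (h' : C.IsNextDependent l r') : r = r' := by
  have key : ∀ {r r' : Fin n}, r ≠ l → r' ≠ l → C.IsNextDependent l r → C.IsNextDependent l r' →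
      ¬ (r - l).val < (r' - l).val := by
    intro r r' hr hr' h h' hlt
    have hpos : 0 < (r - l).val := by
      have : r.val ≠ l.val := fun e => hr (Fin.ext e)
      have := r.isLt
      have := l.isLt
      rw [val_sub_eq]; split_ifs <;> omega
    have hsub : insert r (cyclicIoo l r) ⊆ cyclicIoo l r' := by
      rintro m (rfl | hm)
      · exact (mem_cyclicIoo_iff hr').2 ⟨hpos, hlt⟩
      · rw [mem_cyclicIoo_iff hr] at hm
        exact (mem_cyclicIoo_iff hr').2 ⟨hm.1, hm.2.trans hlt⟩
    have hl := (h.1.exchange h.2).mono hsub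
    refine h'.2 (h'.1.trans ?_)
    rintro a (rfl | ha)
    exacts [hl, inSpan_of_mem ha]
  have h1 := key hr hr' h h'
  have h2 := key hr' hr h' h
  rw [val_sub_eq, val_sub_eq] at h1 h2
  have := r.isLt
  have := r'.isLt
  have := l.isLt
  apply Fin.ext
  split_ifs at h1 h2 <;> omega

/-- The lexicographically minimal basis is the greedy one: a column is taken exactly when it is
independent of the preceding ones. -/
theorem mem_isLexMin_iff {ρ : Fin n} {I : Finset (Fin n)} (hI : IsLexMin C.bases ρ I) (m : Fin n) :
    m ∈ I ↔ ¬ C.InSpan m {a | (a - ρ).val < (m - ρ).val} := by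
  have h1 : ∀ m, m ∉ I → C.InSpan m {a | a ∈ I ∧ (a - ρ).val < (m - ρ).val} := by
    intro m hm
    refine inSpan_sep_of_mem_bases hI.1 fun a ha hlt => ?_
    by_contra hcon
    have hJ := insert_erase_mem_bases hI.1 ha hm hcon
    obtain ⟨x, hx, hx'⟩ := hI.2 _ hJ (fun e => hm (e ▸ Finset.mem_insert_self m _))
    have hma : m ≠ a := by rintro rfl; exact hm ha
    have hxa : x = a := by
      by_contra hxa
      simp only [Finset.mem_sdiff, Finset.mem_insert, Finset.mem_erase, not_or, not_and] at hx
      exact hx.2.2 hxa hx.1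
    subst hxa
    exact hlt (hx' m (by simp [hm]))
  constructor
  · intro hm h
    refine not_inSpan_of_mem_bases hI.1 hm (s := {a | a ∈ I ∧ (a - ρ).val < (m - ρ).val})
      (fun a ha => ⟨ha.1, by rintro rfl; exact lt_irrefl _ ha.2⟩) (h.trans fun a ha => ?_)
    by_cases haI : a ∈ I
    · exact inSpan_of_mem ⟨haI, ha⟩
    · exact (h1 a haI).mono fun b hb => ⟨hb.1, hb.2.trans ha⟩
  · intro h
    by_contra hm
    exact h ((h1 m hm).mono fun a ha => ha.2)

/-- Put r = π⁻¹ l. It is absent from I_l, so it is spanned by the columns from l to just before r;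
it is present in I_{l+1}, so it is not spanned once l is dropped. That column l is nonzero gives l ∈
I_l, hence r ∉ I_l by cardinality. -/
theorem isNextDependent_symm {π : Equiv.Perm (Fin n)} (hπ : IsCellPermutation C.bases π)
    (hcol : ∀ j, C.A.col j ≠ 0) (l : Fin n) : C.IsNextDependent l (π.symm l) := by
  obtain ⟨hder, I, hI, hstep⟩ := hπ
  set r := π.symm l with hr
  have hrl : r ≠ l := fun e => hder r (by rw [hr, Equiv.apply_symm_apply]; exact e.symm)
  have hnext := hstep l r (by rw [hr, Equiv.apply_symm_apply])
  have hlI : l ∈ I l := by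
    rw [mem_isLexMin_iff (hI l)]
    intro h
    have he : {a : Fin n | (a - l).val < (l - l).val} = ∅ := by
      ext a
      simp only [val_sub_eq l l, le_refl, if_true, Nat.sub_self, Set.mem_ofPred_eq, Nat.not_lt_zero,
        Set.mem_empty_iff_false]
    rw [he] at h
    simp only [InSpan, Set.image_empty, Submodule.span_empty, Submodule.mem_bot] at h
    exact hcol l h
  have hrI : r ∉ I l := by
    intro h
    have h1 := (mem_bases.1 (hI l).1).1
    have h2 := (mem_bases.1 (hI (finRotate n l)).1).1
    rw [hnext, Finset.insert_eq_of_mem (Finset.mem_erase.2 ⟨hrl, h⟩), Finset.card_erase_of_mem hlI,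
      h1] at h2
    have := Finset.card_pos.2 ⟨l, hlI⟩
    omega
  have hrI' : r ∈ I (finRotate n l) := by rw [hnext]; exact Finset.mem_insert_self _ _
  rw [mem_isLexMin_iff (hI _), not_not] at hrI
  rw [mem_isLexMin_iff (hI _)] at hrI'
  have hvl : r.val ≠ l.val := fun e => hrl (Fin.ext e)
  constructor
  · refine hrI.mono fun a ha => ?_
    by_cases hal : a = l
    · exact Or.inl hal
    · right
      rw [mem_cyclicIoo_iff hrl]
      refine ⟨?_, ha⟩
      have : a.val ≠ l.val := fun e => hal (Fin.ext e)
      have := a.isLt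
      have := l.isLt
      rw [val_sub_eq]; split_ifs <;> omega
  · intro h
    apply hrI'
    refine h.mono fun a ha => ?_
    rw [mem_cyclicIoo_iff hrl, val_sub_eq, val_sub_eq] at ha
    have h1 := a.isLt
    have h2 := l.isLt
    have h3 := r.isLt
    -- The wrap-around at l = n - 1 is the case in which the cyclic successor is 0.
    have hrot : (finRotate n l).val = if l.val + 1 = n then 0 else l.val + 1 := by
      cases n with
      | zero => exact l.elim0
      | succ n =>
        rw [coe_finRotate]
        simp only [Fin.ext_iff, Fin.val_last, Nat.add_right_cancel_iff]
    simp only [Set.mem_ofPred_eq, val_sub_eq, hrot]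
    split_ifs at ha ⊢ <;> omega

/-! ### Asymptotics of the contour plot -/

/-- The weight of `m` at infinity along a line-soliton with `l` on its left and `r` on its right,
against its direction. -/
def weight (C : Data k n) (l r m : Fin n) : ℝ :=
  (C.κ r - C.κ l) * ((C.κ l + C.κ r) * C.κ m - C.κ m ^ 2)

theorem sum_weight {L R : Finset (Fin n)} {l r : Fin n} (hl : L \ R = {l}) (hr : R \ L = {r})
    (J : Finset (Fin n)) : ∑ m ∈ J, C.weight l r m = -C.slope J (C.direction L R) := by
  have c1 := C.charge_sub_of_sdiff hl hr
  have c2 := C.charge₂_sub_of_sdiff hl hr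
  simp only [slope, direction_eq, c1, c2, weight]
  simp only [charge, charge₂, Finset.sum_mul, ← Finset.sum_add_distrib, ← Finset.sum_neg_distrib]
  exact Finset.sum_congr rfl fun m _ => by ring

theorem weight_sub (l r m : Fin n) : C.weight l r m - C.weight l r l =
    -((C.κ r - C.κ l) * (C.κ m - C.κ l) * (C.κ m - C.κ r)) := by
  simp only [weight]; ring

theorem weight_right (l r : Fin n) : C.weight l r r = C.weight l r l := by
  simp only [weight]; ring

/-- The weight minus that of l is a quadratic in κ_m with roots κ_l and κ_r. Its leading sign is
determined by which of l and r is larger, and this selects the inside or the outside of the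
interval, which is the cyclic interval from l to r in either case. -/
theorem setOf_weight_lt (hC : C.Admissible) {l r : Fin n} (h : r ≠ l) :
    {m | C.weight l r l < C.weight l r m} = cyclicIoo l r := by
  ext m
  have hs := hC.strictMono
  have hw := C.weight_sub l r m
  have key : C.weight l r l < C.weight l r m ↔
      (C.κ r - C.κ l) * ((C.κ m - C.κ l) * (C.κ m - C.κ r)) < 0 := by
    constructor <;> intro <;> linarith
  simp only [Set.mem_ofPred_eq, key, cyclicIoo]
  rcases lt_or_gt_of_ne h with hlt | hlt
  · have h1 := hs hlt
    rw [mul_comm, mul_neg_iff]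
    have h2 : ¬ (C.κ r - C.κ l > 0) := by linarith
    have h3 : C.κ r - C.κ l < 0 := by linarith
    simp only [hlt, not_lt_of_gt hlt, false_and, true_and, false_or, sub_pos,
      not_lt_of_gt h1, and_false, or_false, sub_neg, h1, and_true, mul_pos_iff, hs.lt_iff_lt]
    constructor
    · rintro (h | h)
      exacts [Or.inl h.1, Or.inr h.2]
    · rintro (h | h)
      exacts [Or.inl ⟨h, hlt.trans h⟩, Or.inr ⟨h.trans hlt, h⟩]
  · have h1 := hs hlt
    rw [mul_neg_iff]
    simp only [hlt, not_lt_of_gt hlt, false_and, true_and, or_false, sub_pos,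
      not_lt_of_gt h1, sub_neg, h1, mul_neg_iff, hs.lt_iff_lt]
    constructor
    · rintro (h | h)
      exacts [h, (lt_asymm (h.1.trans hlt) h.2).elim]
    · exact fun h => Or.inl h

theorem weight_ne (hC : C.Admissible) {l r m : Fin n} (h : r ≠ l) (hl : m ≠ l) (hr : m ≠ r) :
    C.weight l r m ≠ C.weight l r l := by
  intro e
  have hw := C.weight_sub l r m
  rw [e, sub_self, eq_comm, neg_eq_zero] at hw
  have hi := hC.strictMono.injective
  rcases mul_eq_zero.1 hw with hw | hw
  · rcases mul_eq_zero.1 hw with hw | hw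
    · exact h (hi (sub_eq_zero.1 hw))
    · exact hl (hi (sub_eq_zero.1 hw))
  · exact hr (hi (sub_eq_zero.1 hw))

/-- A term of smaller slope along the direction would overtake `L` far back on the ray; by
`sum_weight`, weights are negated slopes. -/
theorem isMaxWeight_of_fromInfinity {L R : Finset (Fin n)} {l r : Fin n}
    (hl : L \ R = {l}) (hr : R \ L = {r}) (hs : C.IsLineSoliton L R) (hinf : C.FromInfinity L R) :
    C.IsMaxWeight (C.weight l r) L ∧ C.IsMaxWeight (C.weight l r) R := by
  obtain ⟨p, hp⟩ := hs.2.2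
  have key : ∀ J ∈ C.bases, C.slope L (C.direction L R) ≤ C.slope J (C.direction L R) := by
    intro J hJ
    by_contra hlt
    push Not at hlt
    set g := C.slope L (C.direction L R) - C.slope J (C.direction L R) with hg
    have hg0 : 0 < g := by linarith
    have hLp := isMaxAt_of_mem_regionsAt (mem_regionsAt_of_border hp).1
    set s := (C.logTerm L p - C.logTerm J p + 1) / g with hs
    have hs0 : 0 ≤ s := div_nonneg (by linarith [hLp.2 J hJ]) hg0.le
    have hsg : s * g = C.logTerm L p - C.logTerm J p + 1 := div_mul_cancel₀ _ hg0.ne'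
    have := (isMaxAt_of_mem_regionsAt (mem_regionsAt_of_border (hinf p hp s hs0)).1).2 J hJ
    rw [sub_eq_add_neg, ← neg_smul, logTerm_add_smul, logTerm_add_smul] at this
    rw [hg] at hsg
    linarith
  have hlive := hs.live
  refine ⟨⟨hlive.1.mem_bases, fun J hJ => ?_⟩, hlive.2.mem_bases, fun J hJ => ?_⟩
  · rw [sum_weight hl hr, sum_weight hl hr]
    linarith [key J hJ]
  · rw [sum_weight hl hr, sum_weight hl hr, slope_direction]
    linarith [key J hJ]

/-- As r ∉ `L`, its column is spanned by elements of `L` at least as heavy, which are l or lie in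
the cyclic interval. As r ∈ `R`, it is not spanned by the strictly heavier columns. -/
theorem isNextDependent_of_isMaxWeight (hC : C.Admissible) {L R : Finset (Fin n)} {l r : Fin n}
    (hl : L \ R = {l}) (hr : R \ L = {r}) (hL : C.IsMaxWeight (C.weight l r) L)
    (hR : C.IsMaxWeight (C.weight l r) R) : C.IsNextDependent l r := by
  obtain ⟨l1, l2⟩ := mem_sdiff_of_eq hl
  obtain ⟨r1, r2⟩ := mem_sdiff_of_eq hr
  have hrl : r ≠ l := by rintro rfl; exact l2 r1
  rw [IsNextDependent, ← setOf_weight_lt hC hrl]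
  constructor
  · refine (hL.inSpan r2).mono fun a ⟨ha, hw⟩ => ?_
    by_cases hal : a = l
    · exact Or.inl hal
    · right
      rw [weight_right] at hw
      exact lt_of_le_of_ne hw (weight_ne hC hrl hal (by rintro rfl; exact r2 ha)).symm
  · have := hR.not_inSpan r1
    rwa [weight_right] at this

theorem IsMaxWeight.mem_of_mem (hC : C.Admissible) (hcol : ∀ j, C.A.col j ≠ 0) {l r : Fin n}
    (hrl : r ≠ l) (hnd : C.IsNextDependent l r) {X X' : Finset (Fin n)}
    (hX : C.IsMaxWeight (C.weight l r) X) (hX' : C.IsMaxWeight (C.weight l r) X') {m : Fin n}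
    (hml : m ≠ l) (hmr : m ≠ r) (hm : m ∈ X) : m ∈ X' := by
  -- Genericity of sums of two parameters is available only for k ≥ 2. For k = 1, X = {m} with m
  -- lighter would make column l zero, and with m heavier would make column r a multiple of a column
  -- strictly between.
  rcases Nat.lt_or_ge k 2 with hk | hk
  · exfalso
    have hcard := (mem_bases.1 hX.1).1
    have hk1 : X.card = 1 := by
      have := Finset.card_pos.2 ⟨m, hm⟩
      omega
    obtain ⟨y, hy⟩ := Finset.card_eq_one.1 hk1
    obtain rfl : m = y := by rw [hy] at hm; simpa using hm
    rcases lt_or_gt_of_ne (weight_ne hC hrl hml hmr) with h | h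
    · have := (hX.inSpan (m := l) (by rw [hy]; simpa using hml.symm))
      have he : {a | a ∈ X ∧ C.weight l r l ≤ C.weight l r a} = ∅ := by
        ext a
        simp only [hy, Finset.mem_singleton, Set.mem_ofPred_eq, Set.mem_empty_iff_false, iff_false,
          not_and]
        rintro rfl
        exact h.not_ge
      rw [he] at this
      simp only [InSpan, Set.image_empty, Submodule.span_empty, Submodule.mem_bot] at this
      exact hcol l this
    · have h' : m ∈ cyclicIoo l r := by
        rw [← setOf_weight_lt hC hrl]; exact h
      refine hnd.2 ((inSpan_of_mem_bases hX.1 r).mono ?_)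
      rw [hy]; simpa using h'
  · by_contra hm'
    have h1 := hX'.inSpan hm'
    refine hX.not_inSpan hm (h1.mono fun a ⟨ha, hw⟩ => lt_of_le_of_ne hw fun e => ?_)
    have ham : a ≠ m := by rintro rfl; exact hm' ha
    have hκ : ∀ {x y}, x ≠ y → C.κ x - C.κ y ≠ 0 := fun h =>
      sub_ne_zero.2 fun h' => h (hC.strictMono.injective h')
    -- For a ≠ m, equal weights are equivalent to equal distances of κ_a and κ_m from the vertex of
    -- the quadratic.
    have hsum : C.κ a + C.κ m = C.κ l + C.κ r := by
      simp only [weight] at e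
      have h3 : (C.κ r - C.κ l) * ((C.κ a - C.κ m) * (C.κ l + C.κ r - (C.κ a + C.κ m))) = 0 := by
        linear_combination -e
      have h4 := (mul_eq_zero.1 ((mul_eq_zero.1 h3).resolve_left (hκ hrl))).resolve_left (hκ ham)
      linarith
    have := hC.generic 2 le_rfl hk {a, m} {l, r} (Finset.card_pair ham) (Finset.card_pair hrl.symm)
      (by rw [Finset.sum_pair ham, Finset.sum_pair hrl.symm]; exact hsum)
    have h5 : m ∈ ({l, r} : Finset (Fin n)) := by rw [← this]; simp
    simp only [Finset.mem_insert, Finset.mem_singleton] at h5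
    exact h5.elim hml hmr

/-- Column r is spanned by l and the cyclic interval, hence, by greediness, by l and heavier
elements of `X`; a basis cannot contain such an r as well as l. -/
theorem IsMaxWeight.not_mem_both (hC : C.Admissible) {l r : Fin n}
    (hrl : r ≠ l) (hnd : C.IsNextDependent l r) {X : Finset (Fin n)}
    (hX : C.IsMaxWeight (C.weight l r) X) : ¬ (l ∈ X ∧ r ∈ X) := by
  rintro ⟨hl, hr⟩
  refine not_inSpan_of_mem_bases hX.1 hr (s := insert l {a | a ∈ X ∧ C.weight l r l < C.weight l r a})
    ?_ (hnd.1.trans ?_)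
  · rintro x (rfl | hx)
    · exact ⟨hl, hrl.symm⟩
    · refine ⟨hx.1, ?_⟩
      rintro rfl
      have := hx.2
      rw [weight_right] at this
      exact lt_irrefl _ this
  · rintro a (rfl | ha)
    · exact inSpan_of_mem (Or.inl rfl)
    · refine (hX.inSpan_lt ?_).mono (Set.subset_insert _ _)
      exact inSpan_of_mem (by rw [setOf_weight_lt hC hrl]; exact ha)

/-- The bases of maximal weight are the index sets of the two regions next to an unbounded
line-soliton. -/
theorem exists_isMaxWeight_pair (hC : C.Admissible) (hcol : ∀ j, C.A.col j ≠ 0) {l r : Fin n}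
    (hrl : r ≠ l) (hnd : C.IsNextDependent l r) : ∃ L R : Finset (Fin n), L \ R = {l} ∧ R \ L = {r} ∧
      C.IsMaxWeight (C.weight l r) L ∧ C.IsMaxWeight (C.weight l r) R ∧
      ∀ X, C.IsMaxWeight (C.weight l r) X → (l ∈ X → X = L) ∧ (r ∈ X → X = R) ∧ (X = L ∨ X = R) := by
  obtain ⟨X, hX, hmax⟩ := C.bases.exists_max_image (fun B => ∑ j ∈ B, C.weight l r j) hC.nonempty
  have hX : C.IsMaxWeight (C.weight l r) X := ⟨hX, hmax⟩
  have hl' : ¬ C.InSpan l (cyclicIoo l r) := fun h => hnd.2 (hnd.1.trans fun a ha => by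
    rcases ha with rfl | ha
    exacts [h, inSpan_of_mem ha])
  have hl_span : C.InSpan l (insert r (cyclicIoo l r)) := hnd.1.exchange hnd.2
  have hsym : C.InSpan r (insert l (cyclicIoo l r)) := hnd.1
  have one : ∀ X, C.IsMaxWeight (C.weight l r) X → l ∈ X ∨ r ∈ X := by
    intro X hX
    by_contra hcon
    push Not at hcon
    refine hl' ((hX.inSpan hcon.1).mono fun a ⟨ha, hw⟩ => ?_)
    rw [← setOf_weight_lt hC hrl]
    exact lt_of_le_of_ne hw (weight_ne hC hrl (by rintro rfl; exact hcon.1 ha)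
      (by rintro rfl; exact hcon.2 ha)).symm
  -- Exchanging l and r preserves the weight. The result is a basis: otherwise x would be spanned by
  -- y and the heavier columns, hence by the rest of `X`.
  have swap : ∀ X, C.IsMaxWeight (C.weight l r) X → ∀ x y : Fin n, x ∈ X → y ∉ X →
      C.weight l r x = C.weight l r y → C.InSpan x (insert y (cyclicIoo l r)) →
      ¬ C.InSpan x (cyclicIoo l r) → C.weight l r x = C.weight l r l →
      C.IsMaxWeight (C.weight l r) (insert y (X.erase x)) := by
    intro X hX x y hx hy hw hspan hnspan hwx
    refine ⟨insert_erase_mem_bases hX.1 hx hy fun h => ?_, fun B hB => ?_⟩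
    · have hH : ∀ a ∈ cyclicIoo l r, C.InSpan a ((X : Set (Fin n)) \ {x}) := by
        intro a ha
        rw [← setOf_weight_lt hC hrl] at ha
        refine (hX.inSpan_lt (inSpan_of_mem ha)).mono fun b ⟨hb, hwb⟩ => ⟨hb, ?_⟩
        rintro rfl
        rw [hwx] at hwb
        exact lt_irrefl _ hwb
      refine not_inSpan_of_mem_bases hX.1 hx (s := (X : Set (Fin n)) \ {x}) (fun b hb => hb)
        (hspan.trans ?_)
      rintro a (rfl | ha)
      exacts [h, hH a ha]
    · rw [Finset.sum_insert fun h => hy (Finset.mem_of_mem_erase h), ← hw,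
        Finset.add_sum_erase X _ hx]
      exact hX.2 B hB
  have agree : ∀ X Y, C.IsMaxWeight (C.weight l r) X → C.IsMaxWeight (C.weight l r) Y →
      (l ∈ X ∧ l ∈ Y ∨ r ∈ X ∧ r ∈ Y) → X = Y := by
    intro X Y hX hY h
    have nX := hX.not_mem_both hC hrl hnd
    have nY := hY.not_mem_both hC hrl hnd
    ext m
    by_cases hml : m = l
    · subst hml; tauto
    by_cases hmr : m = r
    · subst hmr; tauto
    exact ⟨hX.mem_of_mem hC hcol hrl hnd hY hml hmr, hY.mem_of_mem hC hcol hrl hnd hX hml hmr⟩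
  have finish : ∀ L R, C.IsMaxWeight (C.weight l r) L → C.IsMaxWeight (C.weight l r) R → l ∈ L →
      r ∈ R → ∃ L R : Finset (Fin n), L \ R = {l} ∧ R \ L = {r} ∧
      C.IsMaxWeight (C.weight l r) L ∧ C.IsMaxWeight (C.weight l r) R ∧
      ∀ X, C.IsMaxWeight (C.weight l r) X → (l ∈ X → X = L) ∧ (r ∈ X → X = R) ∧
        (X = L ∨ X = R) := by
    intro L R hL hR hlL hrR
    have nL := hL.not_mem_both hC hrl hnd
    have nR := hR.not_mem_both hC hrl hnd
    refine ⟨L, R, ?_, ?_, hL, hR, fun X hX => ⟨fun h => agree X L hX hL (Or.inl ⟨h, hlL⟩),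
      fun h => agree X R hX hR (Or.inr ⟨h, hrR⟩), (one X hX).imp
      (fun h => agree X L hX hL (Or.inl ⟨h, hlL⟩)) fun h => agree X R hX hR (Or.inr ⟨h, hrR⟩)⟩⟩
    · ext m
      simp only [Finset.mem_sdiff, Finset.mem_singleton]
      constructor
      · rintro ⟨h1, h2⟩
        by_contra hml
        by_cases hmr : m = r
        · subst hmr; exact h2 hrR
        exact h2 (hL.mem_of_mem hC hcol hrl hnd hR hml hmr h1)
      · rintro rfl; exact ⟨hlL, fun h => nR ⟨h, hrR⟩⟩
    · ext m
      simp only [Finset.mem_sdiff, Finset.mem_singleton]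
      constructor
      · rintro ⟨h1, h2⟩
        by_contra hmr
        by_cases hml : m = l
        · subst hml; exact h2 hlL
        exact h2 (hR.mem_of_mem hC hcol hrl hnd hL hml hmr h1)
      · rintro rfl; exact ⟨hrR, fun h => nL ⟨hlL, h⟩⟩
  have nX := hX.not_mem_both hC hrl hnd
  rcases one X hX with h | h
  · exact finish X _ hX (swap X hX l r h (fun h' => nX ⟨h, h'⟩) (weight_right l r).symm hl_span hl' rfl)
      h (Finset.mem_insert_self _ _)
  · exact finish _ X (swap X hX r l h (fun h' => nX ⟨h', h⟩) (weight_right l r) hsym hnd.2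
      (weight_right l r)) hX (Finset.mem_insert_self _ _) h

/-- All other terms have strictly larger slope along the direction, so far enough back on the line
where `L` and `R` are tied they are all smaller, and they remain so further back. -/
theorem exists_fromInfinity (hC : C.Admissible) {L R : Finset (Fin n)} {l r : Fin n}
    (hl : L \ R = {l}) (hr : R \ L = {r}) (hL : C.IsMaxWeight (C.weight l r) L)
    (hR : C.IsMaxWeight (C.weight l r) R)
    (huniq : ∀ X, C.IsMaxWeight (C.weight l r) X → X = L ∨ X = R) :
    C.IsLineSoliton L R ∧ C.FromInfinity L R := by
  have hne : L ≠ R := by rintro rfl; simp at hl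
  have hc : C.charge L - C.charge R ≠ 0 := sub_ne_zero.2 fun h => hne (hC.charge_inj hL.1 hR.1 h)
  have hge : ∀ J ∈ C.bases, C.slope L (C.direction L R) ≤ C.slope J (C.direction L R) := by
    intro J hJ
    have := hL.2 J hJ
    rw [sum_weight hl hr, sum_weight hl hr] at this
    linarith
  have hgt : ∀ J ∈ C.bases, J ≠ L → J ≠ R →
      C.slope L (C.direction L R) < C.slope J (C.direction L R) := by
    intro J hJ h1 h2
    refine lt_of_le_of_ne (hge J hJ) fun e => ?_
    refine (huniq J ⟨hJ, fun B hB => ?_⟩).elim h1 h2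
    rw [sum_weight hl hr, sum_weight hl hr, ← e]
    linarith [hge B hB]
  have hval : ∀ N p (s : ℝ), C.logTerm N (p - s • C.direction L R) =
      C.logTerm N p - s * C.slope N (C.direction L R) := by
    intro N p s
    rw [sub_eq_add_neg, ← neg_smul, logTerm_add_smul]; ring
  obtain ⟨p₀, hp₀⟩ : ∃ p₀, C.logTerm L p₀ = C.logTerm R p₀ := by
    refine ⟨0 + ((C.logTerm R 0 - C.logTerm L 0) / (C.charge L - C.charge R), 0), ?_⟩
    rw [logTerm_add, logTerm_add]
    simp only [slope, mul_zero, add_zero]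
    field_simp
    ring
  obtain ⟨p, hpLR, hp⟩ : ∃ p, C.logTerm L p = C.logTerm R p ∧
      ∀ J ∈ C.bases, J ≠ L → J ≠ R → C.logTerm J p < C.logTerm L p := by
    have hev : ∀ᶠ s : ℝ in Filter.atTop, ∀ J ∈ C.bases, J ≠ L → J ≠ R →
        C.logTerm J (p₀ - s • C.direction L R) < C.logTerm L (p₀ - s • C.direction L R) := by
      rw [Finset.eventually_all]
      intro J hJ
      by_cases h : J ≠ L ∧ J ≠ R
      swap
      · exact Filter.Eventually.of_forall fun s h1 h2 => (h ⟨h1, h2⟩).elim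
      have hg := sub_pos.2 (hgt J hJ h.1 h.2)
      filter_upwards [Filter.eventually_gt_atTop ((C.logTerm J p₀ - C.logTerm L p₀) /
        (C.slope J (C.direction L R) - C.slope L (C.direction L R)))] with s hs _ _
      rw [div_lt_iff₀ hg] at hs
      rw [hval, hval]
      linarith
    obtain ⟨s, hs⟩ := hev.exists
    exact ⟨_, by rw [hval, hval, hp₀, slope_direction], hs⟩
  have hmaxL : C.IsMaxAt L p := ⟨hL.1, fun I hI => by
    by_cases h1 : I = L
    · rw [h1]
    by_cases h2 : I = R
    · rw [h2, hpLR]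
    exact (hp I hI h1 h2).le⟩
  have hmaxR : C.IsMaxAt R p := ⟨hR.1, fun I hI => hpLR ▸ hmaxL.2 I hI⟩
  have hsq : 0 < (C.charge L - C.charge R) * (C.charge L - C.charge R) := mul_self_pos.2 hc
  have hLp : L ∈ C.regionsAt p := by
    -- At `p` only `L` and `R` are tied; a horizontal move separates them since their charges
    -- differ.
    refine mem_regionsAt_of_slope (w := (C.charge L - C.charge R, 0)) hmaxL fun I hI hIL he => ?_
    by_cases h2 : I = R
    · subst h2; simp only [slope, mul_zero, add_zero]; linarith
    · exact ((hp I hI hIL h2).ne he).elim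
  have hRp : R ∈ C.regionsAt p := by
    refine mem_regionsAt_of_slope (w := (-(C.charge L - C.charge R), 0)) hmaxR fun I hI hIR he => ?_
    by_cases h2 : I = L
    · subst h2; simp only [slope, mul_zero, add_zero]; linarith
    · exact ((hp I hI h2 hIR).ne (he.trans hpLR.symm)).elim
  have hlL := live_of_mem_regionsAt hLp
  have hlR := live_of_mem_regionsAt hRp
  refine ⟨⟨by rw [hl]; simp, by rw [hr]; simp, p, ?_⟩, fun q hq s hs => ?_⟩
  · exact (mem_border_iff hC hlL hlR).2 ⟨hpLR, fun N hN h1 h2 => hp N hN.mem_bases h1 h2⟩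
  · rw [mem_border_iff hC hlL hlR] at hq ⊢
    refine ⟨by rw [hval, hval, hq.1, slope_direction], fun N hN h1 h2 => ?_⟩
    rw [hval, hval]
    have := mul_le_mul_of_nonneg_left (hge N hN.mem_bases) hs
    linarith [hq.2 N hN h1 h2]

end Data

end KPSoliton

end

noncomputable section

namespace KPSoliton

namespace Data

variable {k n : ℕ} {C : Data k n}

/-! ### Boundary vertices -/

theorem plabicGraph_boundary_iff {π : Equiv.Perm (Fin n)} {i : Fin n} {d : C.Piece} :
    (C.plabicGraph π).boundary i d ↔ C.FromInfinity d.1.1 d.1.2 ∧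
      symmDiff d.1.1 d.1.2 = {π.symm i, i} ∧
      ((π.symm i < i ∧ (C.direction d.1.1 d.1.2).2 < 0) ∨
        (i < π.symm i ∧ 0 < (C.direction d.1.1 d.1.2).2)) := Iff.rfl

/-- The vertical component of the direction is κ_r - κ_l, so the sign condition in the boundary
labelling determines which of the two indices is on the left. -/
theorem Follows.of_boundary (hC : C.Admissible) {π : Equiv.Perm (Fin n)} {i : Fin n} {d : C.Piece}
    (h : (C.plabicGraph π).boundary i d) :
    d.1.1 \ d.1.2 = {i} ∧ d.1.2 \ d.1.1 = {π.symm i} := by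
  obtain ⟨-, htype, hdir⟩ := plabicGraph_boundary_iff.1 h
  obtain ⟨⟨L, R⟩, hs⟩ := d
  have hadj : Adjacent L R := ⟨hs.1, hs.2.1⟩
  obtain ⟨l, r, hl, hr⟩ := hadj.exists_sdiff
  simp only at *
  have hlr : ∀ x, (x = l ∨ x = r) ↔ (x = π.symm i ∨ x = i) := by
    intro x
    have := Finset.ext_iff.1 htype x
    rw [symmDiff_def, Finset.sup_eq_union, hl, hr] at this
    simpa using this
  have hd : (C.direction L R).2 = C.κ r - C.κ l := by
    rw [direction_eq, charge_sub_of_sdiff hl hr]; ring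
  have hne : l ≠ r := by
    rintro rfl
    exact (mem_sdiff_of_eq hl).2 (mem_sdiff_of_eq hr).1
  have hmono := hC.strictMono
  rw [hd, sub_neg, sub_pos, hmono.lt_iff_lt, hmono.lt_iff_lt] at hdir
  rcases (hlr i).2 (Or.inr rfl) with rfl | rfl
  · rcases (hlr r).1 (Or.inr rfl) with h' | h'
    · exact ⟨hl, by rw [hr, h']⟩
    · exact (hne h'.symm).elim
  · rcases (hlr l).1 (Or.inl rfl) with h' | h'
    · rw [← h'] at hdir
      rcases hdir with h | h
      · exact (lt_asymm h.1 h.2).elim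
      · exact (lt_asymm h.1 h.2).elim
    · exact (hne h').elim

theorem boundary_of_fromInfinity (hC : C.Admissible) {π : Equiv.Perm (Fin n)}
    (hπ : IsCellPermutation C.bases π) (hcol : ∀ j, C.A.col j ≠ 0) {d : C.Piece}
    (hd : C.FromInfinity d.1.1 d.1.2) {l : Fin n} (hl : d.1.1 \ d.1.2 = {l}) :
    (C.plabicGraph π).boundary l d := by
  obtain ⟨⟨L, R⟩, hs⟩ := d
  have hadj : Adjacent L R := ⟨hs.1, hs.2.1⟩
  obtain ⟨-, r, -, hr⟩ := hadj.exists_sdiff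
  simp only at *
  have hne : r ≠ l := by
    rintro rfl
    exact (mem_sdiff_of_eq hl).2 (mem_sdiff_of_eq hr).1
  obtain ⟨hL, hR⟩ := isMaxWeight_of_fromInfinity hl hr hs hd
  have hne' : π.symm l ≠ l := fun e => hπ.1 l (by rw [Equiv.symm_apply_eq] at e; exact e.symm)
  obtain rfl := IsNextDependent.unique hne hne' (isNextDependent_of_isMaxWeight hC hl hr hL hR)
    (isNextDependent_symm hπ hcol l)
  have hdir : (C.direction L R).2 = C.κ (π.symm l) - C.κ l := by
    rw [direction_eq, charge_sub_of_sdiff hl hr]; ring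
  rw [plabicGraph_boundary_iff]
  refine ⟨hd, ?_, ?_⟩
  · rw [symmDiff_def, Finset.sup_eq_union, hl, hr, Finset.union_comm]; rfl
  · simp only
    rw [hdir, sub_neg, sub_pos, hC.strictMono.lt_iff_lt, hC.strictMono.lt_iff_lt, and_self, and_self]
    exact lt_or_gt_of_ne hne

theorem existsUnique_boundary (hC : C.Admissible) {π : Equiv.Perm (Fin n)}
    (hπ : IsCellPermutation C.bases π) (hcol : ∀ j, C.A.col j ≠ 0) (i : Fin n) :
    ∃! d, (C.plabicGraph π).boundary i d := by
  have hne : π.symm i ≠ i := fun e => hπ.1 i (by rw [Equiv.symm_apply_eq] at e; exact e.symm)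
  obtain ⟨L, R, hl, hr, hL, hR, huniq⟩ := exists_isMaxWeight_pair hC hcol hne
    (isNextDependent_symm hπ hcol i)
  obtain ⟨hs, hinf⟩ := exists_fromInfinity hC hl hr hL hR fun X hX => (huniq X hX).2.2
  refine ⟨⟨(L, R), hs⟩, boundary_of_fromInfinity hC hπ hcol hinf hl, ?_⟩
  rintro ⟨⟨X, Y⟩, hs'⟩ hb
  obtain ⟨hX, hY⟩ := Follows.of_boundary hC hb
  obtain ⟨mX, mY⟩ := isMaxWeight_of_fromInfinity hX hY hs' (plabicGraph_boundary_iff.1 hb).1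
  obtain rfl := (huniq X mX).1 (mem_sdiff_of_eq hX).1
  obtain rfl := (huniq Y mY).2.1 (mem_sdiff_of_eq hY).1
  rfl

/-! ### Labels of edges and regions -/

/-- Any two regions are connected by a sequence of regions, consecutive ones of which are separated
by line-solitons. -/
theorem live_induction (hC : C.Admissible) (hgen : C.IsGeneric) {S : Finset (Fin n) → Prop}
    (hS : ∀ L R, C.IsLineSoliton L R → S L → S R) {J₀ J : Finset (Fin n)} (h₀ : C.Live J₀)
    (hJ₀ : S J₀) (h : C.Live J) : S J := by
  -- All regions meeting at one point are linked through the solitons at that vertex or crossing;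
  -- across a phase-shift the link goes around the crossing.
  have point : ∀ p, ∀ K ∈ C.regionsAt p, ∀ K' ∈ C.regionsAt p, S K → S K' := by
    intro p K hK K' hK' hSK
    by_cases hKK : K = K'
    · exact hKK ▸ hSK
    by_cases hb : ∃ L R, C.IsLineSoliton L R ∧ p ∈ C.border L R
    · obtain ⟨L, R, hs, hp⟩ := hb
      have hp' : C.regionsAt p = {L, R} := hp
      rw [hp'] at hK hK'
      rcases hK with rfl | hK <;> rcases hK' with rfl | hK'
      · exact (hKK rfl).elim
      · obtain rfl : K' = R := hK'
        exact hS _ _ hs hSK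
      · obtain rfl : K = R := hK
        exact hS _ _ hs.symm hSK
      · exact (hKK (hK.trans hK'.symm)).elim
    · obtain ⟨Z, hZ, hpZ⟩ := exists_interaction (v := p) ⟨mem_contourPlot hC hKK hK hK', hb⟩
      rcases hgen Z hZ with ht | hx
      · obtain ⟨v, L, R, N, rfl, htr⟩ := IsTrivalent.tripod hC hZ ht
        obtain rfl : p = v := hpZ
        have s1 := (htr.soliton hC).1
        have s2 := (htr.rotate.soliton hC).1
        have s3 := (htr.rotate.rotate.soliton hC).1
        rcases (htr.mem_iff K).1 hK with rfl | rfl | rfl <;>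
          rcases (htr.mem_iff K').1 hK' with rfl | rfl | rfl
        · exact hSK
        · exact hS _ _ s1 hSK
        · exact hS _ _ s2.symm hSK
        · exact hS _ _ s1.symm hSK
        · exact hSK
        · exact hS _ _ s3 hSK
        · exact hS _ _ s2 hSK
        · exact hS _ _ s3.symm hSK
        · exact hSK
      · obtain ⟨A, hA⟩ := hx.crossing hZ
        obtain ⟨m, rfl⟩ := (hA.mem_iff K).1 ⟨p, hK, hpZ⟩
        obtain ⟨m', rfl⟩ := (hA.mem_iff K').1 ⟨p, hK', hpZ⟩
        have step : ∀ j, S (A j) → S (A (j + 1)) := fun j => hS _ _ (hA.soliton j).symm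
        have e1 : m + 1 + 1 = m + 2 := by rw [add_assoc]; rfl
        have e2 : m + 2 + 1 = m + 3 := by rw [add_assoc]; rfl
        have t1 := step m hSK
        have t2 := step _ t1
        rw [e1] at t2
        have t3 := step _ t2
        rw [e2] at t3
        rcases fin_four_cases m m' with rfl | rfl | rfl | rfl
        exacts [hSK, t1, t2, t3]
  by_contra hJ
  have hclosed : ∀ T : Finset (Fin n) → Prop, IsClosed (⋃ K : {K // T K}, closure (C.region K.1)) :=
    fun T => isClosed_iUnion_of_finite fun _ => isClosed_closure
  -- The closures of the regions with `S` and of those without form two closed sets covering the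
  -- connected plane, so they share a point, contradicting `point`.
  have := isPreconnected_closed_iff.1 (isPreconnected_univ (α := ℝ × ℝ)) _ _ (hclosed S)
    (hclosed fun K => ¬ S K) (fun p _ => by
      obtain ⟨K, hK⟩ := exists_mem_regionsAt hC p
      by_cases hSK : S K
      · exact Or.inl (Set.mem_iUnion.2 ⟨⟨K, hSK⟩, hK⟩)
      · exact Or.inr (Set.mem_iUnion.2 ⟨⟨K, hSK⟩, hK⟩))
    ⟨h₀.some, trivial, Set.mem_iUnion.2 ⟨⟨J₀, hJ₀⟩, subset_closure h₀.some_mem⟩⟩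
    ⟨h.some, trivial, Set.mem_iUnion.2 ⟨⟨J, hJ⟩, subset_closure h.some_mem⟩⟩
  obtain ⟨p, -, hp1, hp2⟩ := this
  obtain ⟨⟨K, hK⟩, hKp⟩ := Set.mem_iUnion.1 hp1
  obtain ⟨⟨K', hK'⟩, hKp'⟩ := Set.mem_iUnion.1 hp2
  exact hK' (point p K hKp K' hKp' hK)

/-- Forwards, the property holds at the boundary and is preserved by every turn; backwards, every
such piece comes from an unbounded one, whose boundary label is necessarily i. -/
theorem inTrip_iff (hC : C.Admissible) (hgen : C.IsGeneric) {π : Equiv.Perm (Fin n)}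
    (hπ : IsCellPermutation C.bases π) (hcol : ∀ j, C.A.col j ≠ 0) (i : Fin n) (d : C.Piece) :
    (C.plabicGraph π).InTrip i d ↔ Follows i d := by
  constructor
  · rintro ⟨s, hs, h⟩
    induction h with
    | refl => exact mem_sdiff_of_eq (Follows.of_boundary hC hs).1
    | tail _ h ih => exact ih.next hC hgen h
  · intro hd
    refine Follows.induction hC hgen π (P := fun d => (C.plabicGraph π).InTrip i d) ?_ ?_ d hd
    · intro d hd hinf
      have hadj : Adjacent d.1.1 d.1.2 := ⟨d.2.1, d.2.2.1⟩
      exact ⟨d, boundary_of_fromInfinity hC hπ hcol hinf (hadj.sdiff_eq hd.1 hd.2), .refl⟩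
    · rintro d d' ⟨s, hs, h⟩ hn
      exact ⟨s, hs, h.tail hn⟩

theorem edgeHasLabel_iff (hC : C.Admissible) (hgen : C.IsGeneric) {π : Equiv.Perm (Fin n)}
    (hπ : IsCellPermutation C.bases π) (hcol : ∀ j, C.A.col j ≠ 0) (i : Fin n) (d : C.Piece) :
    (C.plabicGraph π).EdgeHasLabel i d ↔ i ∈ symmDiff d.1.1 d.1.2 := by
  rw [Finset.mem_symmDiff]
  exact or_congr (inTrip_iff hC hgen hπ hcol i d)
    (inTrip_iff hC hgen hπ hcol i ((C.plabicGraph π).rev d))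

/-- A piece entered from the boundary vertex j has j on its left and π⁻¹ j on its right. Traversed
outwards, it has π⁻¹ j on its left only, so it belongs to the trip of π⁻¹ j alone. -/
theorem tripEndsAt_iff (hC : C.Admissible) (hgen : C.IsGeneric) {π : Equiv.Perm (Fin n)}
    (hπ : IsCellPermutation C.bases π) (hcol : ∀ j, C.A.col j ≠ 0) (i j : Fin n) :
    (C.plabicGraph π).TripEndsAt i j ↔ π i = j := by
  constructor
  · rintro ⟨d, hd, hb⟩
    have hd : Follows i d := (inTrip_iff hC hgen hπ hcol i d).1 hd
    have h1 : d.1.1 \ d.1.2 = {π.symm j} := (Follows.of_boundary hC hb).2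
    have h2 : i ∈ d.1.1 \ d.1.2 := Finset.mem_sdiff.2 hd
    rw [h1, Finset.mem_singleton] at h2
    rw [h2, Equiv.apply_symm_apply]
  · rintro rfl
    obtain ⟨e, he, -⟩ := existsUnique_boundary hC hπ hcol (π i)
    refine ⟨(C.plabicGraph π).rev e, (inTrip_iff hC hgen hπ hcol i _).2 ?_, he⟩
    have h1 : e.1.2 \ e.1.1 = {π.symm (π i)} := (Follows.of_boundary hC he).2
    rw [Equiv.symm_apply_apply] at h1
    exact mem_sdiff_of_eq h1

theorem regionHasLabel_iff (hC : C.Admissible) (hgen : C.IsGeneric) {π : Equiv.Perm (Fin n)}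
    (hπ : IsCellPermutation C.bases π) (hcol : ∀ j, C.A.col j ≠ 0) (i : Fin n) (J : C.Region) :
    (C.plabicGraph π).RegionHasLabel i J ↔ i ∈ J.1 := by
  set step : C.Region → C.Region → Prop := fun P Q => ∃ e : C.Piece,
    ¬ (C.plabicGraph π).EdgeHasLabel i e ∧ (C.plabicGraph π).left e = P ∧
      (C.plabicGraph π).left ((C.plabicGraph π).rev e) = Q with hstep
  have step_iff : ∀ P Q, step P Q → (i ∈ P.1 ↔ i ∈ Q.1) := by
    rintro _ _ ⟨e, he, rfl, rfl⟩
    rw [edgeHasLabel_iff hC hgen hπ hcol, Finset.mem_symmDiff] at he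
    change i ∈ e.1.1 ↔ i ∈ e.1.2
    tauto
  have path_iff : ∀ P Q, Relation.ReflTransGen step P Q → (i ∈ P.1 ↔ i ∈ Q.1) := by
    intro P Q h
    induction h with
    | refl => exact Iff.rfl
    | tail _ h ih => exact ih.trans (step_iff _ _ h)
  constructor
  · rintro ⟨d, hd, h⟩
    exact (path_iff _ _ h).1 ((inTrip_iff hC hgen hπ hcol i d).1 hd).1
  · intro hi
    by_contra hcon
    obtain ⟨d, hd, -⟩ := existsUnique_boundary hC hπ hcol i
    have hdf : Follows i d := mem_sdiff_of_eq (Follows.of_boundary hC hd).1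
    -- The regions linked to `J` without crossing T_i are spread to all neighbours. A piece of T_i
    -- on the way would have i on the side linked to `J`, hence that side as its left, and would
    -- already label `J`. So even the region on the left of the first piece of T_i is linked to `J`,
    -- which is again a contradiction.
    have hall := live_induction hC hgen
      (S := fun K => ∃ hK : C.Live K, Relation.ReflTransGen step ⟨K, hK⟩ J) ?_ J.2
      ⟨J.2, .refl⟩ (d.2.live.1)
    · obtain ⟨hK, hpath⟩ := hall
      exact hcon ⟨d, (inTrip_iff hC hgen hπ hcol i d).2 hdf, hpath⟩
    · rintro K K' hs ⟨hK, hpath⟩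
      refine ⟨hs.live.2, .head ⟨⟨(K', K), hs.symm⟩, fun he => ?_, rfl, rfl⟩ hpath⟩
      have hiK : i ∈ K := (path_iff _ _ hpath).2 hi
      rw [edgeHasLabel_iff hC hgen hπ hcol, Finset.mem_symmDiff] at he
      have hf : Follows i (⟨(K, K'), hs⟩ : C.Piece) := by
        rcases he with he | he
        exacts [(he.2 hiK).elim, he]
      exact hcon ⟨⟨(K, K'), hs⟩, (inTrip_iff hC hgen hπ hcol i _).2 hf, hpath⟩

end Data

/-! ### Reduction to the standing assumptions -/

theorem col_ne_zero_of_irreducibleCell {k n : ℕ} {M : Finset (Finset (Fin n))}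
    (hM : IrreducibleCell k M) {A : Matrix (Fin k) (Fin n) ℝ} (hA : A ∈ positroidCell k M)
    (j : Fin n) : A.col j ≠ 0 := by
  intro h
  obtain ⟨B, p, -, ⟨g, -, rfl⟩, hB, -⟩ := hM A hA
  obtain ⟨i, hi⟩ := hB j
  apply hi
  rw [Matrix.mul_apply]
  exact Finset.sum_eq_zero fun x _ => by
    rw [show A x j = 0 from congrFun h x, mul_zero]

end KPSoliton

end

theorem mainTheorem9 {k n : ℕ}
    -- fixed generic parameters
    (κ : Fin n → ℝ) (hκ : StrictMono κ) (hκgen : KPSoliton.GenericParameters k κ)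
    -- an irreducible positroid cell, indexed by the derangement `π`, and a point of it
    (M : Finset (Finset (Fin n))) (π : Equiv.Perm (Fin n))
    (hM : KPSoliton.IrreducibleCell k M) (hπ : KPSoliton.IsCellPermutation M π)
    (A : Matrix (Fin k) (Fin n) ℝ) (hA : A ∈ KPSoliton.positroidCell k M)
    -- a time at which the contour plot is generic
    (t : ℝ) (C : KPSoliton.Data k n) (hC : C = ⟨κ, A, t⟩) (hgen : C.IsGeneric) :
    -- `Pl(C)` has `n` boundary vertices, the ends of the unbounded line-solitons, and these are
    -- labelled bijectively
    ((∀ i, ∃! d, (C.plabicGraph π).boundary i d) ∧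
      ∀ d : C.Piece, C.FromInfinity d.1.1 d.1.2 →
        ∃! i, (C.plabicGraph π).boundary i d) ∧
    -- the trip permutation is `π`
    (∀ i j, (C.plabicGraph π).TripEndsAt i j ↔ π i = j) ∧
    -- the labels of the edges are the types of the line-solitons
    (∀ d : C.Piece,
      {i | (C.plabicGraph π).EdgeHasLabel i d} = (C.edgeLabel d : Set (Fin n))) ∧
    -- the labels of the regions are the dominant exponentials
    (∀ J : C.Region,
      {i | (C.plabicGraph π).RegionHasLabel i J} = (C.regionLabel J : Set (Fin n))) := by
  open KPSoliton KPSoliton.Data in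
  have hcol : ∀ j, C.A.col j ≠ 0 := by
    subst hC
    exact col_ne_zero_of_irreducibleCell hM hA
  have hbases : C.bases = M := by
    subst hC
    ext J
    rw [mem_bases]
    constructor
    · rintro ⟨h1, h2⟩
      by_contra hJ
      exact h2 (hA.2.2 J h1 hJ)
    · intro hJ
      have h := hA.2.1 J hJ
      refine ⟨?_, h.ne'⟩
      -- `minor` has the default value 0 on sets of the wrong size, so positivity forces k elements.
      by_contra hcard
      rw [minor, dif_neg hcard] at h
      exact lt_irrefl _ h
  -- For n = 0 the necklace is empty and yields no basis; but then there are neither indices nor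
  -- pieces, and every claim is vacuous or an equality of empty sets.
  rcases isEmpty_or_nonempty (Fin n) with hempty | ⟨⟨i₀⟩⟩
  · have noPiece : C.Piece → False := fun d => by
      obtain ⟨i, -⟩ := Finset.card_eq_one.1 d.2.1
      exact hempty.elim i
    exact ⟨⟨fun i => hempty.elim i, fun d => (noPiece d).elim⟩, fun i => hempty.elim i,
      fun d => (noPiece d).elim, fun J => Set.ext fun i => hempty.elim i⟩
  have hAdm : C.Admissible := by
    obtain ⟨-, I, hI, -⟩ := id hπ
    refine ⟨?_, ?_, ?_⟩
    · subst hC; exact hκ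
    · subst hC; exact hκgen
    · rw [hbases]; exact ⟨I i₀, (hI i₀).1⟩
  rw [← hbases] at hπ
  refine ⟨⟨existsUnique_boundary hAdm hπ hcol, fun d hd => ?_⟩, tripEndsAt_iff hAdm hgen hπ hcol,
    fun d => Set.ext fun i => ?_, fun J => Set.ext fun i => ?_⟩
  · obtain ⟨l, hl⟩ := Finset.card_eq_one.1 d.2.1
    refine ⟨l, boundary_of_fromInfinity hAdm hπ hcol hd hl, fun i hi => ?_⟩
    have := (Follows.of_boundary hAdm hi).1
    rw [hl, Finset.singleton_inj] at this
    exact this.symm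
  · exact edgeHasLabel_iff hAdm hgen hπ hcol i d
  · exact regionHasLabel_iff hAdm hgen hπ hcol i J
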